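/- **Setting.** Let $n\ge 1$, $l\ge 0$, $\alpha\in(0,1)$, let $\xi$ be an $\mathbb{R}^{n_0}$-valued random vector, and let $f:\mathbb{R}^n\to\mathbb{R}$, $c_1:\mathbb{R}^n\times\mathbb{R}^{n_0}\to\mathbb{R}$ and $c_2:\mathbb{R}^n\to\mathbb{R}^{l}$ be differentiable. Let $Q(x)=\inf\{q:\mathbb{P}[c_1(x,\xi)\le q]\ge 1-\alpha\}$, $g_0=Q$, $g_i=c_{2,i}$ $(1\le i\le l)$, and for $\rho>0$, $\mu\in\mathbb{R}^{l+1}$ let $$\Phi(x,\rho,\mu)=f(x)+\frac{\rho}{2}\sum_{i=0}^{l}\max\{0,g_i(x)+\mu_i/\rho\}^2 .$$ Let $S\subset\mathbb{R}^n$ be open and bounded, and assume: $f,g_0,\dots,g_l$ are $C^1$ on $S$, with $\nabla f$ being $L_f$-Lipschitz and every $\nabla g_i$ being $L_g$-Lipschitz on $S$ ($L_g>0$); for every $x\in S$ the variable $c_1(x,\xi)$ has a $C^1$ Lebesgue density $p(\cdot\,;x)$; and there are $p_0,t_0>0$ with $p(q;x)\ge p_0$ whenever $x\in S$ and $|q-Q(x)|\le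 t_0$. Let $B_H$ be a real number and let $K$ satisfy $K\ge L_f+B_H+2L_g$ and $K\ge(\|\nabla g_i(x)\|+|g_i(x)|+L_g)^2$ for all $x\in S$, $0\le i\le l$. **Sampled quantities.** For a batch of $N$ samples of $\xi$ let $Q_N(x)$ be the $\lceil(1-\alpha)N\rceil$-th smallest of the values of $c_1(x,\cdot)$ on the batch; let $\Phi_N$ be $\Phi$ with $Q$ replaced by $Q_N$; let $$G_N(x)=\sum_{j=1}^n\frac{Q_N(x+\beta e_j)-Q_N(x-\beta e_j)}{2\beta}e_j,$$ $$\phi_N(x)=\nabla f(x)+\rho\max\{0,Q_N(x)+\mu_0/\rho\}\,G_N(x)+\rho\sum_{i=1}^{l}\max\{0,g_i(x)+\mu_i/\rho\}\nabla g_i(x),$$ and let $\sigma_N(x,\mu)=\big(\min\{-Q_N(x),\mu_0\}^2+\sum_{i=1}^l\min\{-g_i(x),\mu_i\}^2\big)^{1/2}$. **Inner (trust-region) method** with fixed parameters $0<\gamma_{\rm dec}<1<\gamma_{\rm inc}$, $\eta_1,\eta_2,r_0,\Delta_0,\varepsilon\in(0,1)$, $\theta>0$, applied with inputs $(\rho,\mu,r)$,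 $0<r<1$, from a starting point $x^0$. For $k=0,1,\dots$: choose a sample size $N_k$ (a function of the past), set $\beta=r_0\Delta_k$, draw a batch of $N_k$ i.i.d. samples and form $$m_k(y)=\Phi_{N_k}(x^k)+\phi_{N_k}(x^k)^{\top}(y-x^k)+\tfrac12(y-x^k)^{\top}H_k(y-x^k),$$ where $\|H_k\|\le B_H$ and $H_k$ is a measurable function of the past and of this batch; let $s^k$ be a (measurably selected) minimizer of $m_k(x^k+s)$ over $\|s\|\le\Delta_k$. If $m_k(x^k)-m_k(x^k+s^k)\ge\eta_1\min\{\Delta_k,\Delta_k^2\}$ and $$\frac{\Phi_{N_k}(x^k)-\Phi_{N_k}(x^k+s^k)}{m_k(x^k)-m_k(x^k+s^k)}\ge\eta_2,$$ the two values of $\Phi_{N_k}$ in the numerator being computed from one fresh batch of $N_k$ samples, then $x^{k+1}=x^k+s^k$ and $\Delta_{k+1}=\min\{1,\gamma_{\rm inc}\Delta_k\}$; otherwise $x^{k+1}=x^k$ and $\Delta_{k+1}=\gamma_{\rm dec}\Delta_k$. Return $x^k$ for the first $k$ with $\Delta_{k+1}\le r$. **Outer (augmented Lagrangian) method** with $\theta_\rho>1$,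 $\mu_{\max}>0$, $\rho^1>0$, real tolerances $\eta^m$, radii $r^m\in(0,1)$ (functions of the past), and $\mu^1_i=\bar\mu^1_i=1$. For $m=1,2,\dots$: $x^m$ is the output of the inner method started at $x^{m-1}$ with inputs $(\rho^m,\bar\mu^m,r^m)$; with a fresh batch of $N^m\ge1$ samples ($N^m$ a function of the past) set $\mu_0^{m+1}=\max\{0,\bar\mu_0^m+\rho^mQ_{N^m}(x^m)\}$, $\mu_i^{m+1}=\max\{0,\bar\mu_i^m+\rho^mg_i(x^m)\}$ for $i\ge1$, and $\bar\mu^{m+1}_i=\min\{\mu_{\max},\mu_i^{m+1}\}$ for all $i$; set $\rho^{m+1}=\theta_\rho\rho^m$ if $\sigma_{N^m}(x^m,\mu^{m+1})>\eta^m$ and $\rho^{m+1}=\rho^m$ otherwise. All samples drawn are i.i.d. copies of $\xi$. Write $w=1+\sum_i\mu_i+\rho$, $L=wK$, $\kappa_{\rm eg}=6wK$, $\kappa_{\rm ef}=5wK$, $$\mathcal L_1=\max\Big\{2L+\kappa_{\rm eg},\ \frac{(3-\eta_2)\kappa_{\rm eg}+4\kappa_{\rm ef}}{1-\eta_2},\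 \frac{2L}{\gamma_{\rm inc}-1},\ \frac{L}{\gamma_{\rm inc}}\Big(\frac{1-\gamma_{\rm dec}}{\gamma_{\rm dec}}-\frac{1-\gamma_{\rm inc}}{\gamma_{\rm inc}}\Big)^{-1}\Big\},$$ $$\mathcal L(\rho,\mu)=\max\{\mathcal L_1/\gamma_{\rm dec},\ L+\mathcal L_1\},\qquad \Psi^m=\max\Big\{\frac{\|\nabla\Phi(x^{m-1},\rho^m,\bar\mu^m)\|}{\Delta_0},\ \mathcal L(\rho^m,\bar\mu^m)\Big\}.$$ **Lemma.** There are constants $C_S,d_S>0$, depending only on the problem data and on the fixed parameters of the inner and outer methods (not on $x^0$, $\rho^1$, $\eta^m$, $r^m$, the iteration numbers or the sample path), such that the following holds for every run of the outer method. Assume that almost surely, in every inner iteration $k$ of every outer iteration $m$ that is carried out, the closed ball of radius $\Delta_k$ around $x^k$ lies in $S$ and $$N_k\ \ge\ \frac{C_S^2\,n^2\,\alpha(1-\alpha)\,(\log\frac n\varepsilon)^3}{A_k\,\Delta_k^4},$$ $$A_k=\min\Big\{d_S^2L_g^2r_0^2,\ d_S^2\rho\eta_1\eta_2,\ d_S^2\rho\sqrt{\eta_1\eta_2\theta},\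 \frac{d_S^2\eta_1^2\eta_2^2}{(\mu_0+\rho K)^2},\ \frac{d_S^2\eta_1\eta_2\theta}{(\mu_0+\rho K)^2}\Big\}$$ with $\rho=\rho^m$, $\mu_0=\bar\mu_0^m$. Assume also that for some $\sigma>0$ and some $C$, almost surely $r^m\le \dfrac{C}{\Psi^m m^{3+\sigma}}$ for all $m\ge1$. Then almost surely every inner run terminates, and for every subsequence $\mathcal M$ of $\mathbb{N}$, almost surely there is a subsequence $\mathcal M'\subseteq\mathcal M$ with $$\lim_{m\in\mathcal M'}\|\nabla\Phi(x^m,\rho^m,\bar\mu^m)\|=0 .$$ -/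

import Mathlib

open MeasureTheory ProbabilityTheory Filter Topology

universe u

noncomputable section

namespace QuantileALM

/-- `ℝⁿ` with the Euclidean norm. -/
abbrev Vec (n : ℕ) : Type := EuclideanSpace ℝ (Fin n)

/-! ### The chance-constrained program and its quantile reformulation -/

/-- Data of `min f(x)  s.t.  P[c₁(x,ξ) ≤ 0] ≥ 1 - α,  c₂(x) ≤ 0`, where `ξ` has law `ν`. -/
structure Problem (n n₀ l : ℕ) where
  f : Vec n → ℝ
  c₁ : Vec n → Vec n₀ → ℝ
  c₂ : Fin l → Vec n → ℝ
  ν : Measure (Vec n₀)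
  α : ℝ

/-- The empirical `(1-α)`-quantile of `N` numbers: sort them in ascending order and take the
`⌈(1-α)N⌉`-th one (counting from one). -/
def empQuantile (α : ℝ) {N : ℕ} (v : Fin N → ℝ) : ℝ :=
  if h : ⌈(1 - α) * (N : ℝ)⌉₊ - 1 < N then v (Tuple.sort v ⟨⌈(1 - α) * (N : ℝ)⌉₊ - 1, h⟩) else 0

/-- The augmented Lagrangian
`f(x) + (ρ/2) ∑ᵢ max{0, gᵢ(x) + μᵢ/ρ}²`. -/
def augLagrangian {n k : ℕ} (f : Vec n → ℝ) (g : Fin k → Vec n → ℝ) (ρ : ℝ) (μ : Fin k → ℝ)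
    (x : Vec n) : ℝ :=
  f x + ρ / 2 * ∑ i, (max 0 (g i x + μ i / ρ)) ^ 2

namespace Problem

variable {n n₀ l : ℕ} (P : Problem n n₀ l)

/-- The (smallest) `(1-α)`-quantile `Q(x)` of the random variable `c₁(x,ξ)`. -/
def Q (x : Vec n) : ℝ :=
  sInf {q : ℝ | 1 - P.α ≤ P.ν.real {z | P.c₁ x z ≤ q}}

/-- The constraint functions `g₀ = Q`, `gᵢ = c₂ᵢ`; index `0` is the quantile constraint. -/
def g : Fin (l + 1) → Vec n → ℝ :=
  Fin.cons (α := fun _ => Vec n → ℝ) P.Q P.c₂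

/-- The merit function `Φ(x,ρ,μ)`. -/
def Phi (ρ : ℝ) (μ : Fin (l + 1) → ℝ) (x : Vec n) : ℝ :=
  augLagrangian P.f P.g ρ μ x

/-- The empirical quantile `Q_N(x)` from the first `N` samples of the batch `z`. -/
def QN (N : ℕ) (z : ℕ → Vec n₀) (x : Vec n) : ℝ :=
  empQuantile P.α fun i : Fin N => P.c₁ x (z i)

/-- The constraint functions with `g₀` replaced by its `N`-sample estimate. -/
def gN (N : ℕ) (z : ℕ → Vec n₀) : Fin (l + 1) → Vec n → ℝ :=
  Fin.cons (α := fun _ => Vec n → ℝ) (P.QN N z) P.c₂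

/-- The `N`-sample approximation `Φ_N(x,ρ,μ)` of the merit function. -/
def PhiN (N : ℕ) (z : ℕ → Vec n₀) (ρ : ℝ) (μ : Fin (l + 1) → ℝ) (x : Vec n) : ℝ :=
  augLagrangian P.f (P.gN N z) ρ μ x

/-- The central finite-difference estimate `G_N(x)` of `∇Q(x)` with step `β`. -/
def GN (N : ℕ) (z : ℕ → Vec n₀) (β : ℝ) (x : Vec n) : Vec n :=
  ∑ j : Fin n,
    ((P.QN N z (x + β • EuclideanSpace.single j (1 : ℝ))
        - P.QN N z (x - β • EuclideanSpace.single j (1 : ℝ))) / (2 * β))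
      • EuclideanSpace.single j (1 : ℝ)

/-- The estimate `φ_N(x,ρ,μ,β)` of `∇Φ(x,ρ,μ)`. -/
def phiN (N : ℕ) (z : ℕ → Vec n₀) (ρ : ℝ) (μ : Fin (l + 1) → ℝ) (β : ℝ) (x : Vec n) : Vec n :=
  gradient P.f x
    + (ρ * max 0 (P.QN N z x + μ 0 / ρ)) • P.GN N z β x
    + ∑ i : Fin l, (ρ * max 0 (P.c₂ i x + μ i.succ / ρ)) • gradient (P.c₂ i) x

/-- The quadratic local model around `x₀`,
`m_N(y) = Φ_N(x₀) + φ_N(x₀)ᵀ(y - x₀) + ½ (y - x₀)ᵀ H (y - x₀)`. -/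
def model (N : ℕ) (z : ℕ → Vec n₀) (ρ : ℝ) (μ : Fin (l + 1) → ℝ) (β : ℝ)
    (H : Vec n →L[ℝ] Vec n) (x₀ y : Vec n) : ℝ :=
  P.PhiN N z ρ μ x₀ + inner ℝ (P.phiN N z ρ μ β x₀) (y - x₀)
    + 1 / 2 * inner ℝ (y - x₀) (H (y - x₀))

/-- The infeasibility measure
`σ_N(x,μ) = (min{-g_{0,N}(x), μ₀}² + ∑ᵢ min{-gᵢ(x), μᵢ}²)^{1/2}`. -/
def sigmaN (N : ℕ) (z : ℕ → Vec n₀) (x : Vec n) (μ : Fin (l + 1) → ℝ) : ℝ :=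
  Real.sqrt (∑ i, (min (-(P.gN N z i x)) (μ i)) ^ 2)

/-- Standing regularity assumptions on the bounded open region `S`. -/
structure Regular (S : Set (Vec n)) (Lf Lg : ℝ) : Prop where
  prob : IsProbabilityMeasure P.ν
  alpha_pos : 0 < P.α
  alpha_lt : P.α < 1
  isOpen : IsOpen S
  isBounded : Bornology.IsBounded S
  diff_f : Differentiable ℝ P.f
  diff_c₁ : Differentiable ℝ fun p : Vec n × Vec n₀ => P.c₁ p.1 p.2
  diff_c₂ : ∀ i, Differentiable ℝ (P.c₂ i)
  /-- `f` is `C¹` on `S` with `Lf`-Lipschitz gradient. -/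
  contDiff_f : ContDiffOn ℝ 1 P.f S
  lip_f : ∀ x ∈ S, ∀ y ∈ S, ‖gradient P.f x - gradient P.f y‖ ≤ Lf * ‖x - y‖
  /-- The quantile function and all deterministic constraint functions are `C¹` on `S`, and
  `Lg` is a common Lipschitz constant of their gradients. -/
  contDiff_g : ∀ i, ContDiffOn ℝ 1 (P.g i) S
  Lg_pos : 0 < Lg
  lip_g : ∀ i, ∀ x ∈ S, ∀ y ∈ S, ‖gradient (P.g i) x - gradient (P.g i) y‖ ≤ Lg * ‖x - y‖
  /-- For `x ∈ S`, `c₁(x,ξ)` has a `C¹` Lebesgue density `p x`, which is bounded away from zero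
  near the quantile `Q(x)`, uniformly in `x`. -/
  density : ∃ p : Vec n → ℝ → ℝ,
    (∀ x ∈ S, ContDiff ℝ 1 (p x) ∧ (∀ t, 0 ≤ p x t) ∧
      P.ν.map (P.c₁ x) = volume.withDensity fun t => ENNReal.ofReal (p x t)) ∧
    ∃ p₀ t₀ : ℝ, 0 < p₀ ∧ 0 < t₀ ∧ ∀ x ∈ S, ∀ q : ℝ, |q - P.Q x| ≤ t₀ → p₀ ≤ p x q

end Problem

/-! ### The algorithm -/

/-- Parameters of the trust-region method (`γdec, γinc, η₁, η₂, r₀, Δ₀, ε`, and the accuracy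
parameter `θ`) and of the augmented Lagrangian method (`θρ, μmax`). -/
structure Params where
  γdec : ℝ
  γinc : ℝ
  η₁ : ℝ
  η₂ : ℝ
  r₀ : ℝ
  Δ₀ : ℝ
  ε : ℝ
  θ : ℝ
  θρ : ℝ
  μmax : ℝ

structure Params.Valid (A : Params) : Prop where
  γdec_pos : 0 < A.γdec
  γdec_lt : A.γdec < 1
  γinc_gt : 1 < A.γinc
  η₁_pos : 0 < A.η₁
  η₁_lt : A.η₁ < 1
  η₂_pos : 0 < A.η₂
  η₂_lt : A.η₂ < 1
  r₀_pos : 0 < A.r₀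
  r₀_lt : A.r₀ < 1
  Δ₀_pos : 0 < A.Δ₀
  Δ₀_lt : A.Δ₀ < 1
  ε_pos : 0 < A.ε
  ε_lt : A.ε < 1
  θ_pos : 0 < A.θ
  θρ_gt : 1 < A.θρ
  μmax_pos : 0 < A.μmax

/-- Labels of the random draws: the `i`-th draw of the batch used to build the model, resp. of the
batch used in the acceptance test, in inner iteration `k` of outer iteration `m`; and the `i`-th
draw used for the multiplier update of outer iteration `m`. -/
inductive Draw : Type
  | model (m k i : ℕ)
  | test (m k i : ℕ)
  | outer (m i : ℕ)

/-- Draws made before inner iteration `k` of outer iteration `m`. -/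
def Draw.Before (m k : ℕ) : Draw → Prop
  | .model m' k' _ => m' < m ∨ (m' = m ∧ k' < k)
  | .test m' k' _ => m' < m ∨ (m' = m ∧ k' < k)
  | .outer m' _ => m' < m

/-- Draws made before the acceptance test of inner iteration `k` of outer iteration `m`. -/
def Draw.BeforeTest (m k : ℕ) : Draw → Prop
  | .model m' k' _ => m' < m ∨ (m' = m ∧ k' ≤ k)
  | .test m' k' _ => m' < m ∨ (m' = m ∧ k' < k)
  | .outer m' _ => m' < m

/-- Draws made before the multiplier update of outer iteration `m`. -/
def Draw.BeforeUpdate (m : ℕ) : Draw → Prop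
  | .model m' _ _ => m' ≤ m
  | .test m' _ _ => m' ≤ m
  | .outer m' _ => m' < m

/-- The information carried by the draws whose label satisfies `B`. -/
abbrev info {n₀ : ℕ} {Ω : Type u} (ξ : Draw → Ω → Vec n₀) (B : Draw → Prop) : MeasurableSpace Ω :=
  ⨆ d : {d : Draw // B d}, MeasurableSpace.comap (ξ d) inferInstance

/-- A run of the probabilistic augmented Lagrangian method whose subproblems are treated by the
trust-region method. Outer iterations are numbered `m = 1, 2, …`; `X m k`, `Δ m k` are the
trust-region iterates and radii of outer iteration `m`, written down with the termination test
disregarded; the test is applied in `output`. -/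
structure Run {n n₀ l : ℕ} (P : Problem n n₀ l) (A : Params) {Ω : Type u} [MeasurableSpace Ω]
    (Pr : Measure Ω) where
  /-- the i.i.d. draws of the random parameter -/
  ξ : Draw → Ω → Vec n₀
  ξ_measurable : ∀ d, Measurable (ξ d)
  ξ_indep : iIndepFun ξ Pr
  ξ_law : ∀ d, Pr.map (ξ d) = P.ν
  /-- starting point, initial penalty parameter, tolerances -/
  xin : Vec n
  ρin : ℝ
  ρin_pos : 0 < ρin
  η : ℕ → ℝ
  /-- outer iterates, penalty parameters, multipliers, safeguarded multipliers -/
  x : ℕ → Ω → Vec n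
  ρ : ℕ → Ω → ℝ
  μ : ℕ → Ω → Fin (l + 1) → ℝ
  μbar : ℕ → Ω → Fin (l + 1) → ℝ
  /-- termination radii, fixed before outer iteration `m` starts -/
  r : ℕ → Ω → ℝ
  r_adapted : ∀ m, 1 ≤ m → Measurable[info ξ (Draw.Before m 0)] (r m)
  r_pos : ∀ m, 1 ≤ m → ∀ ω, 0 < r m ω
  r_lt : ∀ m, 1 ≤ m → ∀ ω, r m ω < 1
  /-- sample size in the multiplier update -/
  Nout : ℕ → Ω → ℕ
  Nout_pos : ∀ m, 1 ≤ m → ∀ ω, 0 < Nout m ω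
  Nout_adapted : ∀ m, 1 ≤ m → Measurable[info ξ (Draw.BeforeUpdate m)] (Nout m)
  /-- inner iterates, radii, sample sizes, model Hessians, trial steps -/
  X : ℕ → ℕ → Ω → Vec n
  Δ : ℕ → ℕ → Ω → ℝ
  N : ℕ → ℕ → Ω → ℕ
  H : ℕ → ℕ → Ω → (Vec n →L[ℝ] Vec n)
  s : ℕ → ℕ → Ω → Vec n
  N_adapted : ∀ m k, 1 ≤ m → Measurable[info ξ (Draw.Before m k)] (N m k)
  H_adapted : ∀ m k, 1 ≤ m → Measurable[info ξ (Draw.BeforeTest m k)] (H m k)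
  s_adapted : ∀ m k, 1 ≤ m → Measurable[info ξ (Draw.BeforeTest m k)] (s m k)
  /-- initialisation -/
  x_zero : ∀ ω, x 0 ω = xin
  ρ_one : ∀ ω, ρ 1 ω = ρin
  μ_one : ∀ ω i, μ 1 ω i = 1
  μbar_one : ∀ ω i, μbar 1 ω i = 1
  X_zero : ∀ m ω, X (m + 1) 0 ω = x m ω
  Δ_zero : ∀ m, 1 ≤ m → ∀ ω, Δ m 0 ω = A.Δ₀
  /-- the trial step minimises the model over the trust region -/
  s_mem : ∀ m k, 1 ≤ m → ∀ ω, ‖s m k ω‖ ≤ Δ m k ω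
  s_min : ∀ m k, 1 ≤ m → ∀ ω, ∀ v : Vec n, ‖v‖ ≤ Δ m k ω →
    P.model (N m k ω) (fun i => ξ (.model m k i) ω) (ρ m ω) (μbar m ω) (A.r₀ * Δ m k ω)
        (H m k ω) (X m k ω) (X m k ω + s m k ω)
      ≤ P.model (N m k ω) (fun i => ξ (.model m k i) ω) (ρ m ω) (μbar m ω) (A.r₀ * Δ m k ω)
        (H m k ω) (X m k ω) (X m k ω + v)
  /-- trust-region update: the step is accepted iff the model decrease
  `m_N(x) - m_N(x+s)` is at least `η₁ min{Δ, Δ²}` and the ratio of the estimated decrease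
  `Φ_N(x) - Φ_N(x+s)` to the model decrease is at least `η₂` -/
  step : ∀ m k, 1 ≤ m → ∀ ω,
    let mdl := P.model (N m k ω) (fun i => ξ (.model m k i) ω) (ρ m ω) (μbar m ω)
      (A.r₀ * Δ m k ω) (H m k ω) (X m k ω)
    let est := P.PhiN (N m k ω) (fun i => ξ (.test m k i) ω) (ρ m ω) (μbar m ω)
    let mdec := mdl (X m k ω) - mdl (X m k ω + s m k ω)
    let accept := A.η₁ * min (Δ m k ω) (Δ m k ω ^ 2) ≤ mdec ∧
      A.η₂ ≤ (est (X m k ω) - est (X m k ω + s m k ω)) / mdec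
    (accept → X m (k + 1) ω = X m k ω + s m k ω ∧
      Δ m (k + 1) ω = min 1 (A.γinc * Δ m k ω)) ∧
    (¬ accept → X m (k + 1) ω = X m k ω ∧ Δ m (k + 1) ω = A.γdec * Δ m k ω)
  /-- the inner method returns `X m k` for the first `k` with `Δ m (k+1) ≤ r m` -/
  output : ∀ m, 1 ≤ m → ∀ ω, x m ω = X m (sInf {k : ℕ | Δ m (k + 1) ω ≤ r m ω}) ω
  /-- update of multipliers and penalty parameter -/
  μ_succ : ∀ m, 1 ≤ m → ∀ ω i, μ (m + 1) ω i =
    max 0 (μbar m ω i + ρ m ω * P.gN (Nout m ω) (fun j => ξ (.outer m j) ω) i (x m ω))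
  μbar_succ : ∀ m, 1 ≤ m → ∀ ω i, μbar (m + 1) ω i = min A.μmax (μ (m + 1) ω i)
  ρ_succ : ∀ m, 1 ≤ m → ∀ ω, ρ (m + 1) ω =
    if η m < P.sigmaN (Nout m ω) (fun j => ξ (.outer m j) ω) (x m ω) (μ (m + 1) ω)
    then A.θρ * ρ m ω else ρ m ω

namespace Run

variable {n n₀ l : ℕ} {P : Problem n n₀ l} {A : Params} {Ω : Type u} [MeasurableSpace Ω]
  {Pr : Measure Ω} (R : Run P A Pr)

/-- Inner iteration `k` of outer iteration `m` is really carried out (no earlier termination). -/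
def Active (m k : ℕ) (ω : Ω) : Prop :=
  ∀ j < k, R.r m ω < R.Δ m (j + 1) ω

/-- The inner method terminates in outer iteration `m`. -/
def Terminates (m : ℕ) (ω : Ω) : Prop :=
  ∃ k, R.Δ m (k + 1) ω ≤ R.r m ω

/-- All trust regions used by the algorithm lie in `S`. -/
def StaysIn (S : Set (Vec n)) : Prop :=
  ∀ᵐ ω ∂Pr, ∀ m k, 1 ≤ m → R.Active m k ω → Metric.closedBall (R.X m k ω) (R.Δ m k ω) ⊆ S

end Run

/-! ### Constants in the sample-size and radius conditions -/

/-- The factor `A_k` in the sample-size condition, as a function of `ρ` and `μ₀`. -/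
def accFactor (A : Params) (dS Lg K ρ μ₀ : ℝ) : ℝ :=
  min (dS ^ 2 * Lg ^ 2 * A.r₀ ^ 2) <|
  min (dS ^ 2 * ρ * A.η₁ * A.η₂) <|
  min (dS ^ 2 * ρ * Real.sqrt (A.η₁ * A.η₂ * A.θ)) <|
  min (dS ^ 2 * A.η₁ ^ 2 * A.η₂ ^ 2 / (μ₀ + ρ * K) ^ 2)
    (dS ^ 2 * A.η₁ * A.η₂ * A.θ / (μ₀ + ρ * K) ^ 2)

/-- The sample-size condition
`N_k ≥ C_S² n² α(1-α) (log(n/ε))³ / (A_k Δ_k⁴)` in every inner iteration. -/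
def Run.SampleSizeCond {n n₀ l : ℕ} {P : Problem n n₀ l} {A : Params} {Ω : Type u}
    [MeasurableSpace Ω] {Pr : Measure Ω} (R : Run P A Pr) (CS dS Lg K : ℝ) : Prop :=
  ∀ᵐ ω ∂Pr, ∀ m k, 1 ≤ m → R.Active m k ω →
    CS ^ 2 * (n : ℝ) ^ 2 * (P.α * (1 - P.α)) * Real.log ((n : ℝ) / A.ε) ^ 3
        / (accFactor A dS Lg K (R.ρ m ω) (R.μbar m ω 0) * R.Δ m k ω ^ 4)
      ≤ (R.N m k ω : ℝ)

/-- The trust-region constant `𝓛(ρ,μ,K)`, built from the Lipschitz bound `w K` of `∇Φ` and the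
fully-linear constants `κ_eg = 6 w K`, `κ_ef = 5 w K`, where `w = 1 + ∑ᵢ μᵢ + ρ`. -/
def trConst {k : ℕ} (A : Params) (K ρ : ℝ) (μ : Fin k → ℝ) : ℝ :=
  let w := 1 + ∑ i, μ i + ρ
  let L := w * K
  let κeg := 6 * K * w
  let κef := 5 * K * w
  let L₁ := max (2 * L + κeg) <|
    max (((3 - A.η₂) * κeg + 4 * κef) / (1 - A.η₂)) <|
    max (2 * L / (A.γinc - 1))
      (L / A.γinc * ((1 - A.γdec) / A.γdec - (1 - A.γinc) / A.γinc)⁻¹)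
  max (L₁ / A.γdec) (L + L₁)

/-- `Ψᵐ = max{‖∇Φ(x^{m-1}, ρᵐ, μ̄ᵐ)‖ / Δ₀, 𝓛(ρᵐ, μ̄ᵐ, K)}`: the value at the starting point of the
inner method in outer iteration `m`. -/
def Run.Psi {n n₀ l : ℕ} {P : Problem n n₀ l} {A : Params} {Ω : Type u}
    [MeasurableSpace Ω] {Pr : Measure Ω} (R : Run P A Pr) (K : ℝ) (m : ℕ) (ω : Ω) : ℝ :=
  max (‖gradient (P.Phi (R.ρ m ω) (R.μbar m ω)) (R.X m 0 ω)‖ / R.Δ m 0 ω)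
    (trConst A K (R.ρ m ω) (R.μbar m ω))

end QuantileALM

end

noncomputable section

namespace QuantileALM

/-! ### Empirical quantiles as order statistics -/

/-! Fix an outer iteration and put `w = 1 + ∑ μ̄ᵢ + ρ`. On `S` the oscillation of `Φ`, the size of
`∇Φ` and, along each trust region, its Lipschitz constant are at most `c w`. The proof is a drift
argument for one potential, uniform in `w`.

Sampling. The density is at least `p₀` near the quantile, so Hoeffding's inequality gives `P(|Q_N -
Q| > t) ≤ 2 exp(-2N(p₀t)²)` (`measure_QN_dev`). Batches are independent of the past, so this remains
valid at random points, with random `N` and `t`, once the past is frozen (`lintegral_freeze`). Since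
`A_k w²` is bounded, a large `C_S` turns the sample-size condition into `N ≥ C₀ w²/Δ⁴` with `C₀` as
large as desired. Errors of order `Δ²` then have probability at most `p₁/w⁴` with `p₁` small.

Drift. With `Y = max(‖∇Φ‖/Δ, M w)` the potential is `r³ Y³ + C₁ (r/w) (Φ(x^k) - Φ(x^0) + c w + κ
Δ²)`. If all estimates of an iteration are accurate, the step is accepted unless `‖∇Φ‖/Δ ≤ M₁ w`
(`accept_of_accurate`). Acceptance enlarges the radius, so `Y` contracts by a factor `a < 1` down to
its floor `M w`. An inaccurate iteration raises `Y` by at most the factor `1/γdec`, at an expected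
cost of order `p₁ Y³/w⁴`. Well above the floor the contraction pays for this. Near the floor the
cost is of order `1/w`, and the energy pays: its decrease `c₁ Δ²`, weighted by `C₁ r/w`, is of order
`r³/w`, because active iterations have `Δ ≥ Δ₀ r`. An accepted step whose true decrease falls short
of `η₁η₂Δ²` by a significant `u` needs a test error above `t₃ u/w`, and `u` times the probability of
that is at most `c₁ Δ²/4`. Altogether the expected potential on the active event drops by at least
the expectation of `r³/w` there (`Tuning.drift_le`, `lintegral_drift`).

Conclusion. Summation over `k` shows that nontermination is a null event. The last inner step is a
rejection that leaves a radius at most `r`, so the final potential dominates `‖∇Φ(x^m)‖³`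
(`norm_grad_cube_le`). The initial potential is at most a constant times `(rw)³ + rw`, and `Ψ ≥ K w`
together with the radius condition gives `r w ≤ C/(K m)`. By Markov's inequality the gradients tend
to zero in probability, and every subsequence has a further one that converges almost surely. -/

theorem empQuantile_le_iff {α : ℝ} (hα : 0 < α) (hα1 : α < 1) {N : ℕ} (hN : 0 < N)
    (v : Fin N → ℝ) (q : ℝ) :
    empQuantile α v ≤ q ↔
      ⌈(1 - α) * (N : ℝ)⌉₊ ≤ (Finset.univ.filter fun i => v i ≤ q).card := by
  have hN' : (0 : ℝ) < N := by exact_mod_cast hN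
  have h1 : 0 < ⌈(1 - α) * (N : ℝ)⌉₊ := Nat.ceil_pos.2 (by nlinarith)
  have h2 : ⌈(1 - α) * (N : ℝ)⌉₊ ≤ N := Nat.ceil_le.2 (by nlinarith)
  have h : ⌈(1 - α) * (N : ℝ)⌉₊ - 1 < N := by omega
  have hmono := Tuple.monotone_sort v
  -- Indexing from zero: entry `k - 1` of the sorted tuple is at most `q` exactly when more than `k
  -- - 1` entries are.
  have key := Tuple.lt_card_le_iff_apply_le_of_monotone
    (j := ⟨⌈(1 - α) * (N : ℝ)⌉₊ - 1, h⟩) (a := q) hmono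
  have hcard : (Finset.univ.filter fun i => (v ∘ Tuple.sort v) i ≤ q).card
      = (Finset.univ.filter fun i => v i ≤ q).card := by
    refine Finset.card_equiv (Tuple.sort v) fun i => ?_
    simp
  unfold empQuantile
  rw [dif_pos h]
  simp only [Function.comp_apply] at key hcard
  rw [← key, hcard]
  show _ - 1 < _ ↔ _
  omega

theorem measurable_empQuantile {α : ℝ} (hα : 0 < α) (hα1 : α < 1) (N : ℕ) :
    Measurable fun v : Fin N → ℝ => empQuantile α v := by
  rcases Nat.eq_zero_or_pos N with rfl | hN
  · have : (fun v : Fin 0 → ℝ => empQuantile α v) = fun _ => 0 := by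
      funext v; simp [empQuantile]
    rw [this]; exact measurable_const
  refine measurable_of_Iic fun q => ?_
  -- Counting entries by a sum of indicators keeps the sorting permutation out of the measurability
  -- question.
  have : (fun v : Fin N → ℝ => empQuantile α v) ⁻¹' Set.Iic q
      = {v | (⌈(1 - α) * (N : ℝ)⌉₊ : ℝ) ≤ ∑ i, Set.indicator (Set.Iic q) (fun _ => (1 : ℝ)) (v i)} := by
    ext v
    simp only [Set.mem_preimage, Set.mem_Iic, Set.mem_ofPred_eq, empQuantile_le_iff hα hα1 hN]
    rw [Finset.card_filter, ← Nat.cast_le (α := ℝ)]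
    simp [Set.indicator_apply]
  rw [this]
  exact measurableSet_le measurable_const
    (Finset.measurable_sum _ fun i _ =>
      (measurable_const.indicator measurableSet_Iic).comp (measurable_pi_apply i))

/-! ### Quantiles of a probability measure on the line -/

/-- Right continuity of the distribution function lets the bound pass to the limit from above `q`;
`0 < a < 1` makes the set nonempty and bounded below. -/
theorem sInf_cdf_le_iff (κ : Measure ℝ) [IsProbabilityMeasure κ] {a : ℝ} (ha : 0 < a) (ha1 : a < 1)
    (q : ℝ) : sInf {q | a ≤ κ.real (Set.Iic q)} ≤ q ↔ a ≤ κ.real (Set.Iic q) := by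
  simp only [← cdf_eq_real]
  set T := {q | a ≤ cdf κ q} with hT
  have hne : T.Nonempty := by
    obtain ⟨q, hq⟩ := ((tendsto_cdf_atTop κ).eventually (lt_mem_nhds ha1)).exists
    exact ⟨q, hq.le⟩
  have hbd : BddBelow T := by
    obtain ⟨b, hb⟩ := ((tendsto_cdf_atBot κ).eventually (gt_mem_nhds ha)).exists
    refine ⟨b, fun q hq => ?_⟩
    by_contra! hlt
    have := monotone_cdf κ hlt.le
    exact absurd (le_trans hq this) (not_le.2 hb)
  refine ⟨fun h => ?_, fun h => csInf_le hbd h⟩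
  have hright : Tendsto (cdf κ) (𝓝[>] q) (𝓝 (cdf κ q)) :=
    ((cdf κ).right_continuous q).mono_left (nhdsWithin_mono _ Set.Ioi_subset_Ici_self)
  refine ge_of_tendsto hright ?_
  filter_upwards [self_mem_nhdsWithin] with s hs
  obtain ⟨c, hc, hcs⟩ := exists_lt_of_csInf_lt hne (lt_of_le_of_lt h hs)
  exact le_trans hc (monotone_cdf κ hcs.le)

theorem real_Iic_add_le (κ : Measure ℝ) [IsProbabilityMeasure κ] {p : ℝ → ℝ}
    (hκ : κ = volume.withDensity fun t => ENNReal.ofReal (p t)) {a b p₀ : ℝ} (hab : a ≤ b)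
    (hp₀ : 0 ≤ p₀) (hp : ∀ t, a ≤ t → t ≤ b → p₀ ≤ p t) :
    κ.real (Set.Iic a) + p₀ * (b - a) ≤ κ.real (Set.Iic b) := by
  have h1 : κ.real (Set.Iic b) = κ.real (Set.Iic a) + κ.real (Set.Ioc a b) := by
    rw [← measureReal_union (Set.Iic_disjoint_Ioc le_rfl) measurableSet_Ioc,
      Set.Iic_union_Ioc_eq_Iic hab]
  have h2 : ENNReal.ofReal (p₀ * (b - a)) ≤ κ (Set.Ioc a b) := by
    rw [hκ, withDensity_apply _ measurableSet_Ioc]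
    calc ENNReal.ofReal (p₀ * (b - a))
        = ∫⁻ _ in Set.Ioc a b, ENNReal.ofReal p₀ := by
          rw [setLIntegral_const, Real.volume_Ioc, ENNReal.ofReal_mul hp₀]
      _ ≤ _ := setLIntegral_mono' measurableSet_Ioc
          fun t ht => ENNReal.ofReal_le_ofReal (hp t ht.1.le ht.2)
  have h3 : p₀ * (b - a) ≤ κ.real (Set.Ioc a b) :=
    (ENNReal.ofReal_le_iff_le_toReal (measure_ne_top κ _)).1 h2
  linarith

/-! ### Population quantiles of the chance constraint -/

namespace Problem

variable {n n₀ l : ℕ} {P : Problem n n₀ l} {S : Set (Vec n)} {Lf Lg : ℝ}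

theorem Regular.measurable_c₁ (hP : P.Regular S Lf Lg) :
    Measurable fun p : Vec n × Vec n₀ => P.c₁ p.1 p.2 :=
  hP.diff_c₁.continuous.measurable

theorem Regular.measurable_c₁_apply (hP : P.Regular S Lf Lg) (x : Vec n) :
    Measurable (P.c₁ x) :=
  hP.measurable_c₁.comp measurable_prodMk_left

theorem Regular.real_map_Iic (hP : P.Regular S Lf Lg) (x : Vec n) (q : ℝ) :
    (P.ν.map (P.c₁ x)).real (Set.Iic q) = P.ν.real {z | P.c₁ x z ≤ q} := by
  rw [map_measureReal_apply (hP.measurable_c₁_apply x) measurableSet_Iic]; rfl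

theorem Regular.Q_le_iff (hP : P.Regular S Lf Lg) (x : Vec n) (q : ℝ) :
    P.Q x ≤ q ↔ 1 - P.α ≤ P.ν.real {z | P.c₁ x z ≤ q} := by
  have := hP.prob
  have : IsProbabilityMeasure (P.ν.map (P.c₁ x)) :=
    Measure.isProbabilityMeasure_map (hP.measurable_c₁_apply x).aemeasurable
  have := sInf_cdf_le_iff (P.ν.map (P.c₁ x)) (a := 1 - P.α) (by linarith [hP.alpha_lt])
    (by linarith [hP.alpha_pos]) q
  simp only [hP.real_map_Iic] at this
  exact this

theorem Regular.measurable_Q (hP : P.Regular S Lf Lg) : Measurable P.Q := by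
  have := hP.prob
  refine measurable_of_Iic fun q => ?_
  have : P.Q ⁻¹' Set.Iic q = {x | 1 - P.α ≤ P.ν.real {z | P.c₁ x z ≤ q}} := by
    ext x; exact hP.Q_le_iff x q
  rw [this]
  have hm : MeasurableSet {p : Vec n × Vec n₀ | P.c₁ p.1 p.2 ≤ q} :=
    measurableSet_le hP.measurable_c₁ measurable_const
  exact measurableSet_le measurable_const (measurable_measure_prodMk_left hm).ennreal_toReal

/-- Near the quantile the distribution function of `c₁(x,ξ)` grows at a rate at least `p₀`. -/
theorem Regular.exists_cdf_growth (hP : P.Regular S Lf Lg) :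
    ∃ p₀ t₀ : ℝ, 0 < p₀ ∧ 0 < t₀ ∧ ∀ x ∈ S, ∀ t, 0 < t → t ≤ t₀ →
      1 - P.α + p₀ * t ≤ P.ν.real {z | P.c₁ x z ≤ P.Q x + t} ∧
      P.ν.real {z | P.c₁ x z ≤ P.Q x - t} ≤ 1 - P.α - p₀ * t := by
  obtain ⟨p, hp, p₀, t₀, hp₀, ht₀, hlow⟩ := hP.density
  have := hP.prob
  refine ⟨p₀, t₀, hp₀, ht₀, fun x hx t ht htt => ?_⟩
  have : IsProbabilityMeasure (P.ν.map (P.c₁ x)) :=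
    Measure.isProbabilityMeasure_map (hP.measurable_c₁_apply x).aemeasurable
  have grow : ∀ a b, a ≤ b → P.Q x - t₀ ≤ a → b ≤ P.Q x + t₀ →
      P.ν.real {z | P.c₁ x z ≤ a} + p₀ * (b - a) ≤ P.ν.real {z | P.c₁ x z ≤ b} := by
    intro a b hab ha hb
    have := real_Iic_add_le (P.ν.map (P.c₁ x)) (hp x hx).2.2 hab hp₀.le fun s hs hs' =>
      hlow x hx s (abs_le.2 ⟨by linarith, by linarith⟩)
    simpa only [hP.real_map_Iic] using this
  constructor
  · have h1 := (hP.Q_le_iff x (P.Q x)).1 le_rfl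
    have h2 := grow (P.Q x) (P.Q x + t) (by linarith) (by linarith) (by linarith)
    linarith
  -- Strictly below the quantile the distribution function is less than `1 - α`. Growth is compared
  -- between `Q - t` and a point `s < Q` within `e / p₀` of `Q`; the maximum keeps `s` to the right
  -- of `Q - t`.
  · refine le_of_forall_pos_le_add fun e he => ?_
    set s := max (P.Q x - t) (P.Q x - e / p₀) with hs
    have hsQ : s < P.Q x := by
      have : 0 < e / p₀ := by positivity
      exact max_lt (by linarith) (by linarith)
    have h1 : P.ν.real {z | P.c₁ x z ≤ s} < 1 - P.α := by
      by_contra! h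
      exact absurd ((hP.Q_le_iff x s).2 h) (not_le.2 hsQ)
    have h2 := grow (P.Q x - t) s (le_max_left _ _) (by linarith) (by linarith)
    have h3 : P.Q x - e / p₀ ≤ s := le_max_right _ _
    have h4 : p₀ * (P.Q x - e / p₀ - (P.Q x - t)) ≤ p₀ * (s - (P.Q x - t)) := by gcongr
    have h5 : p₀ * (P.Q x - e / p₀ - (P.Q x - t)) = p₀ * t - e := by field_simp; ring
    linarith

end Problem

/-! ### Hoeffding's bound for empirical quantiles -/

/-- A centred indicator is sub-Gaussian with variance proxy `1/4`, so Hoeffding's exponent is `(Na)²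
/ (2N/4) = 2Na²`. -/
theorem measure_sum_indicator_dev {Ω E : Type*} [MeasurableSpace Ω] [MeasurableSpace E]
    {Pr : Measure Ω} [IsProbabilityMeasure Pr] {Z : ℕ → Ω → E} {ν : Measure E}
    (hZ : ∀ i, Measurable (Z i)) (hind : iIndepFun Z Pr) (hlaw : ∀ i, Pr.map (Z i) = ν)
    {B : Set E} (hB : MeasurableSet B) (N : ℕ) (hN : 0 < N) {a : ℝ} (ha : 0 ≤ a) :
    Pr.real {ω | N * a ≤ ∑ i ∈ Finset.range N, (B.indicator (fun _ => (1 : ℝ)) (Z i ω) - ν.real B)}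
        ≤ Real.exp (-2 * N * a ^ 2) ∧
    Pr.real {ω | N * a ≤ ∑ i ∈ Finset.range N, (ν.real B - B.indicator (fun _ => (1 : ℝ)) (Z i ω))}
        ≤ Real.exp (-2 * N * a ^ 2) := by
  have hN' : (0 : ℝ) < N := by exact_mod_cast hN
  set b : E → ℝ := B.indicator fun _ => (1 : ℝ) with hb
  have hbm : Measurable b := measurable_const.indicator hB
  have hmean : ∀ i, ∫ ω, b (Z i ω) ∂Pr = ν.real B := by
    intro i
    rw [← integral_map (hZ i).aemeasurable hbm.aestronglyMeasurable, hlaw i,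
      integral_indicator_const _ hB]
    simp
  have hsub : ∀ i, HasSubgaussianMGF (fun ω => b (Z i ω) - ν.real B) (1 / 4) Pr := by
    intro i
    have h := hasSubgaussianMGF_of_mem_Icc (μ := Pr) (X := fun ω => b (Z i ω)) (a := 0) (b := 1)
      (hbm.comp (hZ i)).aemeasurable (ae_of_all _ fun ω => by
        by_cases h : Z i ω ∈ B <;> simp [hb, h])
    rw [hmean i] at h
    convert h using 1
    simp; norm_num
  have hexp : Real.exp (-(N * a) ^ 2 / (2 * N * ((1 / 4 : NNReal) : ℝ)))
      = Real.exp (-2 * N * a ^ 2) := by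
    congr 1
    push_cast
    field_simp
    ring
  constructor
  · have hi : iIndepFun (fun i ω => b (Z i ω) - ν.real B) Pr :=
      hind.comp (fun _ e => b e - ν.real B) fun _ => hbm.sub_const _
    have h := HasSubgaussianMGF.measure_sum_range_ge_le_of_iIndepFun hi (n := N)
      (fun i _ => hsub i) (ε := N * a) (by positivity)
    rwa [hexp] at h
  · have hi : iIndepFun (fun i ω => ν.real B - b (Z i ω)) Pr :=
      hind.comp (fun _ e => ν.real B - b e) fun _ => hbm.const_sub _
    have h := HasSubgaussianMGF.measure_sum_range_ge_le_of_iIndepFun hi (n := N) (c := 1 / 4)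
      (fun i _ => by
        have := (hsub i).neg
        convert this using 1
        funext ω; simp) (ε := N * a) (by positivity)
    rwa [hexp] at h

/-- If `Q_N > Q + t`, fewer than `(1-α)N` samples lie below `Q + t`, although at least `(1-α+p₀t)N`
are expected there; so a count of indicators deviates from its mean by `N p₀ t`. The lower side is
symmetric. -/
theorem Problem.measure_QN_dev {n n₀ l : ℕ} {P : Problem n n₀ l} {S : Set (Vec n)} {Lf Lg : ℝ}
    (hP : P.Regular S Lf Lg) {p₀ t : ℝ} (hp₀ : 0 < p₀) (ht : 0 < t) {x : Vec n}
    (hup : 1 - P.α + p₀ * t ≤ P.ν.real {z | P.c₁ x z ≤ P.Q x + t})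
    (hlo : P.ν.real {z | P.c₁ x z ≤ P.Q x - t} ≤ 1 - P.α - p₀ * t)
    {Ω : Type*} [MeasurableSpace Ω] {Pr : Measure Ω} [IsProbabilityMeasure Pr]
    {Z : ℕ → Ω → Vec n₀} (hZ : ∀ i, Measurable (Z i)) (hind : iIndepFun Z Pr)
    (hlaw : ∀ i, Pr.map (Z i) = P.ν) {N : ℕ} (hN : 0 < N) :
    Pr {ω | t < |P.QN N (fun i => Z i ω) x - P.Q x|}
      ≤ ENNReal.ofReal (2 * Real.exp (-2 * N * (p₀ * t) ^ 2)) := by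
  have hN' : (0 : ℝ) < N := by exact_mod_cast hN
  have hBm : ∀ q, MeasurableSet {z | P.c₁ x z ≤ q} := fun q =>
    measurableSet_le (hP.measurable_c₁_apply x) measurable_const
  have hcard : ∀ ω q, (((Finset.univ.filter fun i : Fin N => P.c₁ x (Z i ω) ≤ q).card : ℕ) : ℝ)
      = ∑ i ∈ Finset.range N, Set.indicator {z | P.c₁ x z ≤ q} (fun _ => (1 : ℝ)) (Z i ω) := by
    intro ω q
    rw [Finset.card_filter, Finset.sum_range]
    push_cast
    simp [Set.indicator_apply]
  have hU := (measure_sum_indicator_dev hZ hind hlaw (hBm (P.Q x + t)) N hN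
    (a := p₀ * t) (by positivity)).2
  have hL := (measure_sum_indicator_dev hZ hind hlaw (hBm (P.Q x - t)) N hN
    (a := p₀ * t) (by positivity)).1
  have hsub : {ω | t < |P.QN N (fun i => Z i ω) x - P.Q x|} ⊆
      {ω | N * (p₀ * t) ≤ ∑ i ∈ Finset.range N, (P.ν.real {z | P.c₁ x z ≤ P.Q x + t}
        - Set.indicator {z | P.c₁ x z ≤ P.Q x + t} (fun _ => (1 : ℝ)) (Z i ω))} ∪
      {ω | N * (p₀ * t) ≤ ∑ i ∈ Finset.range N,
        (Set.indicator {z | P.c₁ x z ≤ P.Q x - t} (fun _ => (1 : ℝ)) (Z i ω)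
          - P.ν.real {z | P.c₁ x z ≤ P.Q x - t})} := by
    intro ω hω
    simp only [Set.mem_ofPred_eq] at hω
    rcases lt_abs.1 hω with h | h
    · left
      have h1 : ¬ P.QN N (fun i => Z i ω) x ≤ P.Q x + t := by linarith
      unfold Problem.QN at h1
      rw [empQuantile_le_iff hP.alpha_pos hP.alpha_lt hN, not_le, Nat.lt_ceil, hcard] at h1
      simp only [Set.mem_ofPred_eq, Finset.sum_sub_distrib, Finset.sum_const, Finset.card_range,
        nsmul_eq_mul]
      nlinarith
    · right
      have h1 : P.QN N (fun i => Z i ω) x ≤ P.Q x - t := by linarith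
      unfold Problem.QN at h1
      rw [empQuantile_le_iff hP.alpha_pos hP.alpha_lt hN, Nat.ceil_le, hcard] at h1
      simp only [Set.mem_ofPred_eq, Finset.sum_sub_distrib, Finset.sum_const, Finset.card_range,
        nsmul_eq_mul]
      nlinarith
  refine (measure_mono hsub).trans ((measure_union_le _ _).trans ?_)
  rw [two_mul, ENNReal.ofReal_add (by positivity) (by positivity)]
  refine add_le_add ?_ ?_
  · rw [← ofReal_measureReal]; exact ENNReal.ofReal_le_ofReal hU
  · rw [← ofReal_measureReal]; exact ENNReal.ofReal_le_ofReal hL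

/-! ### Freezing the past -/

/-- Under independence the joint law is a product, and Tonelli's theorem integrates out the fresh
variable while the past is held fixed. -/
theorem lintegral_freeze_of_indepFun {Ω Ω₁ E : Type*} [MeasurableSpace Ω] [MeasurableSpace Ω₁]
    [MeasurableSpace E] {Pr : Measure Ω} [IsProbabilityMeasure Pr] {X : Ω → Ω₁} {Y : Ω → E}
    (hX : Measurable X) (hY : Measurable Y) (hXY : IndepFun X Y Pr) {h b : Ω₁ → ENNReal}
    (hh : Measurable h) {s : Set (Ω₁ × E)} (hs : MeasurableSet s)
    (hb : ∀ x, h x * Pr {ω | (x, Y ω) ∈ s} ≤ b x) :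
    ∫⁻ ω, s.indicator (fun p => h p.1) (X ω, Y ω) ∂Pr ≤ ∫⁻ x, b x ∂(Pr.map X) := by
  have := Measure.isProbabilityMeasure_map (μ := Pr) hY.aemeasurable
  have := Measure.isProbabilityMeasure_map (μ := Pr) hX.aemeasurable
  have hmap := (indepFun_iff_map_prod_eq_prod_map_map hX.aemeasurable hY.aemeasurable).1 hXY
  have hm : Measurable (s.indicator (fun p : Ω₁ × E => h p.1)) :=
    (hh.comp measurable_fst).indicator hs
  rw [← lintegral_map (μ := Pr) (g := fun ω => (X ω, Y ω)) hm (hX.prodMk hY), hmap,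
    lintegral_prod _ hm.aemeasurable]
  refine lintegral_mono fun x => le_trans (le_of_eq ?_) (hb x)
  have h1 : ∀ y, s.indicator (fun p : Ω₁ × E => h p.1) (x, y)
      = (Prod.mk x ⁻¹' s).indicator (fun _ => h x) y := fun y => rfl
  simp only [h1]
  rw [lintegral_indicator_const (measurable_prodMk_left hs),
    Measure.map_apply hY (measurable_prodMk_left hs)]
  rfl

/-- The past is the identity map into `Ω` carrying the smaller σ-algebra `m₁`, so no separate state
space is needed. -/
theorem lintegral_freeze {Ω E : Type*} {m₁ mΩ : MeasurableSpace Ω}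
    [MeasurableSpace E] {Pr : Measure Ω} [IsProbabilityMeasure Pr] (hm : m₁ ≤ mΩ) {Y : Ω → E}
    (hY : Measurable Y) (hind : Indep m₁ (MeasurableSpace.comap Y inferInstance) Pr)
    {h b : Ω → ENNReal} (hh : Measurable[m₁] h) (hbm : Measurable[m₁] b)
    {s : Set (Ω × E)} (hs : MeasurableSet[m₁.prod inferInstance] s)
    (hb : ∀ x, h x * Pr {ω | (x, Y ω) ∈ s} ≤ b x) :
    ∫⁻ ω, s.indicator (fun p => h p.1) (ω, Y ω) ∂Pr ≤ ∫⁻ x, b x ∂Pr := by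
  have hid : @Measurable Ω Ω mΩ m₁ id := measurable_id'' hm
  have hXY : @IndepFun Ω Ω E mΩ m₁ _ id Y Pr :=
    (@IndepFun_iff_Indep Ω Ω E mΩ m₁ _ id Y Pr).2 (by rw [MeasurableSpace.comap_id]; exact hind)
  have h1 := @lintegral_freeze_of_indepFun Ω Ω E mΩ m₁ _ Pr _ id Y hid hY hXY h b hh s hs hb
  have h2 := @lintegral_map Ω Ω mΩ m₁ Pr b id hbm hid
  rw [h2] at h1
  exact h1

/-! ### Measurability of the sampled quantities -/

namespace Problem

variable {n n₀ l : ℕ} {P : Problem n n₀ l} {S : Set (Vec n)} {Lf Lg : ℝ}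

theorem Regular.measurable_QN_prod (hP : P.Regular S Lf Lg) :
    Measurable fun p : ℕ × ((ℕ → Vec n₀) × Vec n) => P.QN p.1 p.2.1 p.2.2 := by
  refine measurable_from_prod_countable_right fun N => ?_
  refine (measurable_empQuantile hP.alpha_pos hP.alpha_lt N).comp
    (measurable_pi_lambda _ fun i => hP.measurable_c₁.comp
      (measurable_snd.prodMk ((measurable_pi_apply (i : ℕ)).comp measurable_fst)))

section

variable {Ω : Type*} {_ : MeasurableSpace Ω} {N : Ω → ℕ} {z : Ω → ℕ → Vec n₀} {x y : Ω → Vec n}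
  {ρ β : Ω → ℝ} {μ : Ω → Fin (l + 1) → ℝ} {H : Ω → Vec n →L[ℝ] Vec n}

theorem Regular.measurable_QN (hP : P.Regular S Lf Lg) (hN : Measurable N) (hz : Measurable z)
    (hx : Measurable x) : Measurable fun ω => P.QN (N ω) (z ω) (x ω) := by
  have h : Measurable fun ω => (N ω, z ω, x ω) := hN.prodMk (hz.prodMk hx)
  have h' := hP.measurable_QN_prod.comp h
  exact h'

theorem Regular.measurable_gN (hP : P.Regular S Lf Lg) (hN : Measurable N) (hz : Measurable z)
    (hx : Measurable x) (i : Fin (l + 1)) : Measurable fun ω => P.gN (N ω) (z ω) i (x ω) := by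
  refine Fin.cases ?_ (fun i => ?_) i
  · exact hP.measurable_QN hN hz hx
  · exact (hP.diff_c₂ i).continuous.measurable.comp hx

theorem Regular.measurable_PhiN (hP : P.Regular S Lf Lg) (hN : Measurable N) (hz : Measurable z)
    (hρ : Measurable ρ) (hμ : ∀ i, Measurable fun ω => μ ω i) (hx : Measurable x) :
    Measurable fun ω => P.PhiN (N ω) (z ω) (ρ ω) (μ ω) (x ω) := by
  unfold PhiN augLagrangian
  refine (hP.diff_f.continuous.measurable.comp hx).add ((hρ.div_const 2).mul
    (Finset.measurable_sum _ fun i _ => ((measurable_const.max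
      ((hP.measurable_gN hN hz hx i).add ((hμ i).div hρ))).pow_const 2)))

theorem measurable_gradient (f : Vec n → ℝ) : Measurable (gradient f) :=
  (InnerProductSpace.toDual ℝ (Vec n)).symm.continuous.measurable.comp (measurable_fderiv ℝ f)

theorem Regular.measurable_GN (hP : P.Regular S Lf Lg) (hN : Measurable N) (hz : Measurable z)
    (hβ : Measurable β) (hx : Measurable x) :
    Measurable fun ω => P.GN (N ω) (z ω) (β ω) (x ω) := by
  unfold GN
  refine Finset.measurable_sum _ fun j _ => Measurable.smul_const (Measurable.div ?_ ?_) _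
  · exact (hP.measurable_QN hN hz (hx.add (hβ.smul_const _))).sub
      (hP.measurable_QN hN hz (hx.sub (hβ.smul_const _)))
  · exact hβ.const_mul 2

theorem Regular.measurable_phiN (hP : P.Regular S Lf Lg) (hN : Measurable N) (hz : Measurable z)
    (hρ : Measurable ρ) (hμ : ∀ i, Measurable fun ω => μ ω i) (hβ : Measurable β)
    (hx : Measurable x) :
    Measurable fun ω => P.phiN (N ω) (z ω) (ρ ω) (μ ω) (β ω) (x ω) := by
  unfold phiN
  refine (((measurable_gradient _).comp hx).add (Measurable.smul (hρ.mul (measurable_const.max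
    ((hP.measurable_QN hN hz hx).add ((hμ 0).div hρ)))) (hP.measurable_GN hN hz hβ hx))).add
    (Finset.measurable_sum _ fun i _ => Measurable.smul (hρ.mul (measurable_const.max
    (((hP.diff_c₂ i).continuous.measurable.comp hx).add ((hμ i.succ).div hρ))))
      ((measurable_gradient _).comp hx))

theorem measurable_clm_apply (hH : Measurable H) (hx : Measurable x) :
    Measurable fun ω => H ω (x ω) := by
  have : ∀ ω, H ω (x ω) = ∑ j, (x ω) j • H ω (EuclideanSpace.single j (1 : ℝ)) := by
    intro ω
    conv_lhs => rw [← (EuclideanSpace.basisFun (Fin n) ℝ).sum_repr (x ω)]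
    simp
  simp only [this]
  exact Finset.measurable_sum _ fun j _ => Measurable.smul
    ((EuclideanSpace.proj (𝕜 := ℝ) j).continuous.measurable.comp hx) (hH.apply_continuousLinearMap _)

theorem Regular.measurable_model (hP : P.Regular S Lf Lg) (hN : Measurable N) (hz : Measurable z)
    (hρ : Measurable ρ) (hμ : ∀ i, Measurable fun ω => μ ω i) (hβ : Measurable β)
    (hH : Measurable H) (hx : Measurable x) (hy : Measurable y) :
    Measurable fun ω => P.model (N ω) (z ω) (ρ ω) (μ ω) (β ω) (H ω) (x ω) (y ω) := by
  unfold model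
  exact ((hP.measurable_PhiN hN hz hρ hμ hx).add
    ((hP.measurable_phiN hN hz hρ hμ hβ hx).inner (hy.sub hx))).add
    (((hy.sub hx).inner (measurable_clm_apply hH (hy.sub hx))).const_mul _)

end

/-- Deviations of the empirical quantile of a fresh batch, integrated against a weight that is
determined by the past. -/
theorem Regular.lintegral_QN_dev (hP : P.Regular S Lf Lg) {p₀ t₀ : ℝ} (hp₀ : 0 < p₀)
    (hgrow : ∀ x ∈ S, ∀ t, 0 < t → t ≤ t₀ →
      1 - P.α + p₀ * t ≤ P.ν.real {z | P.c₁ x z ≤ P.Q x + t} ∧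
      P.ν.real {z | P.c₁ x z ≤ P.Q x - t} ≤ 1 - P.α - p₀ * t)
    {Ω : Type*} {m₁ mΩ : MeasurableSpace Ω} {Pr : Measure Ω} [IsProbabilityMeasure Pr]
    (hm : m₁ ≤ mΩ) {Z : ℕ → Ω → Vec n₀} (hZ : ∀ i, Measurable (Z i)) (hiid : iIndepFun Z Pr)
    (hlaw : ∀ i, Pr.map (Z i) = P.ν)
    (hind : Indep m₁ (MeasurableSpace.comap (fun ω i => Z i ω) inferInstance) Pr)
    {h : Ω → ENNReal} {N : Ω → ℕ} {x : Ω → Vec n} {t : Ω → ℝ} (hh : Measurable[m₁] h)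
    (hN : Measurable[m₁] N) (hx : Measurable[m₁] x) (ht : Measurable[m₁] t)
    (hcond : ∀ ω, h ω ≠ 0 → x ω ∈ S ∧ 0 < t ω ∧ t ω ≤ t₀ ∧ 0 < N ω) :
    ∫⁻ ω, {ω | t ω < |P.QN (N ω) (fun i => Z i ω) (x ω) - P.Q (x ω)|}.indicator h ω ∂Pr
      ≤ ∫⁻ ω, h ω * ENNReal.ofReal (2 * Real.exp (-2 * N ω * (p₀ * t ω) ^ 2)) ∂Pr := by
  set s : Set (Ω × (ℕ → Vec n₀)) := {p | t p.1 < |P.QN (N p.1) p.2 (x p.1) - P.Q (x p.1)|} with hs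
  have hsm : MeasurableSet[m₁.prod inferInstance] s := by
    have h1 : @Measurable _ _ (m₁.prod inferInstance) m₁ (Prod.fst : Ω × (ℕ → Vec n₀) → Ω) :=
      @measurable_fst Ω (ℕ → Vec n₀) m₁ _
    have h2 : @Measurable _ _ (m₁.prod inferInstance) _ (Prod.snd : Ω × (ℕ → Vec n₀) → _) :=
      @measurable_snd Ω (ℕ → Vec n₀) m₁ _
    let _ : MeasurableSpace (Ω × (ℕ → Vec n₀)) := m₁.prod inferInstance
    have hQ := hP.measurable_QN (hN.comp h1) h2 (hx.comp h1)
    exact measurableSet_lt (ht.comp h1)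
      (hQ.sub (hP.measurable_Q.comp (hx.comp h1))).norm
  have hbm : Measurable[m₁] fun ω =>
      h ω * ENNReal.ofReal (2 * Real.exp (-2 * N ω * (p₀ * t ω) ^ 2)) := by
    refine hh.mul (ENNReal.measurable_ofReal.comp ?_)
    refine (Real.measurable_exp.comp ((Measurable.mul ?_ ?_))).const_mul 2
    · exact (measurable_from_top.comp hN).const_mul (-2)
    · exact (ht.const_mul p₀).pow_const 2
  refine le_trans (le_of_eq ?_) (lintegral_freeze hm (measurable_pi_lambda _ hZ) hind hh hbm hsm
    fun ω => ?_)
  · rfl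
  -- Where the weight vanishes, nothing is known about the point, the threshold or the sample size,
  -- and nothing is needed.
  · by_cases h0 : h ω = 0
    · simp [h0]
    · obtain ⟨hxS, h1, h2, h3⟩ := hcond ω h0
      exact mul_le_mul_right (measure_QN_dev hP hp₀ h1 (hgrow _ hxS _ h1 h2).1
        (hgrow _ hxS _ h1 h2).2 hZ hiid hlaw h3) _

end Problem

theorem measurable_batch {Ω E : Type*} {_ : MeasurableSpace Ω} [MeasurableSpace E] {z : ℕ → Ω → E}
    (hz : ∀ i, Measurable (z i)) : Measurable fun ω i => z i ω :=
  measurable_pi_lambda _ hz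

theorem measurable_apply_nat {Ω E : Type*} {_ : MeasurableSpace Ω} [MeasurableSpace E]
    {z : ℕ → Ω → E} (hz : ∀ i, Measurable (z i)) {T : Ω → ℕ} (hT : Measurable T) :
    Measurable fun ω => z (T ω) ω := by
  have hp : Measurable fun p : ℕ × Ω => z p.1 p.2 := measurable_from_prod_countable_right hz
  exact hp.comp (hT.prodMk measurable_id)

theorem measurable_update {Ω E : Type*} {_ : MeasurableSpace Ω} [MeasurableSpace E]
    {p : Ω → Prop} (hp : MeasurableSet {ω | p ω}) {f g₁ g₂ : Ω → E} (h₁ : Measurable g₁)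
    (h₂ : Measurable g₂) (hf₁ : ∀ ω, p ω → f ω = g₁ ω) (hf₂ : ∀ ω, ¬ p ω → f ω = g₂ ω) :
    Measurable f := by
  classical
  have : f = fun ω => if p ω then g₁ ω else g₂ ω := by
    funext ω
    split_ifs with h
    · exact hf₁ ω h
    · exact hf₂ ω h
  rw [this]
  exact Measurable.ite hp h₁ h₂

namespace Problem

variable {n n₀ l : ℕ} {P : Problem n n₀ l} {S : Set (Vec n)} {Lf Lg : ℝ}
  {Ω : Type*} {_ : MeasurableSpace Ω} {N : Ω → ℕ} {z z' : Ω → ℕ → Vec n₀} {x s : Ω → Vec n}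
  {ρ Δ : Ω → ℝ} {μ μ' : Ω → Fin (l + 1) → ℝ} {H : Ω → Vec n →L[ℝ] Vec n}

theorem Regular.measurableSet_accept (hP : P.Regular S Lf Lg) (hN : Measurable N)
    (hz : Measurable z) (hz' : Measurable z') (hρ : Measurable ρ)
    (hμ : ∀ i, Measurable fun ω => μ ω i) (hΔ : Measurable Δ) (hH : Measurable H)
    (hx : Measurable x) (hs : Measurable s) (η₁ η₂ r₀ : ℝ) :
    MeasurableSet {ω | η₁ * min (Δ ω) (Δ ω ^ 2) ≤
        P.model (N ω) (z ω) (ρ ω) (μ ω) (r₀ * Δ ω) (H ω) (x ω) (x ω)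
          - P.model (N ω) (z ω) (ρ ω) (μ ω) (r₀ * Δ ω) (H ω) (x ω) (x ω + s ω) ∧
      η₂ ≤ (P.PhiN (N ω) (z' ω) (ρ ω) (μ ω) (x ω) - P.PhiN (N ω) (z' ω) (ρ ω) (μ ω) (x ω + s ω)) /
        (P.model (N ω) (z ω) (ρ ω) (μ ω) (r₀ * Δ ω) (H ω) (x ω) (x ω)
          - P.model (N ω) (z ω) (ρ ω) (μ ω) (r₀ * Δ ω) (H ω) (x ω) (x ω + s ω))} := by
  have hm1 := (hP.measurable_model hN hz hρ hμ (hΔ.const_mul r₀) hH hx hx).sub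
      (hP.measurable_model hN hz hρ hμ (hΔ.const_mul r₀) hH hx (hx.add hs))
  have hm2 := ((hP.measurable_PhiN hN hz' hρ hμ hx).sub
    (hP.measurable_PhiN hN hz' hρ hμ (hx.add hs))).div hm1
  exact (measurableSet_le ((hΔ.min (hΔ.pow_const 2)).const_mul _) hm1).inter
      (measurableSet_le measurable_const hm2)

theorem Regular.measurable_multiplier (hP : P.Regular S Lf Lg) (hN : Measurable N)
    (hz : Measurable z) (hρ : Measurable ρ) (hμ : ∀ i, Measurable fun ω => μ ω i)
    (hx : Measurable x) (hμ' : ∀ ω i, μ' ω i = max 0 (μ ω i + ρ ω * P.gN (N ω) (z ω) i (x ω)))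
    (i : Fin (l + 1)) : Measurable fun ω => μ' ω i := by
  simp only [hμ']
  exact measurable_const.max ((hμ i).add (hρ.mul (hP.measurable_gN hN hz hx i)))

theorem Regular.measurable_sigmaN (hP : P.Regular S Lf Lg) (hN : Measurable N)
    (hz : Measurable z) (hμ : ∀ i, Measurable fun ω => μ ω i) (hx : Measurable x) :
    Measurable fun ω => P.sigmaN (N ω) (z ω) (x ω) (μ ω) :=
  (Finset.measurable_sum _ fun i _ =>
    ((hP.measurable_gN hN hz hx i).neg.min (hμ i)).pow_const 2).sqrt

end Problem

/-! ### Information carried by the draws -/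

section Info

variable {n₀ : ℕ} {Ω : Type u} {ξ : Draw → Ω → Vec n₀} {B B' : Draw → Prop}

theorem info_mono (h : ∀ d, B d → B' d) : info ξ B ≤ info ξ B' :=
  iSup_le fun d => le_iSup (fun d : {d : Draw // B' d} => MeasurableSpace.comap (ξ d) inferInstance)
    ⟨d.1, h _ d.2⟩

theorem measurable_info {d : Draw} (hd : B d) : Measurable[info ξ B] (ξ d) :=
  Measurable.of_comap_le
    (le_iSup (fun d : {d : Draw // B d} => MeasurableSpace.comap (ξ d) inferInstance) ⟨d, hd⟩)

theorem info_le [mΩ : MeasurableSpace Ω] (hξ : ∀ d, Measurable (ξ d)) : info ξ B ≤ mΩ :=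
  iSup_le fun d => (hξ d).comap_le

/-- The labels of the batch avoid `B`, so two disjoint subfamilies of an independent family are
compared. -/
theorem indep_info_batch [mΩ : MeasurableSpace Ω] {Pr : Measure Ω} (hξ : ∀ d, Measurable (ξ d))
    (hind : iIndepFun ξ Pr) {lab : ℕ → Draw} (hlab : ∀ i, ¬ B (lab i)) :
    Indep (info ξ B) (MeasurableSpace.comap (fun ω i => ξ (lab i) ω) inferInstance) Pr := by
  have hdis : Disjoint {d | B d} (Set.range lab) := by
    rw [Set.disjoint_right]
    rintro _ ⟨i, rfl⟩
    exact hlab i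
  have h := indep_iSup_of_disjoint (m := fun d => MeasurableSpace.comap (ξ d) inferInstance)
    (fun d => (hξ d).comap_le) ((iIndepFun_iff_iIndep _ _ _).1 hind) hdis
  refine indep_of_indep_of_le_left (indep_of_indep_of_le_right h ?_) ?_
  · refine Measurable.comap_le (measurable_batch fun i => Measurable.of_comap_le ?_)
    exact le_iSup₂ (f := fun d (_ : d ∈ Set.range lab) =>
      MeasurableSpace.comap (ξ d) inferInstance) (lab i) ⟨i, rfl⟩
  · exact iSup_le fun d => le_iSup₂ (f := fun d (_ : d ∈ {d | B d}) =>
      MeasurableSpace.comap (ξ d) inferInstance) d.1 d.2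

end Info

theorem measurable_sInf_nat {Ω : Type*} {_ : MeasurableSpace Ω} {p : ℕ → Ω → Prop}
    (hp : ∀ k, MeasurableSet {ω | p k ω}) : Measurable fun ω => sInf {k | p k ω} := by
  refine measurable_to_countable' fun k => ?_
  -- The infimum of the empty set is `0`, so the value `0` also collects the outcomes where no index
  -- qualifies.
  have h : (fun ω => sInf {k | p k ω}) ⁻¹' {k}
      = ({ω | p k ω} ∩ ⋂ j, ⋂ (_ : j < k), {ω | p j ω}ᶜ) ∪ ({_ω | k = 0} ∩ ⋂ j, {ω | p j ω}ᶜ) := by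
    ext ω
    simp only [Set.mem_preimage, Set.mem_singleton_iff, Set.mem_union, Set.mem_inter_iff,
      Set.mem_iInter, Set.mem_compl_iff, Set.mem_ofPred_eq]
    constructor
    · intro hk
      by_cases hne : {k | p k ω}.Nonempty
      · left
        subst hk
        exact ⟨Nat.sInf_mem hne, fun j hj => Nat.notMem_of_lt_sInf hj⟩
      · right
        rw [Set.not_nonempty_iff_eq_empty] at hne
        rw [hne, Nat.sInf_empty] at hk
        exact ⟨hk.symm, fun j hj => by
          have : j ∈ {k | p k ω} := hj
          rw [hne] at this; exact this⟩
    · rintro (⟨h1, h2⟩ | ⟨h1, h2⟩)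
      · refine le_antisymm (Nat.sInf_le h1) ?_
        by_contra! hlt
        exact h2 _ hlt (Nat.sInf_mem (s := {k | p k ω}) ⟨k, h1⟩)
      · have : {k | p k ω} = ∅ := Set.eq_empty_of_forall_notMem h2
        rw [this, Nat.sInf_empty, h1]
  rw [h]
  refine MeasurableSet.union ((hp k).inter (MeasurableSet.iInter fun j =>
    MeasurableSet.iInter fun _ => (hp j).compl)) (MeasurableSet.inter (.const _)
    (MeasurableSet.iInter fun j => (hp j).compl))

/-! ### Adaptedness of the iterates and parameters of a run -/

namespace Run

variable {n n₀ l : ℕ} {P : Problem n n₀ l} {A : Params} {Ω : Type u} [mΩ : MeasurableSpace Ω]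
  {Pr : Measure Ω} (R : Run P A Pr) {S : Set (Vec n)} {Lf Lg : ℝ}

/-- The local model of inner iteration `k` of outer iteration `m`. -/
def mdl (m k : ℕ) (ω : Ω) (y : Vec n) : ℝ :=
  P.model (R.N m k ω) (fun i => R.ξ (.model m k i) ω) (R.ρ m ω) (R.μbar m ω) (A.r₀ * R.Δ m k ω)
    (R.H m k ω) (R.X m k ω) y

/-- The merit function estimate used in the acceptance test. -/
def est (m k : ℕ) (ω : Ω) (y : Vec n) : ℝ :=
  P.PhiN (R.N m k ω) (fun i => R.ξ (.test m k i) ω) (R.ρ m ω) (R.μbar m ω) y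

/-- The decrease predicted by the local model. -/
def mdec (m k : ℕ) (ω : Ω) : ℝ :=
  R.mdl m k ω (R.X m k ω) - R.mdl m k ω (R.X m k ω + R.s m k ω)

/-- The trial step is accepted. -/
def Accept (m k : ℕ) (ω : Ω) : Prop :=
  A.η₁ * min (R.Δ m k ω) (R.Δ m k ω ^ 2) ≤ R.mdec m k ω ∧
    A.η₂ ≤ (R.est m k ω (R.X m k ω) - R.est m k ω (R.X m k ω + R.s m k ω)) / R.mdec m k ω

theorem step_accept {m k : ℕ} (hm : 1 ≤ m) {ω : Ω} (h : R.Accept m k ω) :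
    R.X m (k + 1) ω = R.X m k ω + R.s m k ω ∧
      R.Δ m (k + 1) ω = min 1 (A.γinc * R.Δ m k ω) :=
  (R.step m k hm ω).1 h

theorem step_reject {m k : ℕ} (hm : 1 ≤ m) {ω : Ω} (h : ¬ R.Accept m k ω) :
    R.X m (k + 1) ω = R.X m k ω ∧ R.Δ m (k + 1) ω = A.γdec * R.Δ m k ω :=
  (R.step m k hm ω).2 h

/-- The state at the start of outer iteration `m` is determined by the past. -/
structure StartMeasurable (m : ℕ) : Prop where
  X : Measurable[info R.ξ (Draw.Before m 0)] (R.X m 0)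
  ρ : Measurable[info R.ξ (Draw.Before m 0)] (R.ρ m)
  μbar : ∀ i, Measurable[info R.ξ (Draw.Before m 0)] fun ω => R.μbar m ω i

theorem before_mono {m k k' : ℕ} (h : k ≤ k') : ∀ d, Draw.Before m k d → Draw.Before m k' d := by
  rintro (_ | _ | _) <;> simp only [Draw.Before] <;> omega

theorem before_beforeTest {m k : ℕ} : ∀ d, Draw.Before m k d → Draw.BeforeTest m k d := by
  rintro (_ | _ | _) <;> simp only [Draw.Before, Draw.BeforeTest] <;> omega

theorem beforeTest_before {m k : ℕ} : ∀ d, Draw.BeforeTest m k d → Draw.Before m (k + 1) d := by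
  rintro (_ | _ | _) <;> simp only [Draw.Before, Draw.BeforeTest] <;> omega

theorem before_beforeUpdate {m k : ℕ} : ∀ d, Draw.Before m k d → Draw.BeforeUpdate m d := by
  rintro (_ | _ | _) <;> simp only [Draw.Before, Draw.BeforeUpdate] <;> omega

theorem beforeUpdate_before {m : ℕ} :
    ∀ d, Draw.BeforeUpdate m d → Draw.Before (m + 1) 0 d := by
  rintro (_ | _ | _) <;> simp only [Draw.Before, Draw.BeforeUpdate] <;> omega

/-- Acceptance depends on both batches of iteration `k`; the information available before iteration
`k + 1` contains them. -/
theorem measurable_inner_step (hP : P.Regular S Lf Lg) {m k : ℕ} (hm : 1 ≤ m)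
    (hX : Measurable[info R.ξ (Draw.Before m (k + 1))] (R.X m k))
    (hΔ : Measurable[info R.ξ (Draw.Before m (k + 1))] (R.Δ m k))
    (hρ : Measurable[info R.ξ (Draw.Before m (k + 1))] (R.ρ m))
    (hμ : ∀ i, Measurable[info R.ξ (Draw.Before m (k + 1))] fun ω => R.μbar m ω i) :
    Measurable[info R.ξ (Draw.Before m (k + 1))] (R.X m (k + 1)) ∧
      Measurable[info R.ξ (Draw.Before m (k + 1))] (R.Δ m (k + 1)) := by
  have hN : Measurable[info R.ξ (Draw.Before m (k + 1))] (R.N m k) :=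
    (R.N_adapted m k hm).mono (info_mono (before_mono (Nat.le_succ k))) le_rfl
  have hH : Measurable[info R.ξ (Draw.Before m (k + 1))] (R.H m k) :=
    (R.H_adapted m k hm).mono (info_mono beforeTest_before) le_rfl
  have hs : Measurable[info R.ξ (Draw.Before m (k + 1))] (R.s m k) :=
    (R.s_adapted m k hm).mono (info_mono beforeTest_before) le_rfl
  have hz1 : Measurable[info R.ξ (Draw.Before m (k + 1))] fun ω i => R.ξ (.model m k i) ω :=
    measurable_batch fun i => measurable_info (by simp [Draw.Before])
  have hz2 : Measurable[info R.ξ (Draw.Before m (k + 1))] fun ω i => R.ξ (.test m k i) ω :=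
    measurable_batch fun i => measurable_info (by simp [Draw.Before])
  have hA : MeasurableSet[info R.ξ (Draw.Before m (k + 1))] {ω | R.Accept m k ω} :=
    hP.measurableSet_accept hN hz1 hz2 hρ hμ hΔ hH hX hs A.η₁ A.η₂ A.r₀
  exact ⟨measurable_update hA (hX.add hs) hX (fun ω h => (R.step_accept hm h).1)
      fun ω h => (R.step_reject hm h).1,
    measurable_update hA (measurable_const.min (hΔ.const_mul A.γinc)) (hΔ.const_mul A.γdec)
      (fun ω h => (R.step_accept hm h).2) fun ω h => (R.step_reject hm h).2⟩

theorem StartMeasurable.inner {R : Run P A Pr} {m : ℕ} (h : R.StartMeasurable m)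
    (hP : P.Regular S Lf Lg) (hm : 1 ≤ m) (k : ℕ) :
    Measurable[info R.ξ (Draw.Before m k)] (R.X m k) ∧
      Measurable[info R.ξ (Draw.Before m k)] (R.Δ m k) := by
  induction k with
  | zero =>
    refine ⟨h.X, ?_⟩
    have : R.Δ m 0 = fun _ => A.Δ₀ := funext fun ω => R.Δ_zero m hm ω
    rw [this]; exact measurable_const
  | succ k ih =>
    have h1 := info_mono (ξ := R.ξ) (before_mono (m := m) (Nat.le_succ k))
    have h0 := info_mono (ξ := R.ξ) (before_mono (m := m) (Nat.zero_le (k + 1)))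
    exact R.measurable_inner_step hP hm (ih.1.mono h1 le_rfl) (ih.2.mono h1 le_rfl)
      (h.ρ.mono h0 le_rfl) fun i => (h.μbar i).mono h0 le_rfl

theorem StartMeasurable.measurable_x {R : Run P A Pr} {m : ℕ} (h : R.StartMeasurable m)
    (hP : P.Regular S Lf Lg) (hm : 1 ≤ m) :
    Measurable[info R.ξ (Draw.BeforeUpdate m)] (R.x m) := by
  have hX : ∀ k, Measurable[info R.ξ (Draw.BeforeUpdate m)] (R.X m k) := fun k =>
    (h.inner hP hm k).1.mono (info_mono before_beforeUpdate) le_rfl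
  have hΔ : ∀ k, Measurable[info R.ξ (Draw.BeforeUpdate m)] (R.Δ m k) := fun k =>
    (h.inner hP hm k).2.mono (info_mono before_beforeUpdate) le_rfl
  have hr : Measurable[info R.ξ (Draw.BeforeUpdate m)] (R.r m) :=
    (R.r_adapted m hm).mono (info_mono before_beforeUpdate) le_rfl
  have hT : Measurable[info R.ξ (Draw.BeforeUpdate m)] fun ω => sInf {k : ℕ | R.Δ m (k + 1) ω ≤ R.r m ω} :=
    measurable_sInf_nat fun k => measurableSet_le (hΔ (k + 1)) hr
  have : R.x m = fun ω => R.X m (sInf {k : ℕ | R.Δ m (k + 1) ω ≤ R.r m ω}) ω :=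
    funext fun ω => R.output m hm ω
  rw [this]
  exact measurable_apply_nat hX hT

theorem StartMeasurable.succ {R : Run P A Pr} {m : ℕ} (h : R.StartMeasurable m)
    (hP : P.Regular S Lf Lg) (hm : 1 ≤ m) : R.StartMeasurable (m + 1) := by
  have hx0 := h.measurable_x hP hm
  have hle : info R.ξ (Draw.BeforeUpdate m) ≤ info R.ξ (Draw.Before (m + 1) 0) :=
    info_mono beforeUpdate_before
  have hle0 : info R.ξ (Draw.Before m 0) ≤ info R.ξ (Draw.Before (m + 1) 0) :=
    (info_mono before_beforeUpdate).trans hle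
  have hx := hx0.mono hle le_rfl
  have hρ := h.ρ.mono hle0 le_rfl
  have hμ := fun i => (h.μbar i).mono hle0 le_rfl
  have hN := (R.Nout_adapted m hm).mono hle le_rfl
  have hz : Measurable[info R.ξ (Draw.Before (m + 1) 0)] fun ω j => R.ξ (.outer m j) ω :=
    measurable_batch fun i => measurable_info (by simp [Draw.Before])
  have key : Measurable[info R.ξ (Draw.Before (m + 1) 0)] (R.ρ (m + 1)) ∧
      ∀ i, Measurable[info R.ξ (Draw.Before (m + 1) 0)] fun ω => R.μbar (m + 1) ω i := by
    have hμ' : ∀ i, Measurable[info R.ξ (Draw.Before (m + 1) 0)] fun ω => R.μ (m + 1) ω i :=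
      hP.measurable_multiplier hN hz hρ hμ hx (R.μ_succ m hm)
    refine ⟨measurable_update (measurableSet_lt measurable_const
      (hP.measurable_sigmaN hN hz hμ' hx)) (hρ.const_mul A.θρ) hρ
        (fun ω h => (R.ρ_succ m hm ω).trans (if_pos h))
        fun ω h => (R.ρ_succ m hm ω).trans (if_neg h), fun i => ?_⟩
    have : (fun ω => R.μbar (m + 1) ω i) = fun ω => min A.μmax (R.μ (m + 1) ω i) :=
      funext fun ω => R.μbar_succ m hm ω i
    rw [this]
    exact measurable_const.min (hμ' i)
  refine ⟨?_, key.1, key.2⟩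
  have : R.X (m + 1) 0 = R.x m := funext fun ω => R.X_zero m ω
  rw [this]
  exact hx

theorem startMeasurable (hP : P.Regular S Lf Lg) {m : ℕ} (hm : 1 ≤ m) : R.StartMeasurable m := by
  induction m, hm using Nat.le_induction with
  | base =>
    refine ⟨?_, ?_, fun i => ?_⟩
    · have : R.X (0 + 1) 0 = fun _ => R.xin := funext fun ω => (R.X_zero 0 ω).trans (R.x_zero ω)
      rw [zero_add] at this
      rw [this]; exact measurable_const
    · have : R.ρ 1 = fun _ => R.ρin := funext R.ρ_one
      rw [this]; exact measurable_const
    · have : (fun ω => R.μbar 1 ω i) = fun _ => 1 := funext fun ω => R.μbar_one ω i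
      rw [this]; exact measurable_const
  | succ m hm ih => exact ih.succ hP hm

end Run

/-! ### Deterministic estimates for the merit function -/

/-- The squared positive part differs from its linearisation by at most `(s - t)²`, at the kink as
well. -/
theorem hasDerivAt_max_zero_sq (t : ℝ) :
    HasDerivAt (fun s : ℝ => (max 0 s) ^ 2) (2 * max 0 t) t := by
  rw [hasDerivAt_iff_isLittleO]
  have h1 : (fun s : ℝ => (max 0 s) ^ 2 - (max 0 t) ^ 2 - (s - t) • (2 * max 0 t))
      =O[𝓝 t] fun s => (s - t) ^ 2 := by
    refine Asymptotics.IsBigO.of_bound 1 (Eventually.of_forall fun s => ?_)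
    rw [Real.norm_eq_abs, Real.norm_eq_abs, one_mul, abs_of_nonneg (sq_nonneg (s - t)), abs_le,
      smul_eq_mul]
    rcases le_total 0 s with hs | hs <;> rcases le_total 0 t with ht | ht <;>
      simp only [max_eq_right, max_eq_left, hs, ht] <;> constructor <;> nlinarith
  refine h1.trans_isLittleO ?_
  have h2 : (fun s : ℝ => s - t) =o[𝓝 t] fun _ => (1 : ℝ) := by
    rw [Asymptotics.isLittleO_one_iff]
    have : Tendsto (fun s : ℝ => s - t) (𝓝 t) (𝓝 (t - t)) := (continuous_sub_right t).tendsto t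
    simpa using this
  have h3 := (Asymptotics.isBigO_refl (fun s : ℝ => s - t) (𝓝 t)).mul_isLittleO h2
  simpa [sq] using h3

theorem abs_max_zero_sub_le (p q : ℝ) : |max 0 p - max 0 q| ≤ |p - q| := by
  have := abs_max_sub_max_le_abs p q 0
  simpa [max_comm] using this

theorem mul_max_zero_add_div {ρ : ℝ} (hρ : 0 < ρ) (p μ : ℝ) :
    ρ * max 0 (p + μ / ρ) = max 0 (ρ * p + μ) := by
  rw [mul_max_of_nonneg _ _ hρ.le, mul_zero, mul_add, mul_div_cancel₀ _ hρ.ne']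

theorem max_zero_le_of {ρ μ p b : ℝ} (hρ : 0 ≤ ρ) (hμ : 0 ≤ μ) (hp : |p| ≤ b) :
    max 0 (ρ * p + μ) ≤ ρ * b + μ := by
  have := (abs_le.1 hp)
  have hb := (abs_nonneg p).trans hp
  exact max_le (by positivity) (by nlinarith)

/-- Perturbation of one penalty term. -/
theorem abs_penalty_sub_le {ρ μ p q b : ℝ} (hρ : 0 < ρ) (hμ : 0 ≤ μ) (hp : |p| ≤ b)
    (hq : |q| ≤ b) :
    |ρ / 2 * (max 0 (p + μ / ρ)) ^ 2 - ρ / 2 * (max 0 (q + μ / ρ)) ^ 2|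
      ≤ |p - q| * (ρ * b + μ) := by
  have h1 := max_zero_le_of hρ.le hμ hp
  have h2 := max_zero_le_of hρ.le hμ hq
  rw [← mul_max_zero_add_div hρ] at h1 h2
  have h3 := abs_max_zero_sub_le (p + μ / ρ) (q + μ / ρ)
  rw [add_sub_add_right_eq_sub] at h3
  have e : ρ / 2 * (max 0 (p + μ / ρ)) ^ 2 - ρ / 2 * (max 0 (q + μ / ρ)) ^ 2
      = (max 0 (p + μ / ρ) - max 0 (q + μ / ρ)) *
        ((ρ * max 0 (p + μ / ρ) + ρ * max 0 (q + μ / ρ)) / 2) := by ring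
  have h0 : 0 ≤ (ρ * max 0 (p + μ / ρ) + ρ * max 0 (q + μ / ρ)) / 2 := by positivity
  rw [e, abs_mul, abs_of_nonneg h0]
  exact mul_le_mul h3 (by linarith) h0 (abs_nonneg _)

/-- Mean value inequality on the ball for `F` minus its linear part at `x`. The constant is `M`
instead of the sharp `M/2`, which is harmless here. -/
theorem abs_sub_sub_inner_le {E : Type*} [NormedAddCommGroup E] [InnerProductSpace ℝ E]
    [CompleteSpace E] {F : E → ℝ} {G : E → E} {x y : E} {M : ℝ} (hM : 0 ≤ M)
    (hF : ∀ z ∈ Metric.closedBall x ‖y - x‖, HasGradientAt F (G z) z)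
    (hG : ∀ z ∈ Metric.closedBall x ‖y - x‖, ‖G z - G x‖ ≤ M * ‖z - x‖) :
    |F y - F x - inner ℝ (G x) (y - x)| ≤ M * ‖y - x‖ ^ 2 := by
  have h := (convex_closedBall x ‖y - x‖).norm_image_sub_le_of_norm_hasFDerivWithin_le
    (𝕜 := ℝ) (f := fun z => F z - inner ℝ (G x) z)
    (f' := fun z => InnerProductSpace.toDual ℝ E (G z) - InnerProductSpace.toDual ℝ E (G x))
    (C := M * ‖y - x‖) (x := x) (y := y) ?_ ?_ (by simp) (by simp [dist_eq_norm])
  · rw [Real.norm_eq_abs] at h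
    rw [inner_sub_right]
    calc _ = |F y - inner ℝ (G x) y - (F x - inner ℝ (G x) x)| := by congr 1; ring
      _ ≤ _ := h
      _ = _ := by ring
  · intro z hz
    exact ((hF z hz).hasFDerivAt.sub
      (InnerProductSpace.toDual ℝ E (G x)).hasFDerivAt).hasFDerivWithinAt
  · intro z hz
    rw [← map_sub, LinearIsometryEquiv.norm_map]
    refine (hG z hz).trans (mul_le_mul_of_nonneg_left ?_ hM)
    simpa [dist_eq_norm] using hz

/-! ### Gradient, Lipschitz, Taylor and perturbation bounds for the merit function -/

namespace Problem

variable {n n₀ l : ℕ} (P : Problem n n₀ l)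

/-- The gradient of the merit function, as an explicit expression. -/
def dPhi (ρ : ℝ) (μ : Fin (l + 1) → ℝ) (x : Vec n) : Vec n :=
  gradient P.f x + ∑ i, max 0 (ρ * P.g i x + μ i) • gradient (P.g i) x

/-- `b` bounds all functions, gradients and Lipschitz constants of the problem on `S`. -/
structure BoundedBy (S : Set (Vec n)) (b : ℝ) : Prop where
  one_le : 1 ≤ b
  diff_f : ∀ x ∈ S, DifferentiableAt ℝ P.f x
  diff_g : ∀ i, ∀ x ∈ S, DifferentiableAt ℝ (P.g i) x
  f_le : ∀ x ∈ S, |P.f x| ≤ b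
  g_le : ∀ i, ∀ x ∈ S, |P.g i x| ≤ b
  df_le : ∀ x ∈ S, ‖gradient P.f x‖ ≤ b
  dg_le : ∀ i, ∀ x ∈ S, ‖gradient (P.g i) x‖ ≤ b
  lip_f : ∀ x ∈ S, ∀ y ∈ S, ‖gradient P.f x - gradient P.f y‖ ≤ b * ‖x - y‖
  lip_g : ∀ i, ∀ x ∈ S, ∀ y ∈ S,
    ‖gradient (P.g i) x - gradient (P.g i) y‖ ≤ b * ‖x - y‖

/-- The weight `1 + ∑ᵢ μᵢ + ρ`. -/
def weight {k : ℕ} (ρ : ℝ) (μ : Fin k → ℝ) : ℝ := 1 + ∑ i, μ i + ρ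

section

variable {ρ : ℝ} {μ : Fin (l + 1) → ℝ}

theorem le_weight (hμ : ∀ i, 0 ≤ μ i) (i : Fin (l + 1)) : ρ + μ i + 1 ≤ weight ρ μ := by
  have := Finset.single_le_sum (f := μ) (fun j _ => hμ j) (Finset.mem_univ i)
  unfold weight; linarith

variable {P} {S : Set (Vec n)} {b : ℝ}

theorem BoundedBy.hasGradientAt_Phi (hb : P.BoundedBy S b) (hρ : 0 < ρ) {x : Vec n} (hx : x ∈ S) :
    HasGradientAt (P.Phi ρ μ) (P.dPhi ρ μ x) x := by
  rw [hasGradientAt_iff_hasFDerivAt]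
  have hf := (hb.diff_f x hx).hasGradientAt.hasFDerivAt
  have hg : ∀ i, HasFDerivAt (fun y => (max 0 (P.g i y + μ i / ρ)) ^ 2)
      ((2 * max 0 (P.g i x + μ i / ρ)) • InnerProductSpace.toDual ℝ (Vec n) (gradient (P.g i) x)) x :=
    fun i => (hasDerivAt_max_zero_sq _).comp_hasFDerivAt x
      ((hb.diff_g i x hx).hasGradientAt.hasFDerivAt.add_const _)
  have h := hf.add ((HasFDerivAt.fun_sum (u := Finset.univ) fun i _ => hg i).const_mul (ρ / 2))
  refine HasFDerivAt.congr_fderiv h ?_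
  ext v
  simp only [dPhi, add_apply, smul_apply,
    sum_apply, InnerProductSpace.toDual_apply_apply, inner_add_left, sum_inner,
    real_inner_smul_left, smul_eq_mul, Finset.mul_sum]
  congr 1
  refine Finset.sum_congr rfl fun i _ => ?_
  rw [← mul_max_zero_add_div hρ]
  ring

theorem BoundedBy.coeff_le (hb : P.BoundedBy S b) (hμ : ∀ i, 0 ≤ μ i)
    (i : Fin (l + 1)) : ρ * b + μ i ≤ b * weight ρ μ := by
  have h := le_weight (ρ := ρ) hμ i
  have h1 := hb.one_le
  nlinarith [hμ i]

theorem BoundedBy.norm_dPhi_le (hb : P.BoundedBy S b) (hρ : 0 < ρ) (hμ : ∀ i, 0 ≤ μ i)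
    {x : Vec n} (hx : x ∈ S) : ‖P.dPhi ρ μ x‖ ≤ (l + 2) * b ^ 2 * weight ρ μ := by
  have h1 := hb.one_le
  have hw : 1 ≤ weight ρ μ := by linarith [le_weight (ρ := ρ) hμ 0, hμ 0]
  have hterm : ∀ i, ‖max 0 (ρ * P.g i x + μ i) • gradient (P.g i) x‖ ≤ b ^ 2 * weight ρ μ := by
    intro i
    rw [norm_smul, Real.norm_of_nonneg (le_max_left _ _)]
    have h2 := (max_zero_le_of hρ.le (hμ i) (hb.g_le i x hx)).trans (hb.coeff_le hμ i)
    calc _ ≤ (b * weight ρ μ) * b := by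
          gcongr
          exact hb.dg_le i x hx
      _ = _ := by ring
  calc ‖P.dPhi ρ μ x‖ ≤ b + ∑ _i : Fin (l + 1), b ^ 2 * weight ρ μ := by
        refine (norm_add_le _ _).trans (add_le_add (hb.df_le x hx) ?_)
        exact (norm_sum_le _ _).trans (Finset.sum_le_sum fun i _ => hterm i)
    _ = b + (l + 1) * (b ^ 2 * weight ρ μ) := by simp
    _ ≤ _ := by
        have : b ≤ b ^ 2 * weight ρ μ := by nlinarith [mul_nonneg (by linarith : 0 ≤ b) (by linarith : 0 ≤ weight ρ μ - 1)]
        linarith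

/-- `S` need not be convex, so the mean value inequality is used on a ball inside it; trust regions
require no more. -/
theorem BoundedBy.abs_g_sub_le (hb : P.BoundedBy S b) {x y : Vec n} {Δ : ℝ}
    (hS : Metric.closedBall x Δ ⊆ S) (hy : y ∈ Metric.closedBall x Δ) (i : Fin (l + 1)) :
    |P.g i y - P.g i x| ≤ b * ‖y - x‖ := by
  have hΔ : 0 ≤ Δ := dist_nonneg.trans hy
  have := (convex_closedBall x Δ).norm_image_sub_le_of_norm_hasFDerivWithin_le
    (𝕜 := ℝ) (f := P.g i) (f' := fun z => InnerProductSpace.toDual ℝ _ (gradient (P.g i) z))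
    (C := b) (fun z hz => (hb.diff_g i z (hS hz)).hasGradientAt.hasFDerivAt.hasFDerivWithinAt)
    (fun z hz => by rw [LinearIsometryEquiv.norm_map]; exact hb.dg_le i z (hS hz))
    (Metric.mem_closedBall_self hΔ) hy
  simpa [Real.norm_eq_abs] using this

/-- Each penalty term is a coefficient, bounded by `b w` and Lipschitz with constant `b w`, times a
gradient, bounded and Lipschitz with constant `b`. The `l + 1` terms contribute `2b²w` each, and `f`
contributes at most `b²w`. -/
theorem BoundedBy.norm_dPhi_sub_le (hb : P.BoundedBy S b) (hρ : 0 < ρ) (hμ : ∀ i, 0 ≤ μ i)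
    {x y : Vec n} {Δ : ℝ} (hS : Metric.closedBall x Δ ⊆ S) (hy : y ∈ Metric.closedBall x Δ) :
    ‖P.dPhi ρ μ y - P.dPhi ρ μ x‖ ≤ (2 * l + 3) * b ^ 2 * weight ρ μ * ‖y - x‖ := by
  have h1 := hb.one_le
  have hΔ : 0 ≤ Δ := dist_nonneg.trans hy
  have hxS := hS (Metric.mem_closedBall_self hΔ)
  have hyS := hS hy
  have hw : 1 ≤ weight ρ μ := by linarith [le_weight (ρ := ρ) hμ 0, hμ 0]
  have hterm : ∀ i, ‖max 0 (ρ * P.g i y + μ i) • gradient (P.g i) y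
      - max 0 (ρ * P.g i x + μ i) • gradient (P.g i) x‖ ≤ 2 * b ^ 2 * weight ρ μ * ‖y - x‖ := by
    intro i
    have e : max 0 (ρ * P.g i y + μ i) • gradient (P.g i) y
        - max 0 (ρ * P.g i x + μ i) • gradient (P.g i) x
        = max 0 (ρ * P.g i y + μ i) • (gradient (P.g i) y - gradient (P.g i) x)
          + (max 0 (ρ * P.g i y + μ i) - max 0 (ρ * P.g i x + μ i)) • gradient (P.g i) x := by
      rw [smul_sub, sub_smul]; abel
    have h2 := (max_zero_le_of hρ.le (hμ i) (hb.g_le i y hyS)).trans (hb.coeff_le hμ i)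
    have h3 : |max 0 (ρ * P.g i y + μ i) - max 0 (ρ * P.g i x + μ i)|
        ≤ weight ρ μ * (b * ‖y - x‖) := by
      refine (abs_max_zero_sub_le _ _).trans ?_
      rw [add_sub_add_right_eq_sub, ← mul_sub, abs_mul, abs_of_pos hρ]
      refine mul_le_mul ?_ (hb.abs_g_sub_le hS hy i) (abs_nonneg _) (by linarith)
      linarith [le_weight (ρ := ρ) hμ 0, hμ 0]
    rw [e]
    calc _ ≤ (b * weight ρ μ) * (b * ‖y - x‖) + weight ρ μ * (b * ‖y - x‖) * b := by
          refine (norm_add_le _ _).trans (add_le_add ?_ ?_)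
          · rw [norm_smul, Real.norm_of_nonneg (le_max_left _ _)]
            gcongr
            exact hb.lip_g i y hyS x hxS
          · rw [norm_smul, Real.norm_eq_abs]
            gcongr
            exact hb.dg_le i x hxS
      _ = _ := by ring
  have e : P.dPhi ρ μ y - P.dPhi ρ μ x = (gradient P.f y - gradient P.f x)
      + ∑ i, (max 0 (ρ * P.g i y + μ i) • gradient (P.g i) y
        - max 0 (ρ * P.g i x + μ i) • gradient (P.g i) x) := by
    unfold dPhi
    rw [Finset.sum_sub_distrib]; abel
  rw [e]
  calc _ ≤ b * ‖y - x‖ + ∑ _i : Fin (l + 1), 2 * b ^ 2 * weight ρ μ * ‖y - x‖ := by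
        refine (norm_add_le _ _).trans (add_le_add (hb.lip_f y hyS x hxS) ?_)
        exact (norm_sum_le _ _).trans (Finset.sum_le_sum fun i _ => hterm i)
    _ = b * ‖y - x‖ + (l + 1) * (2 * b ^ 2 * weight ρ μ * ‖y - x‖) := by simp
    _ ≤ _ := by
        have : b ≤ b ^ 2 * weight ρ μ := by nlinarith [mul_nonneg (by linarith : 0 ≤ b) (by linarith : 0 ≤ weight ρ μ - 1)]
        nlinarith [mul_le_mul_of_nonneg_right this (norm_nonneg (y - x))]

theorem BoundedBy.abs_Phi_taylor_le (hb : P.BoundedBy S b) (hρ : 0 < ρ) (hμ : ∀ i, 0 ≤ μ i)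
    {x y : Vec n} {Δ : ℝ} (hS : Metric.closedBall x Δ ⊆ S) (hy : y ∈ Metric.closedBall x Δ) :
    |P.Phi ρ μ y - P.Phi ρ μ x - inner ℝ (P.dPhi ρ μ x) (y - x)|
      ≤ (2 * l + 3) * b ^ 2 * weight ρ μ * ‖y - x‖ ^ 2 := by
  have hw : 1 ≤ weight ρ μ := by linarith [le_weight (ρ := ρ) hμ 0, hμ 0]
  have hsub : Metric.closedBall x ‖y - x‖ ⊆ Metric.closedBall x Δ :=
    Metric.closedBall_subset_closedBall (by simpa [dist_eq_norm] using hy)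
  exact abs_sub_sub_inner_le (by positivity)
    (fun z hz => hb.hasGradientAt_Phi hρ (hS (hsub hz)))
    fun z hz => hb.norm_dPhi_sub_le hρ hμ hS (hsub hz)

theorem BoundedBy.abs_Phi_sub_le (hb : P.BoundedBy S b) (hρ : 0 < ρ) (hμ : ∀ i, 0 ≤ μ i)
    {x y : Vec n} (hx : x ∈ S) (hy : y ∈ S) :
    |P.Phi ρ μ x - P.Phi ρ μ y| ≤ (2 * l + 4) * b ^ 2 * weight ρ μ := by
  have h1 := hb.one_le
  have hw : 1 ≤ weight ρ μ := by linarith [le_weight (ρ := ρ) hμ 0, hμ 0]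
  have hterm : ∀ i, |ρ / 2 * (max 0 (P.g i x + μ i / ρ)) ^ 2
      - ρ / 2 * (max 0 (P.g i y + μ i / ρ)) ^ 2| ≤ 2 * b ^ 2 * weight ρ μ := by
    intro i
    have hgx := hb.g_le i x hx
    have hgy := hb.g_le i y hy
    refine (abs_penalty_sub_le hρ (hμ i) hgx hgy).trans ?_
    have h2 : |P.g i x - P.g i y| ≤ 2 * b := (abs_sub _ _).trans (by linarith)
    have h3 : 0 ≤ ρ * b + μ i := by have := hμ i; positivity
    calc _ ≤ (2 * b) * (b * weight ρ μ) := mul_le_mul h2 (hb.coeff_le hμ i) h3 (by positivity)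
      _ = _ := by ring
  have e : P.Phi ρ μ x - P.Phi ρ μ y = (P.f x - P.f y) + ∑ i,
      (ρ / 2 * (max 0 (P.g i x + μ i / ρ)) ^ 2 - ρ / 2 * (max 0 (P.g i y + μ i / ρ)) ^ 2) := by
    unfold Phi augLagrangian
    rw [Finset.sum_sub_distrib, ← Finset.mul_sum, ← Finset.mul_sum]; ring
  rw [e]
  calc _ ≤ 2 * b + ∑ _i : Fin (l + 1), 2 * b ^ 2 * weight ρ μ := by
        refine (abs_add_le _ _).trans (add_le_add ?_ ?_)
        · exact (abs_sub _ _).trans (by linarith [hb.f_le x hx, hb.f_le y hy])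
        · exact (Finset.abs_sum_le_sum_abs _ _).trans (Finset.sum_le_sum fun i _ => hterm i)
    _ = 2 * b + (l + 1) * (2 * b ^ 2 * weight ρ μ) := by simp
    _ ≤ _ := by
        have : b ≤ b ^ 2 * weight ρ μ := by nlinarith [mul_nonneg (by linarith : 0 ≤ b) (by linarith : 0 ≤ weight ρ μ - 1)]
        nlinarith

/-- Only the term of index `0` is sampled. An error of at most `1` keeps the sampled quantile below
`b + 1 ≤ 2b` in modulus, hence the factor `2 b w`. -/
theorem BoundedBy.abs_PhiN_sub_le (hb : P.BoundedBy S b) (hρ : 0 < ρ) (hμ : ∀ i, 0 ≤ μ i)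
    {x : Vec n} (hx : x ∈ S) {N : ℕ} {z : ℕ → Vec n₀} {e : ℝ} (he : |P.QN N z x - P.Q x| ≤ e)
    (he1 : e ≤ 1) :
    |P.PhiN N z ρ μ x - P.Phi ρ μ x| ≤ 2 * b * weight ρ μ * e := by
  have h1 := hb.one_le
  have e0 : P.PhiN N z ρ μ x - P.Phi ρ μ x = ρ / 2 * (max 0 (P.QN N z x + μ 0 / ρ)) ^ 2
      - ρ / 2 * (max 0 (P.Q x + μ 0 / ρ)) ^ 2 := by
    simp only [PhiN, Phi, augLagrangian, Fin.sum_univ_succ, gN, g, Fin.cons_zero, Fin.cons_succ]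
    ring
  have hQ : |P.Q x| ≤ b := hb.g_le 0 x hx
  have hQN : |P.QN N z x| ≤ b + 1 := by
    have := abs_sub_abs_le_abs_sub (P.QN N z x) (P.Q x)
    linarith
  rw [e0]
  refine (abs_penalty_sub_le hρ (hμ 0) hQN (by linarith)).trans ?_
  have h2 := le_weight (ρ := ρ) hμ 0
  have h3 : ρ * (b + 1) + μ 0 ≤ 2 * b * weight ρ μ := by nlinarith [hμ 0]
  have h4 : 0 ≤ ρ * (b + 1) + μ 0 := by have := hμ 0; positivity
  calc _ ≤ e * (2 * b * weight ρ μ) := by gcongr; exact (abs_nonneg _).trans he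
    _ = _ := by ring

/-- Per coordinate the two Taylor errors `bβ²` and the two sampling errors `tΔ²` are divided by
`2β`. With `β = r₀Δ` and `t ≤ r₀` each kind contributes at most `bΔ`. -/
theorem BoundedBy.norm_GN_sub_le (hb : P.BoundedBy S b) {x : Vec n} {Δ β t r₀ : ℝ} {N : ℕ}
    {z : ℕ → Vec n₀} (hS : Metric.closedBall x Δ ⊆ S) (hΔ : 0 < Δ) (hr₀ : 0 < r₀) (hr₀1 : r₀ ≤ 1)
    (hβ : β = r₀ * Δ) (ht : t ≤ r₀)
    (hp : ∀ j, |P.QN N z (x + β • EuclideanSpace.single j (1 : ℝ))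
      - P.Q (x + β • EuclideanSpace.single j (1 : ℝ))| ≤ t * Δ ^ 2)
    (hm : ∀ j, |P.QN N z (x - β • EuclideanSpace.single j (1 : ℝ))
      - P.Q (x - β • EuclideanSpace.single j (1 : ℝ))| ≤ t * Δ ^ 2) :
    ‖P.GN N z β x - gradient P.Q x‖ ≤ n * (2 * b * Δ) := by
  have h1 := hb.one_le
  have hβ0 : 0 < β := by rw [hβ]; positivity
  have hβΔ : β ≤ Δ := by rw [hβ]; nlinarith
  have hdiff : ∀ y ∈ S, HasGradientAt P.Q (gradient P.Q y) y := fun y hy =>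
    (hb.diff_g 0 y hy).hasGradientAt
  have hxS := hS (Metric.mem_closedBall_self hΔ.le)
  have tay : ∀ v : Vec n, ‖v‖ = β → |P.Q (x + v) - P.Q x - inner ℝ (gradient P.Q x) v| ≤ b * β ^ 2 := by
    intro v hv
    have := abs_sub_sub_inner_le (F := P.Q) (G := gradient P.Q) (x := x) (y := x + v) (M := b)
      (by linarith) (fun z hz => hdiff z (hS ?_)) (fun z hz => hb.lip_g 0 z (hS ?_) x hxS)
    · simpa [hv] using this
    · exact Metric.closedBall_subset_closedBall (by simpa [hv] using hβΔ) hz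
    · exact Metric.closedBall_subset_closedBall (by simpa [hv] using hβΔ) hz
  have hcomp : gradient P.Q x = ∑ j, (gradient P.Q x j) • EuclideanSpace.single j (1 : ℝ) := by
    conv_lhs => rw [← (EuclideanSpace.basisFun (Fin n) ℝ).sum_repr (gradient P.Q x)]
    simp
  have hterm : ∀ j, ‖((P.QN N z (x + β • EuclideanSpace.single j (1 : ℝ))
        - P.QN N z (x - β • EuclideanSpace.single j (1 : ℝ))) / (2 * β))
      • EuclideanSpace.single j (1 : ℝ)
      - (gradient P.Q x j) • EuclideanSpace.single j (1 : ℝ)‖ ≤ 2 * b * Δ := by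
    intro j
    rw [← sub_smul, norm_smul, PiLp.norm_single, norm_one, mul_one, Real.norm_eq_abs]
    have hn1 : ‖β • (EuclideanSpace.single j (1 : ℝ) : Vec n)‖ = β := by
      rw [norm_smul, PiLp.norm_single, norm_one, mul_one, Real.norm_of_nonneg hβ0.le]
    have hin : inner ℝ (gradient P.Q x) (β • (EuclideanSpace.single j (1 : ℝ) : Vec n))
        = β * gradient P.Q x j := by
      rw [real_inner_smul_right, real_inner_comm, EuclideanSpace.inner_single_left]; simp
    have a1 := tay _ hn1
    have a2 := tay (-(β • EuclideanSpace.single j (1 : ℝ))) (by rw [norm_neg, hn1])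
    rw [inner_neg_right, ← sub_eq_add_neg] at a2
    rw [hin] at a1 a2
    have a3 := hp j
    have a4 := hm j
    set q1 := P.QN N z (x + β • EuclideanSpace.single j (1 : ℝ))
    set q2 := P.QN N z (x - β • EuclideanSpace.single j (1 : ℝ))
    have a5 : |q1 - q2 - 2 * β * gradient P.Q x j| ≤ 2 * (b * β ^ 2) + 2 * (t * Δ ^ 2) := by
      rw [abs_le] at a1 a2 a3 a4 ⊢
      constructor <;> linarith
    have e : (q1 - q2) / (2 * β) - gradient P.Q x j
        = (q1 - q2 - 2 * β * gradient P.Q x j) / (2 * β) := by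
      field_simp
    rw [e, abs_div, abs_of_pos (by positivity : 0 < 2 * β), div_le_iff₀ (by positivity)]
    refine a5.trans ?_
    have a6 : b * β ^ 2 ≤ b * Δ * β := by
      have : b * β * β ≤ b * β * Δ := by gcongr
      nlinarith
    have a7 : t * Δ ^ 2 ≤ b * Δ * β := by
      rw [hβ]
      have : t * Δ ^ 2 ≤ r₀ * Δ ^ 2 := by gcongr
      nlinarith [mul_nonneg (sub_nonneg.2 h1) (by positivity : 0 ≤ r₀ * Δ ^ 2)]
    nlinarith
  unfold GN
  rw [hcomp, ← Finset.sum_sub_distrib]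
  refine (norm_sum_le _ _).trans ((Finset.sum_le_sum fun j _ => hterm j).trans ?_)
  simp

theorem BoundedBy.norm_phiN_sub_le (hb : P.BoundedBy S b) (hρ : 0 < ρ) (hμ : ∀ i, 0 ≤ μ i)
    {x : Vec n} {Δ β t r₀ : ℝ} {N : ℕ}
    {z : ℕ → Vec n₀} (hS : Metric.closedBall x Δ ⊆ S) (hΔ : 0 < Δ) (hΔ1 : Δ ≤ 1) (hr₀ : 0 < r₀)
    (hr₀1 : r₀ ≤ 1) (hβ : β = r₀ * Δ) (ht : t ≤ r₀)
    (h0 : |P.QN N z x - P.Q x| ≤ t * Δ ^ 2)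
    (hp : ∀ j, |P.QN N z (x + β • EuclideanSpace.single j (1 : ℝ))
      - P.Q (x + β • EuclideanSpace.single j (1 : ℝ))| ≤ t * Δ ^ 2)
    (hm : ∀ j, |P.QN N z (x - β • EuclideanSpace.single j (1 : ℝ))
      - P.Q (x - β • EuclideanSpace.single j (1 : ℝ))| ≤ t * Δ ^ 2) :
    ‖P.phiN N z ρ μ β x - P.dPhi ρ μ x‖ ≤ (4 * n + 1) * b ^ 2 * weight ρ μ * Δ := by
  have h1 := hb.one_le
  have hxS := hS (Metric.mem_closedBall_self hΔ.le)
  have hG := hb.norm_GN_sub_le hS hΔ hr₀ hr₀1 hβ ht hp hm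
  have h2 := le_weight (ρ := ρ) hμ 0
  have hw : 1 ≤ weight ρ μ := by linarith [hμ 0]
  have hQ : |P.Q x| ≤ b := hb.g_le 0 x hxS
  have htΔ : t * Δ ^ 2 ≤ Δ := by
    have : t * Δ ^ 2 ≤ 1 * Δ ^ 2 := by gcongr; linarith
    nlinarith
  have hQN : |P.QN N z x| ≤ b + 1 := by
    have := abs_sub_abs_le_abs_sub (P.QN N z x) (P.Q x)
    linarith
  have h3 : ρ * (b + 1) + μ 0 ≤ 2 * b * weight ρ μ := by nlinarith [hμ 0]
  have h4 := (max_zero_le_of hρ.le (hμ 0) hQN).trans h3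
  have e : P.phiN N z ρ μ β x - P.dPhi ρ μ x
      = max 0 (ρ * P.QN N z x + μ 0) • (P.GN N z β x - gradient P.Q x)
        + (max 0 (ρ * P.QN N z x + μ 0) - max 0 (ρ * P.Q x + μ 0)) • gradient P.Q x := by
    simp only [phiN, dPhi, Fin.sum_univ_succ, g, Fin.cons_zero, Fin.cons_succ,
      mul_max_zero_add_div hρ, smul_sub, sub_smul]
    abel
  have h5 : |max 0 (ρ * P.QN N z x + μ 0) - max 0 (ρ * P.Q x + μ 0)| ≤ weight ρ μ * Δ := by
    refine (abs_max_zero_sub_le _ _).trans ?_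
    rw [add_sub_add_right_eq_sub, ← mul_sub, abs_mul, abs_of_pos hρ]
    exact mul_le_mul (by linarith [hμ 0]) (h0.trans htΔ) (abs_nonneg _) (by linarith)
  rw [e]
  calc _ ≤ (2 * b * weight ρ μ) * (n * (2 * b * Δ)) + weight ρ μ * Δ * b := by
        refine (norm_add_le _ _).trans (add_le_add ?_ ?_)
        · rw [norm_smul, Real.norm_of_nonneg (le_max_left _ _)]
          gcongr
        · rw [norm_smul, Real.norm_eq_abs]
          gcongr
          exact hb.dg_le 0 x hxS
    _ ≤ _ := by
        have : b * (weight ρ μ * Δ) ≤ b ^ 2 * (weight ρ μ * Δ) := by gcongr; nlinarith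
        nlinarith

end

end Problem

/-! ### Uniform bounds on the region `S` -/

/-- `f` is bounded on the compact closure of `S`; its gradient is bounded through the Lipschitz
condition and the diameter of `S`; the constraints and their gradients are controlled by `K`, since
`v² ≤ K` gives `v ≤ 1 + K`. The bound involves the problem data only, not a run. -/
theorem Problem.Regular.exists_boundedBy {n n₀ l : ℕ} {P : Problem n n₀ l} {S : Set (Vec n)}
    {Lf Lg K : ℝ} (hP : P.Regular S Lf Lg) (BH : ℝ) (hS : S.Nonempty)
    (hKg : ∀ i, ∀ x ∈ S, (‖gradient (P.g i) x‖ + |P.g i x| + Lg) ^ 2 ≤ K) :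
    ∃ b, P.BoundedBy S b ∧ BH ≤ b := by
  obtain ⟨x₀, hx₀⟩ := hS
  have hLg := hP.Lg_pos
  obtain ⟨Bf, hBf⟩ := hP.isBounded.isCompact_closure.exists_bound_of_continuousOn
    hP.diff_f.continuous.continuousOn
  have hBf' : ∀ x ∈ S, |P.f x| ≤ Bf := fun x hx => hBf x (subset_closure hx)
  have hBf0 : 0 ≤ Bf := (abs_nonneg _).trans (hBf' x₀ hx₀)
  have hK0 : 0 ≤ K := (sq_nonneg _).trans (hKg 0 x₀ hx₀)
  have hsq : ∀ i, ∀ x ∈ S, ‖gradient (P.g i) x‖ + |P.g i x| + Lg ≤ 1 + K := by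
    intro i x hx
    have := hKg i x hx
    nlinarith [norm_nonneg (gradient (P.g i) x), abs_nonneg (P.g i x)]
  obtain ⟨D, hD⟩ := Metric.isBounded_iff.1 hP.isBounded
  have hD0 : 0 ≤ D := dist_nonneg.trans (hD hx₀ hx₀)
  have hG0 := norm_nonneg (gradient P.f x₀)
  have hLfD : 0 ≤ |Lf| * D := by positivity
  have hb1 : ∀ t, t ≤ Bf + (1 + K) + |Lf| + Lg + ‖gradient P.f x₀‖ + |Lf| * D →
      t ≤ Bf + (1 + K) + |Lf| + Lg + ‖gradient P.f x₀‖ + |Lf| * D + |BH| :=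
    fun t ht => by linarith [abs_nonneg BH]
  have hLf0 := abs_nonneg Lf
  refine ⟨Bf + (1 + K) + |Lf| + Lg + ‖gradient P.f x₀‖ + |Lf| * D + |BH|, ?_, ?_⟩
  · constructor
    · exact hb1 _ (by linarith)
    · exact fun x _ => hP.diff_f x
    · intro i x hx
      exact ((hP.contDiff_g i).contDiffAt (hP.isOpen.mem_nhds hx)).differentiableAt one_ne_zero
    · exact fun x hx => hb1 _ (by linarith [hBf' x hx])
    · exact fun i x hx => hb1 _ (by linarith [hsq i x hx, norm_nonneg (gradient (P.g i) x)])
    · intro x hx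
      refine hb1 _ ?_
      have h1 := hP.lip_f x hx x₀ hx₀
      have h2 : Lf * ‖x - x₀‖ ≤ |Lf| * D := by
        have h3 := hD hx hx₀
        rw [dist_eq_norm] at h3
        exact mul_le_mul (le_abs_self _) h3 (norm_nonneg _) hLf0
      have h4 := norm_sub_norm_le (gradient P.f x) (gradient P.f x₀)
      linarith
    · exact fun i x hx => hb1 _ (by linarith [hsq i x hx, abs_nonneg (P.g i x)])
    · intro x hx y hy
      refine (hP.lip_f x hx y hy).trans ?_
      gcongr
      exact hb1 _ (by linarith [le_abs_self Lf])
    · intro i x hx y hy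
      refine (hP.lip_g i x hx y hy).trans ?_
      gcongr
      exact hb1 _ (by linarith)
  · linarith [le_abs_self BH]

/-! ### Acceptance of steps based on accurate estimates -/

/-- If the gradient estimate and the two merit function estimates are accurate and the radius is
small compared with the gradient, the trial step passes the acceptance test. -/
theorem accept_of_accurate {E : Type*} [NormedAddCommGroup E] [InnerProductSpace ℝ E]
    {F Fe : E → ℝ} {x s d φ : E} {H : E →L[ℝ] E} {Δ b c w η₁ η₂ M₁ mdec : ℝ}
    (hΔ : 0 < Δ) (hb : 0 ≤ b) (hc : 0 ≤ c) (hw : 1 ≤ w) (hη₁ : η₁ ≤ 1)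
    (hη₂ : η₂ < 1) (hM₁ : c + b + (4 * c + b) / (1 - η₂) + 1 ≤ M₁) (hH : ‖H‖ ≤ b)
    (hs : ‖s‖ ≤ Δ)
    (hmdec : mdec = -inner ℝ φ s - 1 / 2 * inner ℝ s (H s))
    (hmin : ∀ v, ‖v‖ ≤ Δ → -inner ℝ φ v - 1 / 2 * inner ℝ v (H v) ≤ mdec)
    (hφ : ‖φ - d‖ ≤ c * w * Δ)
    (htay : |F (x + s) - F x - inner ℝ d s| ≤ c * w * Δ ^ 2)
    (he : |Fe x - F x| ≤ c * w * Δ ^ 2) (he' : |Fe (x + s) - F (x + s)| ≤ c * w * Δ ^ 2)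
    (hd : M₁ * w * Δ < ‖d‖) :
    η₁ * min Δ (Δ ^ 2) ≤ mdec ∧ η₂ ≤ (Fe x - Fe (x + s)) / mdec := by
  have h1η : 0 < 1 - η₂ := by linarith
  have hquad : ∀ v : E, ‖v‖ ≤ Δ → |inner ℝ v (H v)| ≤ b * Δ ^ 2 := by
    intro v hv
    calc |inner ℝ v (H v)| ≤ ‖v‖ * ‖H v‖ := abs_real_inner_le_norm _ _
      _ ≤ Δ * (b * Δ) := by
          refine mul_le_mul hv ?_ (norm_nonneg _) hΔ.le
          exact (H.le_opNorm v).trans (mul_le_mul hH hv (norm_nonneg _) hb)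
      _ = _ := by ring
  have hφn : (M₁ - c) * w * Δ ≤ ‖φ‖ := by
    have h1 := norm_sub_norm_le d φ
    rw [norm_sub_rev] at h1
    nlinarith
  have hq0 : 0 ≤ (4 * c + b) / (1 - η₂) := by positivity
  have hbw : b ≤ b * w := by nlinarith
  have hwΔ : 0 < w * Δ := by positivity
  have hφ0 : 0 < ‖φ‖ := by
    have : 0 < (M₁ - c) * (w * Δ) := mul_pos (by linarith) hwΔ
    nlinarith
  have hlow : ((4 * c + b) / (1 - η₂) + 1) * w * Δ ^ 2 ≤ mdec := by
    -- Comparison with the steepest descent step to the boundary of the trust region (Cauchy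
    -- decrease).
    have hv : ‖(-(Δ / ‖φ‖)) • φ‖ ≤ Δ := by
      rw [norm_smul, Real.norm_eq_abs, abs_neg, abs_of_pos (by positivity)]
      field_simp; exact le_rfl
    have h1 := hmin _ hv
    have h2 := (abs_le.1 (hquad _ hv)).2
    have h3 : inner ℝ φ ((-(Δ / ‖φ‖)) • φ) = -(Δ * ‖φ‖) := by
      rw [real_inner_smul_right, real_inner_self_eq_norm_sq]
      field_simp
    rw [h3] at h1
    have h4 : (M₁ - c) * w * Δ ^ 2 ≤ Δ * ‖φ‖ := by nlinarith
    have h5 : b * Δ ^ 2 ≤ b * w * Δ ^ 2 := by gcongr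
    have h6 : 0 ≤ b * Δ ^ 2 := by positivity
    have h7 : ((4 * c + b) / (1 - η₂) + 1 + b) * (w * Δ ^ 2) ≤ (M₁ - c) * (w * Δ ^ 2) :=
      mul_le_mul_of_nonneg_right (by linarith) (by positivity)
    nlinarith
  have hwD : Δ ^ 2 ≤ w * Δ ^ 2 := by nlinarith [sq_nonneg Δ]
  have hD2 : 0 < Δ ^ 2 := by positivity
  have hX : (4 * c + b) / (1 - η₂) * (w * Δ ^ 2) + w * Δ ^ 2 ≤ mdec := by linarith
  have hX0 : 0 ≤ (4 * c + b) / (1 - η₂) * (w * Δ ^ 2) := by positivity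
  have hpos : 0 < mdec := by linarith
  refine ⟨?_, ?_⟩
  · have h1 : min Δ (Δ ^ 2) ≤ Δ ^ 2 := min_le_right _ _
    have h0 : 0 ≤ min Δ (Δ ^ 2) := le_min hΔ.le hD2.le
    nlinarith
  · rw [le_div_iff₀ hpos]
    have h1 : |inner ℝ (φ - d) s| ≤ c * w * Δ ^ 2 := by
      calc _ ≤ ‖φ - d‖ * ‖s‖ := abs_real_inner_le_norm _ _
        _ ≤ (c * w * Δ) * Δ := mul_le_mul hφ hs (norm_nonneg _) (by positivity)
        _ = _ := by ring
    rw [inner_sub_left] at h1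
    have h2 := abs_le.1 (hquad s hs)
    rw [abs_le] at h1 htay he he'
    have h3 : b * Δ ^ 2 ≤ b * w * Δ ^ 2 := by gcongr
    -- Estimated and predicted decrease differ by two estimation errors, one Taylor error, one
    -- gradient error and the quadratic term of the model: at most `(4c + b) w Δ²`. This must fit
    -- into `(1 - η₂) mdec`, which fixes the quotient in `M₁`.
    have h4 : (1 - η₂) * mdec ≥ (4 * c + b) * (w * Δ ^ 2) := by
      have : (1 - η₂) * ((4 * c + b) / (1 - η₂) * (w * Δ ^ 2)) ≤ (1 - η₂) * mdec := by
        refine mul_le_mul_of_nonneg_left ?_ h1η.le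
        linarith [mul_pos (by linarith : 0 < w) hD2]
      have e : (1 - η₂) * ((4 * c + b) / (1 - η₂) * (w * Δ ^ 2)) = (4 * c + b) * (w * Δ ^ 2) := by
        field_simp
      linarith
    nlinarith

/-! ### Elementary properties of a run -/

namespace Run

variable {n n₀ l : ℕ} {P : Problem n n₀ l} {A : Params} {Ω : Type u} [mΩ : MeasurableSpace Ω]
  {Pr : Measure Ω} (R : Run P A Pr)

theorem Δ_pos (hA : A.Valid) {m : ℕ} (hm : 1 ≤ m) (k : ℕ) (ω : Ω) : 0 < R.Δ m k ω := by
  induction k with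
  | zero => rw [R.Δ_zero m hm]; exact hA.Δ₀_pos
  | succ k ih =>
    by_cases h : R.Accept m k ω
    · rw [(R.step_accept hm h).2]
      exact lt_min one_pos (mul_pos (by linarith [hA.γinc_gt]) ih)
    · rw [(R.step_reject hm h).2]
      exact mul_pos hA.γdec_pos ih

theorem Δ_le_one (hA : A.Valid) {m : ℕ} (hm : 1 ≤ m) (k : ℕ) (ω : Ω) : R.Δ m k ω ≤ 1 := by
  induction k with
  | zero => rw [R.Δ_zero m hm]; exact hA.Δ₀_lt.le
  | succ k ih =>
    by_cases h : R.Accept m k ω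
    · rw [(R.step_accept hm h).2]
      exact min_le_left _ _
    · rw [(R.step_reject hm h).2]
      nlinarith [hA.γdec_pos, hA.γdec_lt, R.Δ_pos hA hm k ω]

theorem Active.zero (m : ℕ) (ω : Ω) : R.Active m 0 ω := fun j hj => absurd hj (Nat.not_lt_zero j)

theorem active_succ (m k : ℕ) (ω : Ω) :
    R.Active m (k + 1) ω ↔ R.Active m k ω ∧ R.r m ω < R.Δ m (k + 1) ω := by
  constructor
  · exact fun h => ⟨fun j hj => h j (by omega), h k (by omega)⟩
  · rintro ⟨h1, h2⟩ j hj
    rcases Nat.lt_succ_iff_lt_or_eq.1 hj with h | rfl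
    · exact h1 j h
    · exact h2

variable {R} in
-- For `k ≥ 1` activity means `Δ > r`. The factor `Δ₀` covers `k = 0`, where the radius is `Δ₀` and
-- only `r < 1` is known.
theorem Active.le_Δ (hA : A.Valid) {m k : ℕ} (hm : 1 ≤ m) {ω : Ω} (h : R.Active m k ω) :
    A.Δ₀ * R.r m ω ≤ R.Δ m k ω := by
  have hr0 := R.r_pos m hm ω
  have hr1 := R.r_lt m hm ω
  rcases k with _ | k
  · rw [R.Δ_zero m hm]
    nlinarith [hA.Δ₀_pos]
  · have := h k (Nat.lt_succ_self k)
    nlinarith [hA.Δ₀_lt]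

theorem μbar_nonneg (hA : A.Valid) {m : ℕ} (hm : 1 ≤ m) (ω : Ω) (i : Fin (l + 1)) :
    0 ≤ R.μbar m ω i := by
  rcases Nat.lt_or_ge 1 m with h | h
  · obtain ⟨m, rfl⟩ : ∃ m', m = m' + 1 := ⟨m - 1, by omega⟩
    rw [R.μbar_succ m (by omega), R.μ_succ m (by omega)]
    exact le_min hA.μmax_pos.le (le_max_left _ _)
  · obtain rfl : m = 1 := by omega
    rw [R.μbar_one]; exact zero_le_one

theorem μbar_le {m : ℕ} (hm : 1 ≤ m) (ω : Ω) (i : Fin (l + 1)) :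
    R.μbar m ω i ≤ max 1 A.μmax := by
  rcases Nat.lt_or_ge 1 m with h | h
  · obtain ⟨m, rfl⟩ : ∃ m', m = m' + 1 := ⟨m - 1, by omega⟩
    rw [R.μbar_succ m (by omega)]
    exact (min_le_left _ _).trans (le_max_right _ _)
  · obtain rfl : m = 1 := by omega
    rw [R.μbar_one]; exact le_max_left _ _

theorem ρ_pos (hA : A.Valid) {m : ℕ} (hm : 1 ≤ m) (ω : Ω) : 0 < R.ρ m ω := by
  induction m, hm using Nat.le_induction with
  | base => rw [R.ρ_one]; exact R.ρin_pos
  | succ m hm ih =>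
    rw [R.ρ_succ m hm]
    split_ifs
    · exact mul_pos (by linarith [hA.θρ_gt]) ih
    · exact ih

end Run

/-! ### Tuning constants of the drift analysis -/

/-- Constants for the potential function, relative to a bound `b` on the problem data and the
growth constants `p₀`, `t₀` of the distribution functions at the quantile. -/
structure Tuning (A : Params) (n l : ℕ) (b p₀ t₀ : ℝ) where
  c : ℝ
  M₁ : ℝ
  M : ℝ
  κ : ℝ
  c₁ : ℝ
  a : ℝ
  t₁ : ℝ
  t₃ : ℝ
  p₁ : ℝ
  C₅ : ℝ
  C₁ : ℝ
  C₀ : ℝ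
  c_eq : c = (2 * l + 4 * n + 4) * b ^ 2
  -- Above the ratio `M₁ w` accurate estimates force acceptance.
  M₁_ge : c + b + (4 * c + b) / (1 - A.η₂) + 1 ≤ M₁
  -- A rejection at ratio at most `M₁ w` leads to a ratio at most `M w`.
  M_ge : M₁ ≤ M * A.γdec
  M_ge_growth : 2 * c ≤ M * (A.γinc - 1)
  -- The truncated ratio starts at its floor `M w`.
  M_ge_start : c ≤ M * A.Δ₀
  κ_pos : 0 < κ
  -- Growth of the radius may consume a quarter of the decrease that an accepted step guarantees.
  κ_le : κ * (A.γinc ^ 2 - 1) ≤ A.η₁ * A.η₂ / 4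
  c₁_pos : 0 < c₁
  c₁_le : c₁ ≤ A.η₁ * A.η₂ / 4
  c₁_le_reject : c₁ ≤ κ * (1 - A.γdec ^ 2)
  a_pos : 0 < a
  a_lt : a < 1
  -- The contraction factor is at least the average of `1` and `1/γinc`; the gap to `1/γinc` absorbs
  -- the change of the gradient along the step.
  a_ge : 1 + A.γinc ≤ 2 * A.γinc * a
  t₁_pos : 0 < t₁
  t₁_le : t₁ ≤ t₀
  t₁_le_r₀ : t₁ ≤ A.r₀
  t₃_pos : 0 < t₃
  t₃_le : 8 * b * t₃ ≤ 1
  t₃_le_t₀ : 2 * c * t₃ ≤ t₀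
  t₃_le_one : 2 * c * t₃ ≤ 1
  p₁_pos : 0 < p₁
  p₁_le_one : p₁ ≤ 1
  -- Any of `2n + 3` evaluations may fail, and a failure multiplies the cubed ratio by at most
  -- `γdec⁻³`.
  p₁_le : (2 * n + 3) * p₁ ≤ (1 - a ^ 3) * A.γdec ^ 3
  C₅_ge : (M / a) ^ 3 ≤ C₅
  -- Half of the energy decrease covers the failures near the floor (`C₅`) and leaves one unit
  -- `r³/w`, which forces termination.
  C₁_ge : 2 * (C₅ + 1) ≤ C₁ * c₁ * A.Δ₀ ^ 2
  C₀_ge : 1 ≤ C₀ * (p₁ * p₀ ^ 2 * t₁ ^ 2)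
  C₀_ge_decrease : 8 ≤ C₀ * (p₀ ^ 2 * t₃ ^ 2 * (A.η₁ * A.η₂) * c₁)

theorem Tuning.C₀_pos {A : Params} {n l : ℕ} {b p₀ t₀ : ℝ} (T : Tuning A n l b p₀ t₀)
    (hp₀ : 0 < p₀) : 0 < T.C₀ := by
  have h1 := T.C₀_ge
  have := T.p₁_pos
  have := T.t₁_pos
  by_contra! h0
  have : T.C₀ * (T.p₁ * p₀ ^ 2 * T.t₁ ^ 2) ≤ 0 :=
    mul_nonpos_of_nonpos_of_nonneg h0 (by positivity)
  linarith

/-- There is no circularity: each constant is determined by the earlier ones, the problem data and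
the fixed parameters. -/
theorem Tuning.exists {A : Params} (hA : A.Valid) (n l : ℕ) {b p₀ t₀ : ℝ} (hb : 1 ≤ b)
    (hp₀ : 0 < p₀) (ht₀ : 0 < t₀) : Nonempty (Tuning A n l b p₀ t₀) := by
  have hγ := hA.γdec_pos
  have hγ1 := hA.γdec_lt
  have hγi := hA.γinc_gt
  have h1 := hA.η₁_pos
  have h2 := hA.η₂_pos
  have h3 := hA.η₂_lt
  have hΔ := hA.Δ₀_pos
  have hr := hA.r₀_pos
  have hη : 0 < A.η₁ * A.η₂ := by positivity
  have hγi1 : 0 < A.γinc - 1 := by linarith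
  have hγi2 : 0 < A.γinc ^ 2 - 1 := by nlinarith
  have hγd2 : 0 < 1 - A.γdec ^ 2 := by nlinarith
  have h1η : 0 < 1 - A.η₂ := by linarith
  set c : ℝ := (2 * l + 4 * n + 4) * b ^ 2 with hc
  have hc0 : 0 < c := by positivity
  set M₁ : ℝ := c + b + (4 * c + b) / (1 - A.η₂) + 1 with hM₁
  have hM₁0 : 0 < M₁ := by positivity
  set M : ℝ := M₁ / A.γdec + 2 * c / (A.γinc - 1) + c / A.Δ₀ with hM
  have e1 : 0 < M₁ / A.γdec := by positivity
  have e2 : 0 < 2 * c / (A.γinc - 1) := by positivity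
  have e3 : 0 < c / A.Δ₀ := by positivity
  set κ : ℝ := A.η₁ * A.η₂ / 4 / (A.γinc ^ 2 - 1) with hκ
  have hκ0 : 0 < κ := by positivity
  set c₁ : ℝ := min (A.η₁ * A.η₂ / 4) (κ * (1 - A.γdec ^ 2)) with hc₁
  have hc₁0 : 0 < c₁ := lt_min (by positivity) (by positivity)
  set a : ℝ := (1 + A.γinc) / (2 * A.γinc) with ha
  have ha0 : 0 < a := by positivity
  have ha1 : a < 1 := by rw [ha, div_lt_one (by positivity)]; linarith
  have ha3 : 0 < 1 - a ^ 3 := by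
    have : a ^ 3 < 1 := pow_lt_one₀ ha0.le ha1 (by norm_num)
    linarith
  set t₁ : ℝ := min t₀ A.r₀ with ht₁
  have ht₁0 : 0 < t₁ := lt_min ht₀ hr
  set t₃ : ℝ := min (1 / (8 * b)) (min (t₀ / (2 * c)) (1 / (2 * c))) with ht₃
  have ht₃0 : 0 < t₃ := lt_min (by positivity) (lt_min (by positivity) (by positivity))
  set p₁ : ℝ := min 1 ((1 - a ^ 3) * A.γdec ^ 3 / (2 * n + 3)) with hp₁
  have hp₁0 : 0 < p₁ := lt_min one_pos (by positivity)
  set C₅ : ℝ := (M / a) ^ 3 with hC₅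
  refine ⟨⟨c, M₁, M, κ, c₁, a, t₁, t₃, p₁, C₅, 2 * (C₅ + 1) / (c₁ * A.Δ₀ ^ 2),
    1 / (p₁ * p₀ ^ 2 * t₁ ^ 2) + 8 / (p₀ ^ 2 * t₃ ^ 2 * (A.η₁ * A.η₂) * c₁), rfl, le_rfl, ?_, ?_, ?_,
    hκ0, ?_, hc₁0, min_le_left _ _, min_le_right _ _, ha0, ha1, ?_, ht₁0, min_le_left _ _,
    min_le_right _ _, ht₃0, ?_, ?_, ?_, hp₁0, min_le_left _ _, ?_, le_rfl, ?_, ?_, ?_⟩⟩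
  · rw [← div_le_iff₀ hγ]; linarith
  · rw [← div_le_iff₀ hγi1]; linarith
  · rw [← div_le_iff₀ hΔ]; linarith
  · rw [hκ, div_mul_cancel₀ _ hγi2.ne']
  · rw [ha]; field_simp; exact le_rfl
  · rw [mul_comm, ← le_div_iff₀ (by positivity)]
    exact min_le_left _ _
  · rw [mul_comm, ← le_div_iff₀ (by positivity)]
    exact (min_le_right _ _).trans (min_le_left _ _)
  · rw [mul_comm, ← le_div_iff₀ (by positivity)]
    exact (min_le_right _ _).trans (min_le_right _ _)
  · rw [mul_comm, ← le_div_iff₀ (by positivity)]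
    exact min_le_right _ _
  · rw [mul_assoc, div_mul_cancel₀ _ (by positivity)]
  · have : 0 < p₁ * p₀ ^ 2 * t₁ ^ 2 := by positivity
    rw [add_mul, one_div, inv_mul_cancel₀ this.ne']
    have : 0 ≤ 8 / (p₀ ^ 2 * t₃ ^ 2 * (A.η₁ * A.η₂) * c₁) * (p₁ * p₀ ^ 2 * t₁ ^ 2) := by positivity
    linarith
  · have : 0 < p₀ ^ 2 * t₃ ^ 2 * (A.η₁ * A.η₂) * c₁ := by positivity
    rw [add_mul, div_mul_cancel₀ _ this.ne']
    have : 0 ≤ 1 / (p₁ * p₀ ^ 2 * t₁ ^ 2) * (p₀ ^ 2 * t₃ ^ 2 * (A.η₁ * A.η₂) * c₁) := by positivity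
    linarith

/-! ### One iteration, path by path -/

namespace Run

variable {n n₀ l : ℕ} {P : Problem n n₀ l} {A : Params} {Ω : Type u} [mΩ : MeasurableSpace Ω]
  {Pr : Measure Ω} (R : Run P A Pr) {S : Set (Vec n)} {b p₀ t₀ : ℝ} (T : Tuning A n l b p₀ t₀)

/-- The weight `1 + ∑ᵢ μ̄ᵢ + ρ` in outer iteration `m`. -/
def w (m : ℕ) (ω : Ω) : ℝ := Problem.weight (R.ρ m ω) (R.μbar m ω)

/-- The merit function of outer iteration `m`. -/
def merit (m : ℕ) (ω : Ω) : Vec n → ℝ := P.Phi (R.ρ m ω) (R.μbar m ω)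

/-- The gradient of the merit function at the current inner iterate. -/
def grad (m k : ℕ) (ω : Ω) : Vec n := P.dPhi (R.ρ m ω) (R.μbar m ω) (R.X m k ω)

/-- The truncated ratio of gradient norm and radius. -/
def ratio (M : ℝ) (m k : ℕ) (ω : Ω) : ℝ := max (‖R.grad m k ω‖ / R.Δ m k ω) (M * R.w m ω)

/-- Merit function value plus multiple of the squared radius, shifted to be nonnegative. -/
def energy (c κ : ℝ) (m k : ℕ) (ω : Ω) : ℝ :=
  R.merit m ω (R.X m k ω) - R.merit m ω (R.X m 0 ω) + c * R.w m ω + κ * R.Δ m k ω ^ 2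

/-- The potential function of the drift analysis. -/
def potential (m k : ℕ) (ω : Ω) : ℝ :=
  R.r m ω ^ 3 * R.ratio T.M m k ω ^ 3 + T.C₁ * R.r m ω / R.w m ω * R.energy T.c T.κ m k ω

/-- Points at which the model batch has to be accurate. -/
def modelPt (m k : ℕ) (j : Option (Fin n × Bool)) (ω : Ω) : Vec n :=
  match j with
  | none => R.X m k ω
  | some (j, true) => R.X m k ω + (A.r₀ * R.Δ m k ω) • EuclideanSpace.single j (1 : ℝ)
  | some (j, false) => R.X m k ω - (A.r₀ * R.Δ m k ω) • EuclideanSpace.single j (1 : ℝ)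

/-- Points at which the test batch has to be accurate. -/
def testPt (m k : ℕ) (j : Bool) (ω : Ω) : Vec n :=
  match j with
  | false => R.X m k ω
  | true => R.X m k ω + R.s m k ω

/-- Error of the empirical quantile of the model batch. -/
def modelDev (m k : ℕ) (j : Option (Fin n × Bool)) (ω : Ω) : ℝ :=
  |P.QN (R.N m k ω) (fun i => R.ξ (.model m k i) ω) (R.modelPt m k j ω) - P.Q (R.modelPt m k j ω)|

/-- Error of the empirical quantile of the test batch. -/
def testDev (m k : ℕ) (j : Bool) (ω : Ω) : ℝ :=
  |P.QN (R.N m k ω) (fun i => R.ξ (.test m k i) ω) (R.testPt m k j ω) - P.Q (R.testPt m k j ω)|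

/-- Change of the merit function along the trial step, plus the required decrease. -/
def excess (m k : ℕ) (ω : Ω) : ℝ :=
  R.merit m ω (R.X m k ω + R.s m k ω) - R.merit m ω (R.X m k ω)
    + A.η₁ * A.η₂ * R.Δ m k ω ^ 2

/-- The excess, as far as it is significant. -/
def bigExcess (m k : ℕ) (ω : Ω) : ℝ :=
  if A.η₁ * A.η₂ * R.Δ m k ω ^ 2 / 2 < R.excess m k ω then R.excess m k ω else 0

/-- Pathwise conditions on inner iteration `k` of outer iteration `m`. -/
structure Regular (S : Set (Vec n)) (b : ℝ) (m k : ℕ) (ω : Ω) : Prop where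
  one_le : 1 ≤ m
  start_mem : R.X m 0 ω ∈ S
  ball : Metric.closedBall (R.X m k ω) (R.Δ m k ω) ⊆ S
  H_le : ‖R.H m k ω‖ ≤ b

section

variable {R T} {m k : ℕ} {ω : Ω}

theorem one_le_w (hA : A.Valid) (hm : 1 ≤ m) : 1 ≤ R.w m ω := by
  have := Problem.le_weight (ρ := R.ρ m ω) (R.μbar_nonneg hA hm ω) 0
  unfold w
  linarith [R.μbar_nonneg hA hm ω 0, R.ρ_pos hA hm ω]

theorem Tuning_c_pos (T : Tuning A n l b p₀ t₀) (hb : 1 ≤ b) : 0 < T.c := by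
  rw [T.c_eq]; positivity

theorem Tuning_b_le_c (T : Tuning A n l b p₀ t₀) (hb : 1 ≤ b) : 2 * b ≤ T.c := by
  rw [T.c_eq]
  have h1 : b ≤ b ^ 2 := by nlinarith
  have h2 : (0 : ℝ) ≤ (2 * l + 4 * n) * b ^ 2 := by positivity
  nlinarith

theorem Tuning_M_pos (T : Tuning A n l b p₀ t₀) (hA : A.Valid) (hb : 1 ≤ b) : 0 < T.M := by
  have h := T.M_ge_growth
  have := Tuning_c_pos T hb
  have := hA.γinc_gt
  by_contra! h0
  nlinarith

theorem Tuning_c_le_M (T : Tuning A n l b p₀ t₀) (hA : A.Valid) (hb : 1 ≤ b) : T.c ≤ T.M := by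
  have h := T.M_ge_start
  have := Tuning_M_pos T hA hb
  nlinarith [hA.Δ₀_lt]

namespace Regular

variable (hR : R.Regular S b m k ω) (hA : A.Valid) (hb : P.BoundedBy S b)

include hR hA in
theorem X_mem : R.X m k ω ∈ S :=
  hR.ball (Metric.mem_closedBall_self (R.Δ_pos hA hR.one_le k ω).le)

include hR in
theorem step_mem_ball : R.X m k ω + R.s m k ω ∈ Metric.closedBall (R.X m k ω) (R.Δ m k ω) := by
  simpa [dist_eq_norm] using R.s_mem m k hR.one_le ω

include hR in
theorem step_mem : R.X m k ω + R.s m k ω ∈ S := hR.ball hR.step_mem_ball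

include hR hA in
theorem next_mem : R.X m (k + 1) ω ∈ S := by
  by_cases h : R.Accept m k ω
  · rw [(R.step_accept hR.one_le h).1]; exact hR.step_mem
  · rw [(R.step_reject hR.one_le h).1]; exact hR.X_mem hA

include hR hA hb in
theorem norm_grad_le : ‖R.grad m k ω‖ ≤ T.c * R.w m ω := by
  refine (hb.norm_dPhi_le (R.ρ_pos hA hR.one_le ω) (R.μbar_nonneg hA hR.one_le ω)
    (hR.X_mem hA)).trans ?_
  have hw := one_le_w (R := R) (ω := ω) hA hR.one_le
  rw [T.c_eq]
  refine mul_le_mul_of_nonneg_right ?_ (by linarith : 0 ≤ R.w m ω)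
  refine mul_le_mul_of_nonneg_right ?_ (by positivity)
  have : (0 : ℝ) ≤ n := Nat.cast_nonneg n
  have : (0 : ℝ) ≤ l := Nat.cast_nonneg l
  linarith

include hR hA hb in
theorem norm_grad_next_le : ‖R.grad m (k + 1) ω‖ ≤ T.c * R.w m ω := by
  refine (hb.norm_dPhi_le (R.ρ_pos hA hR.one_le ω) (R.μbar_nonneg hA hR.one_le ω)
    (hR.next_mem hA)).trans ?_
  have hw := one_le_w (R := R) (ω := ω) hA hR.one_le
  rw [T.c_eq]
  refine mul_le_mul_of_nonneg_right ?_ (by linarith : 0 ≤ R.w m ω)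
  refine mul_le_mul_of_nonneg_right ?_ (by positivity)
  have : (0 : ℝ) ≤ n := Nat.cast_nonneg n
  have : (0 : ℝ) ≤ l := Nat.cast_nonneg l
  linarith

include hR hA hb in
theorem norm_grad_next_le_add (h : R.Accept m k ω) :
    ‖R.grad m (k + 1) ω‖ ≤ ‖R.grad m k ω‖ + T.c * R.w m ω * R.Δ m k ω := by
  have h1 := hb.norm_dPhi_sub_le (R.ρ_pos hA hR.one_le ω) (R.μbar_nonneg hA hR.one_le ω) hR.ball
    hR.step_mem_ball
  have h2 := norm_sub_norm_le (P.dPhi (R.ρ m ω) (R.μbar m ω) (R.X m k ω + R.s m k ω))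
    (P.dPhi (R.ρ m ω) (R.μbar m ω) (R.X m k ω))
  have hw := one_le_w (R := R) (ω := ω) hA hR.one_le
  rw [add_sub_cancel_left] at h1
  have h3 : (2 * l + 3) * b ^ 2 * R.w m ω * ‖R.s m k ω‖ ≤ T.c * R.w m ω * R.Δ m k ω := by
    rw [T.c_eq]
    refine mul_le_mul (mul_le_mul_of_nonneg_right (mul_le_mul_of_nonneg_right ?_ (by positivity))
      (by linarith)) (R.s_mem m k hR.one_le ω) (norm_nonneg _) (by positivity)
    have : (0 : ℝ) ≤ n := Nat.cast_nonneg n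
    linarith
  unfold grad
  rw [(R.step_accept hR.one_le h).1]
  unfold w at h3 ⊢
  linarith

include hR hA hb in
-- If the radius is capped at `1`, the bound `c w ≤ M w` on the gradient suffices. Otherwise the
-- ratio `q` becomes at most `(q + c w)/γinc`, and `2c ≤ M (γinc - 1)` turns this into `a q` when `q
-- ≥ M w` and into `M w` when `q ≤ M w`.
theorem ratio_accept (h : R.Accept m k ω) :
    R.ratio T.M m (k + 1) ω ≤ max (T.a * R.ratio T.M m k ω) (T.M * R.w m ω) := by
  have hw := one_le_w (R := R) (ω := ω) hA hR.one_le
  have hΔ := R.Δ_pos hA hR.one_le k ω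
  have hM := Tuning_M_pos T hA hb.one_le
  have hcM := Tuning_c_le_M T hA hb.one_le
  have hγ := hA.γinc_gt
  have hγ0 : 0 < A.γinc := by linarith
  refine max_le ?_ (le_max_right _ _)
  rw [(R.step_accept hR.one_le h).2]
  rcases le_total 1 (A.γinc * R.Δ m k ω) with h1 | h1
  · rw [min_eq_left h1, div_one]
    refine le_max_of_le_right ((hR.norm_grad_next_le (T := T) hA hb).trans ?_)
    exact mul_le_mul_of_nonneg_right hcM (by linarith)
  · rw [min_eq_right h1]
    set q := ‖R.grad m k ω‖ / R.Δ m k ω with hq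
    have h2 : ‖R.grad m (k + 1) ω‖ / (A.γinc * R.Δ m k ω) ≤ (q + T.c * R.w m ω) / A.γinc := by
      rw [div_le_div_iff₀ (by positivity) hγ0]
      have h3 := hR.norm_grad_next_le_add (T := T) hA hb h
      have e : ‖R.grad m k ω‖ = q * R.Δ m k ω := by rw [hq]; field_simp
      rw [e] at h3
      nlinarith
    have hMg := T.M_ge_growth
    have hMw : 2 * T.c * R.w m ω ≤ T.M * (A.γinc - 1) * R.w m ω := by gcongr
    rcases le_total q (T.M * R.w m ω) with h4 | h4
    · refine le_max_of_le_right (h2.trans ?_)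
      rw [div_le_iff₀ hγ0]
      have : 0 < T.c * R.w m ω := mul_pos (Tuning_c_pos T hb.one_le) (by linarith)
      nlinarith
    · refine le_max_of_le_left (h2.trans ?_)
      rw [div_le_iff₀ hγ0]
      have h5 : q ≤ R.ratio T.M m k ω := le_max_left _ _
      have h6 := T.a_ge
      have hq0 : 0 ≤ q := by positivity
      have h7 : T.a * q * A.γinc ≤ T.a * R.ratio T.M m k ω * A.γinc := by
        have := T.a_pos.le
        gcongr
      have h8 : (1 + A.γinc) * q ≤ 2 * A.γinc * T.a * q := by gcongr
      have h9 : T.M * R.w m ω * (A.γinc - 1) ≤ q * (A.γinc - 1) :=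
        mul_le_mul_of_nonneg_right h4 (by linarith)
      nlinarith

omit hb in
include hR hA in
theorem ratio_reject (hb1 : 1 ≤ b) (h : ¬ R.Accept m k ω) :
    R.ratio T.M m (k + 1) ω ≤ R.ratio T.M m k ω / A.γdec := by
  have hw := one_le_w (R := R) (ω := ω) hA hR.one_le
  have hM := Tuning_M_pos T hA hb1
  have hγ := hA.γdec_pos
  have e : ‖R.grad m (k + 1) ω‖ / (A.γdec * R.Δ m k ω) = ‖R.grad m k ω‖ / R.Δ m k ω / A.γdec := by
    unfold grad
    rw [(R.step_reject hR.one_le h).1, mul_comm A.γdec, div_div]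
  unfold ratio
  rw [(R.step_reject hR.one_le h).2, e]
  refine max_le (div_le_div_of_nonneg_right (le_max_left _ _) hγ.le) ?_
  rw [le_div_iff₀ hγ]
  refine le_trans ?_ (le_max_right _ _)
  have : 0 < T.M * R.w m ω := mul_pos hM (by linarith)
  nlinarith [hA.γdec_lt]

include hR hA hb in
theorem abs_est_sub_le {y : Vec n} (hy : y ∈ S) {e : ℝ}
    (he : |P.QN (R.N m k ω) (fun i => R.ξ (.test m k i) ω) y - P.Q y| ≤ e) (he1 : e ≤ 1) :
    |R.est m k ω y - R.merit m ω y| ≤ 2 * b * R.w m ω * e :=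
  hb.abs_PhiN_sub_le (R.ρ_pos hA hR.one_le ω) (R.μbar_nonneg hA hR.one_le ω) hy he he1

theorem mdec_eq : R.mdec m k ω =
    -inner ℝ (P.phiN (R.N m k ω) (fun i => R.ξ (.model m k i) ω) (R.ρ m ω) (R.μbar m ω)
      (A.r₀ * R.Δ m k ω) (R.X m k ω)) (R.s m k ω)
    - 1 / 2 * inner ℝ (R.s m k ω) (R.H m k ω (R.s m k ω)) := by
  simp [mdec, mdl, Problem.model]
  ring

include hR hA hb in
theorem accept_of_dev_le (hmod : ∀ j, R.modelDev m k j ω ≤ T.t₁ * R.Δ m k ω ^ 2)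
    (htest : ∀ j, R.testDev m k j ω ≤ T.t₁ * R.Δ m k ω ^ 2)
    (hg : T.M₁ * R.w m ω < ‖R.grad m k ω‖ / R.Δ m k ω) : R.Accept m k ω := by
  have hm := hR.one_le
  have hw := one_le_w (R := R) (ω := ω) hA hm
  have hΔ := R.Δ_pos hA hm k ω
  have hΔ1 := R.Δ_le_one hA hm k ω
  have hb1 := hb.one_le
  have hρ := R.ρ_pos hA hm ω
  have hμ := R.μbar_nonneg hA hm ω
  have hc := Tuning_c_pos T hb1
  have hbc := Tuning_b_le_c T hb1
  have hn : (0 : ℝ) ≤ n := Nat.cast_nonneg n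
  have hl : (0 : ℝ) ≤ l := Nat.cast_nonneg l
  have ht1 : T.t₁ ≤ 1 := T.t₁_le_r₀.trans hA.r₀_lt.le
  have ht1Δ : T.t₁ * R.Δ m k ω ^ 2 ≤ R.Δ m k ω ^ 2 := by nlinarith [sq_nonneg (R.Δ m k ω)]
  have hΔsq : R.Δ m k ω ^ 2 ≤ 1 := by nlinarith
  have hest : ∀ y ∈ S, |P.QN (R.N m k ω) (fun i => R.ξ (.test m k i) ω) y - P.Q y|
      ≤ T.t₁ * R.Δ m k ω ^ 2 → |R.est m k ω y - R.merit m ω y| ≤ T.c * R.w m ω * R.Δ m k ω ^ 2 := by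
    intro y hy h
    refine (hR.abs_est_sub_le hA hb hy h (by linarith)).trans ?_
    exact mul_le_mul (mul_le_mul_of_nonneg_right hbc (by linarith)) ht1Δ
      (mul_nonneg T.t₁_pos.le (sq_nonneg _)) (by positivity)
  refine accept_of_accurate (F := R.merit m ω) (Fe := R.est m k ω) (x := R.X m k ω)
    (s := R.s m k ω) (d := R.grad m k ω) (H := R.H m k ω) (b := b) (c := T.c) (w := R.w m ω)
    (M₁ := T.M₁) hΔ (by linarith) hc.le hw hA.η₁_lt.le hA.η₂_lt T.M₁_ge hR.H_le
    (R.s_mem m k hm ω) mdec_eq ?_ ?_ ?_ (hest _ (hR.X_mem hA) (htest false))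
    (hest _ hR.step_mem (htest true)) ((lt_div_iff₀ hΔ).1 hg)
  · intro v hv
    have h := R.s_min m k hm ω v hv
    rw [mdec, mdl, mdl]
    simp only [Problem.model, add_sub_cancel_left, sub_self, inner_zero_right, map_zero] at h ⊢
    linarith
  · refine (hb.norm_phiN_sub_le hρ hμ hR.ball hΔ hΔ1 hA.r₀_pos hA.r₀_lt.le rfl T.t₁_le_r₀
      (hmod none) (fun j => hmod (some (j, true))) fun j => hmod (some (j, false))).trans ?_
    rw [T.c_eq]
    unfold w
    refine mul_le_mul_of_nonneg_right (mul_le_mul_of_nonneg_right (mul_le_mul_of_nonneg_right ?_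
      (by positivity)) (by unfold w at hw; linarith)) hΔ.le
    linarith
  · have h := hb.abs_Phi_taylor_le hρ hμ hR.ball hR.step_mem_ball
    rw [add_sub_cancel_left] at h
    refine h.trans ?_
    rw [T.c_eq]
    refine mul_le_mul (mul_le_mul_of_nonneg_right (mul_le_mul_of_nonneg_right ?_
      (by positivity)) (by unfold w at hw; linarith)) ?_ (sq_nonneg _) (by positivity)
    · linarith
    · exact pow_le_pow_left₀ (norm_nonneg _) (R.s_mem m k hm ω) 2

include hR hA hb in
-- An accurate iteration is rejected only at ratio at most `M₁ w`; shrinking the radius by `γdec`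
-- then keeps the ratio below the floor.
theorem ratio_good (hmod : ∀ j, R.modelDev m k j ω ≤ T.t₁ * R.Δ m k ω ^ 2)
    (htest : ∀ j, R.testDev m k j ω ≤ T.t₁ * R.Δ m k ω ^ 2) :
    R.ratio T.M m (k + 1) ω ≤ max (T.a * R.ratio T.M m k ω) (T.M * R.w m ω) := by
  by_cases h : R.Accept m k ω
  · exact hR.ratio_accept hA hb h
  · have hg : ‖R.grad m k ω‖ / R.Δ m k ω ≤ T.M₁ * R.w m ω := by
      by_contra! hlt
      exact h (hR.accept_of_dev_le hA hb hmod htest hlt)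
    have hw := one_le_w (R := R) (ω := ω) hA hR.one_le
    refine max_le (le_max_of_le_right ?_) (le_max_right _ _)
    have e : ‖R.grad m (k + 1) ω‖ / R.Δ m (k + 1) ω
        = ‖R.grad m k ω‖ / R.Δ m k ω / A.γdec := by
      unfold grad
      rw [(R.step_reject hR.one_le h).1, (R.step_reject hR.one_le h).2, mul_comm A.γdec, div_div]
    rw [e, div_le_iff₀ hA.γdec_pos]
    have h1 := mul_le_mul_of_nonneg_right T.M_ge (by linarith : 0 ≤ R.w m ω)
    nlinarith

include hA in
omit hR hb in
theorem _root_.QuantileALM.Run.ratio_pos (hb1 : 1 ≤ b) (hm : 1 ≤ m) (k : ℕ) :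
    0 < R.ratio T.M m k ω :=
  lt_max_of_lt_right (mul_pos (Tuning_M_pos T hA hb1) (by linarith [one_le_w (R := R) (ω := ω) hA hm]))

include hR hA hb in
theorem ratio_next_le : R.ratio T.M m (k + 1) ω ≤ R.ratio T.M m k ω / A.γdec := by
  by_cases h : R.Accept m k ω
  · have h0 := ratio_pos (R := R) (T := T) (ω := ω) hA hb.one_le hR.one_le k
    refine (hR.ratio_accept hA hb h).trans ?_
    rw [le_div_iff₀ hA.γdec_pos]
    have h1 : max (T.a * R.ratio T.M m k ω) (T.M * R.w m ω) ≤ R.ratio T.M m k ω :=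
      max_le (by nlinarith [T.a_lt]) (le_max_right _ _)
    nlinarith [hA.γdec_lt, hA.γdec_pos]
  · exact hR.ratio_reject hA hb.one_le h

include hR hA hb in
open Classical in
-- One penalty per evaluation instead of one for the union of the failures: the bound stays additive
-- and can be integrated batch by batch.
theorem ratio_cube_le :
    R.ratio T.M m (k + 1) ω ^ 3 ≤ max (T.a * R.ratio T.M m k ω) (T.M * R.w m ω) ^ 3
      + ((∑ j, if T.t₁ * R.Δ m k ω ^ 2 < R.modelDev m k j ω
            then R.ratio T.M m k ω ^ 3 / A.γdec ^ 3 else 0)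
        + ∑ j, if T.t₁ * R.Δ m k ω ^ 2 < R.testDev m k j ω
            then R.ratio T.M m k ω ^ 3 / A.γdec ^ 3 else 0) := by
  have hγ := hA.γdec_pos
  have h0 := ratio_pos (R := R) (T := T) (ω := ω) hA hb.one_le hR.one_le k
  have h1 := ratio_pos (R := R) (T := T) (ω := ω) hA hb.one_le hR.one_le (k + 1)
  have hq : 0 ≤ R.ratio T.M m k ω ^ 3 / A.γdec ^ 3 := by positivity
  have hG : 0 ≤ max (T.a * R.ratio T.M m k ω) (T.M * R.w m ω) ^ 3 :=
    pow_nonneg (le_max_of_le_left (mul_nonneg T.a_pos.le h0.le)) 3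
  have hs1 : 0 ≤ ∑ j, if T.t₁ * R.Δ m k ω ^ 2 < R.modelDev m k j ω
            then R.ratio T.M m k ω ^ 3 / A.γdec ^ 3 else 0 :=
    Finset.sum_nonneg fun j _ => by split_ifs <;> [exact hq; exact le_rfl]
  have hs2 : 0 ≤ ∑ j, if T.t₁ * R.Δ m k ω ^ 2 < R.testDev m k j ω
            then R.ratio T.M m k ω ^ 3 / A.γdec ^ 3 else 0 :=
    Finset.sum_nonneg fun j _ => by split_ifs <;> [exact hq; exact le_rfl]
  have hbad : R.ratio T.M m (k + 1) ω ^ 3 ≤ R.ratio T.M m k ω ^ 3 / A.γdec ^ 3 := by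
    rw [← div_pow]
    exact pow_le_pow_left₀ h1.le (hR.ratio_next_le hA hb) 3
  by_cases hmod : ∀ j, R.modelDev m k j ω ≤ T.t₁ * R.Δ m k ω ^ 2
  · by_cases htest : ∀ j, R.testDev m k j ω ≤ T.t₁ * R.Δ m k ω ^ 2
    · have := pow_le_pow_left₀ h1.le (hR.ratio_good (T := T) hA hb hmod htest) 3
      linarith
    · push Not at htest
      obtain ⟨j, hj⟩ := htest
      have := Finset.single_le_sum (f := fun j => if T.t₁ * R.Δ m k ω ^ 2 < R.testDev m k j ω
            then R.ratio T.M m k ω ^ 3 / A.γdec ^ 3 else 0)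
        (fun j _ => by split_ifs <;> [exact hq; exact le_rfl]) (Finset.mem_univ j)
      simp only [if_pos hj] at this
      linarith
  · push Not at hmod
    obtain ⟨j, hj⟩ := hmod
    have := Finset.single_le_sum (f := fun j => if T.t₁ * R.Δ m k ω ^ 2 < R.modelDev m k j ω
          then R.ratio T.M m k ω ^ 3 / A.γdec ^ 3 else 0)
      (fun j _ => by split_ifs <;> [exact hq; exact le_rfl]) (Finset.mem_univ j)
    simp only [if_pos hj] at this
    linarith

include hR hA hb in
theorem abs_merit_sub_le {x y : Vec n} (hx : x ∈ S) (hy : y ∈ S) :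
    |R.merit m ω x - R.merit m ω y| ≤ T.c * R.w m ω := by
  have hw := one_le_w (R := R) (ω := ω) hA hR.one_le
  refine (hb.abs_Phi_sub_le (R.ρ_pos hA hR.one_le ω) (R.μbar_nonneg hA hR.one_le ω) hx hy).trans ?_
  rw [T.c_eq]
  have : (0 : ℝ) ≤ n := Nat.cast_nonneg n
  exact mul_le_mul_of_nonneg_right (mul_le_mul_of_nonneg_right (by linarith) (by positivity))
    (by unfold w at hw; linarith)

include hR hA hb in
-- The shift `c w` outweighs the oscillation of `Φ` on `S`. This makes `core` nonnegative, as the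
-- splitting of integrals in `[0,∞]` requires.
theorem energy_ge : T.c₁ * R.Δ m k ω ^ 2 ≤ R.energy T.c T.κ m k ω := by
  have h1 := (abs_le.1 (hR.abs_merit_sub_le (T := T) hA hb (hR.X_mem hA) hR.start_mem)).1
  have h2 : T.c₁ ≤ T.κ := T.c₁_le_reject.trans (by nlinarith [T.κ_pos, sq_nonneg A.γdec])
  have h3 : T.c₁ * R.Δ m k ω ^ 2 ≤ T.κ * R.Δ m k ω ^ 2 := by gcongr
  unfold energy
  linarith

include hR hA hb in
theorem energy_next_nonneg : 0 ≤ R.energy T.c T.κ m (k + 1) ω := by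
  have h1 := (abs_le.1 (hR.abs_merit_sub_le (T := T) hA hb (hR.next_mem hA) hR.start_mem)).1
  have h3 : 0 ≤ T.κ * R.Δ m (k + 1) ω ^ 2 := mul_nonneg T.κ_pos.le (sq_nonneg _)
  unfold energy
  linarith

include hR hA hb in
theorem excess_le : R.excess m k ω ≤ 2 * T.c * R.w m ω := by
  have h1 := (abs_le.1 (hR.abs_merit_sub_le (T := T) hA hb hR.step_mem (hR.X_mem hA))).2
  have hw := one_le_w (R := R) (ω := ω) hA hR.one_le
  have hΔ := R.Δ_pos hA hR.one_le k ω
  have hΔ1 := R.Δ_le_one hA hR.one_le k ω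
  have hc := Tuning_b_le_c T hb.one_le
  have hη : A.η₁ * A.η₂ ≤ 1 := by nlinarith [hA.η₁_pos, hA.η₁_lt, hA.η₂_pos, hA.η₂_lt]
  have hη0 : 0 ≤ A.η₁ * A.η₂ := mul_nonneg hA.η₁_pos.le hA.η₂_pos.le
  have h2 : A.η₁ * A.η₂ * R.Δ m k ω ^ 2 ≤ 1 := by
    have : R.Δ m k ω ^ 2 ≤ 1 := by nlinarith
    nlinarith
  have h3 : 1 ≤ T.c * R.w m ω := by nlinarith [hb.one_le]
  unfold excess
  linarith

include hR hA in
omit hb in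
theorem est_decrease (h : R.Accept m k ω) : A.η₁ * A.η₂ * R.Δ m k ω ^ 2
    ≤ R.est m k ω (R.X m k ω) - R.est m k ω (R.X m k ω + R.s m k ω) := by
  have hΔ := R.Δ_pos hA hR.one_le k ω
  have hΔ1 := R.Δ_le_one hA hR.one_le k ω
  obtain ⟨h1, h2⟩ := h
  have hmin : min (R.Δ m k ω) (R.Δ m k ω ^ 2) = R.Δ m k ω ^ 2 := min_eq_right (by nlinarith)
  rw [hmin] at h1
  have hpos : 0 < R.mdec m k ω := lt_of_lt_of_le (by have := hA.η₁_pos; positivity) h1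
  rw [le_div_iff₀ hpos] at h2
  have := mul_le_mul_of_nonneg_left h1 hA.η₂_pos.le
  nlinarith

include hR hA hb in
-- If both test evaluations were accurate to `t₃ u / w`, with `u` the excess, each merit estimate
-- would be off by at most `2 b t₃ u`, together at most `u/2`. The estimated decrease would be at
-- most `η₁η₂Δ² - u/2`, too small for acceptance.
theorem exists_dev_of_accept (h : R.Accept m k ω)
    (hu : A.η₁ * A.η₂ * R.Δ m k ω ^ 2 / 2 < R.excess m k ω) :
    ∃ j, T.t₃ * R.excess m k ω / R.w m ω < R.testDev m k j ω := by
  by_contra! hdev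
  have hw := one_le_w (R := R) (ω := ω) hA hR.one_le
  have hw0 : 0 < R.w m ω := by linarith
  have hη0 : 0 < A.η₁ * A.η₂ := mul_pos hA.η₁_pos hA.η₂_pos
  have hu0 : 0 < R.excess m k ω := lt_of_le_of_lt (by positivity) hu
  have h1 : T.t₃ * R.excess m k ω / R.w m ω ≤ 1 := by
    rw [div_le_one hw0]
    have := mul_le_mul_of_nonneg_left (hR.excess_le (T := T) hA hb) T.t₃_pos.le
    have h3 := mul_le_mul_of_nonneg_right T.t₃_le_one hw0.le
    nlinarith
  have e1 := hR.abs_est_sub_le hA hb (hR.X_mem hA) (hdev false) h1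
  have e2 := hR.abs_est_sub_le hA hb hR.step_mem (hdev true) h1
  have e3 : 2 * b * R.w m ω * (T.t₃ * R.excess m k ω / R.w m ω)
      = 2 * b * T.t₃ * R.excess m k ω := by field_simp
  rw [e3, abs_le] at e1 e2
  have h4 := hR.est_decrease hA h
  have h5 := mul_le_mul_of_nonneg_right T.t₃_le hu0.le
  have h6 : R.merit m ω (R.X m k ω) - R.merit m ω (R.X m k ω + R.s m k ω)
      = A.η₁ * A.η₂ * R.Δ m k ω ^ 2 - R.excess m k ω := by unfold excess; ring
  linarith [e1.1, e1.2, e2.1, e2.2]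

include hR hA hb in
open Classical in
-- On acceptance `Φ` changes by `u - η₁η₂Δ²` and `κΔ²` grows by at most `η₁η₂Δ²/4`. If `u ≤
-- η₁η₂Δ²/2`, a decrease of `c₁Δ²` remains; a larger `u` is charged to an inaccurate test
-- evaluation. On rejection the radius term alone gives the decrease.
theorem energy_next_le : R.energy T.c T.κ m (k + 1) ω
    ≤ R.energy T.c T.κ m k ω - T.c₁ * R.Δ m k ω ^ 2
      + ∑ j, if T.t₃ * R.excess m k ω / R.w m ω < R.testDev m k j ω
          then R.bigExcess m k ω else 0 := by
  have hη0 : 0 < A.η₁ * A.η₂ := mul_pos hA.η₁_pos hA.η₂_pos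
  have hbig : 0 ≤ R.bigExcess m k ω := by
    unfold bigExcess
    split_ifs with h
    · exact (lt_of_le_of_lt (by positivity) h).le
    · exact le_rfl
  have hsum : 0 ≤ ∑ j, if T.t₃ * R.excess m k ω / R.w m ω < R.testDev m k j ω
      then R.bigExcess m k ω else 0 :=
    Finset.sum_nonneg fun j _ => by split_ifs <;> [exact hbig; exact le_rfl]
  have hΔ := R.Δ_pos hA hR.one_le k ω
  have hΔ2 := sq_nonneg (R.Δ m k ω)
  by_cases h : R.Accept m k ω
  · have hΔ' : R.Δ m (k + 1) ω ^ 2 ≤ A.γinc ^ 2 * R.Δ m k ω ^ 2 := by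
      rw [(R.step_accept hR.one_le h).2, ← mul_pow]
      exact pow_le_pow_left₀ (le_min zero_le_one (mul_nonneg (by linarith [hA.γinc_gt]) hΔ.le))
        (min_le_right _ _) 2
    have hκ : T.κ * R.Δ m (k + 1) ω ^ 2
        ≤ T.κ * R.Δ m k ω ^ 2 + A.η₁ * A.η₂ / 4 * R.Δ m k ω ^ 2 := by
      have h1 := mul_le_mul_of_nonneg_left hΔ' T.κ_pos.le
      have h2 := mul_le_mul_of_nonneg_right T.κ_le hΔ2
      nlinarith
    have hc₁ := mul_le_mul_of_nonneg_right T.c₁_le hΔ2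
    have key : R.energy T.c T.κ m (k + 1) ω ≤ R.energy T.c T.κ m k ω
        - T.c₁ * R.Δ m k ω ^ 2 + (R.excess m k ω - A.η₁ * A.η₂ * R.Δ m k ω ^ 2 / 2) := by
      unfold energy excess
      rw [(R.step_accept hR.one_le h).1]
      linarith
    by_cases hu : A.η₁ * A.η₂ * R.Δ m k ω ^ 2 / 2 < R.excess m k ω
    · obtain ⟨j, hj⟩ := hR.exists_dev_of_accept (T := T) hA hb h hu
      have := Finset.single_le_sum (f := fun j => if T.t₃ * R.excess m k ω / R.w m ω
            < R.testDev m k j ω then R.bigExcess m k ω else 0)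
        (fun j _ => by split_ifs <;> [exact hbig; exact le_rfl]) (Finset.mem_univ j)
      simp only [if_pos hj] at this
      have e : R.bigExcess m k ω = R.excess m k ω := if_pos hu
      rw [e] at this ⊢
      have : 0 ≤ A.η₁ * A.η₂ * R.Δ m k ω ^ 2 / 2 := by positivity
      linarith
    · linarith
  · have h1 := mul_le_mul_of_nonneg_right T.c₁_le_reject hΔ2
    unfold energy at *
    rw [(R.step_reject hR.one_le h).1, (R.step_reject hR.one_le h).2, mul_pow]
    nlinarith

end Regular

end

end Run

/-! ### Integrating over a fresh batch -/

/-- Freezing the past needs the conditions on point, threshold and sample size wherever the weight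
is nonzero, but for a run some of them hold only almost surely. The weight is therefore cut off to
the event `E` of the past where they hold, which changes the integral by nothing. -/
theorem Problem.Regular.lintegral_batch_le {n n₀ l : ℕ} {P : Problem n n₀ l} {S : Set (Vec n)}
    {Lf Lg : ℝ} (hP : P.Regular S Lf Lg) {p₀ t₀ : ℝ} (hp₀ : 0 < p₀)
    (hgrow : ∀ x ∈ S, ∀ t, 0 < t → t ≤ t₀ →
      1 - P.α + p₀ * t ≤ P.ν.real {z | P.c₁ x z ≤ P.Q x + t} ∧
      P.ν.real {z | P.c₁ x z ≤ P.Q x - t} ≤ 1 - P.α - p₀ * t)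
    {Ω : Type*} {m₁ mΩ : MeasurableSpace Ω} {Pr : Measure Ω} [IsProbabilityMeasure Pr]
    (hm : m₁ ≤ mΩ) {Z : ℕ → Ω → Vec n₀} (hZ : ∀ i, Measurable (Z i)) (hiid : iIndepFun Z Pr)
    (hlaw : ∀ i, Pr.map (Z i) = P.ν)
    (hind : Indep m₁ (MeasurableSpace.comap (fun ω i => Z i ω) inferInstance) Pr)
    {Act : Set Ω} (hAct : MeasurableSet[m₁] Act) {N : Ω → ℕ} {x : Ω → Vec n}
    {Nlow t val bound : Ω → ℝ} (hN : Measurable[m₁] N) (hx : Measurable[m₁] x)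
    (hNlow : Measurable[m₁] Nlow) (ht : Measurable[m₁] t) (hval : Measurable[m₁] val)
    (hae : ∀ᵐ ω ∂Pr, ω ∈ Act → x ω ∈ S ∧ Nlow ω ≤ N ω ∧ t ω ≤ t₀)
    (hbound : ∀ ω ∈ Act, Nlow ω ≤ N ω → 0 < val ω → 0 < t ω ∧ 0 < N ω ∧
      val ω * (2 * Real.exp (-2 * N ω * (p₀ * t ω) ^ 2)) ≤ bound ω) :
    ∫⁻ ω in Act, {ω | t ω < |P.QN (N ω) (fun i => Z i ω) (x ω) - P.Q (x ω)|}.indicator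
        (fun ω => ENNReal.ofReal (val ω)) ω ∂Pr
      ≤ ∫⁻ ω in Act, ENNReal.ofReal (bound ω) ∂Pr := by
  have hNr : Measurable[m₁] fun ω => (N ω : ℝ) := measurable_from_top.comp hN
  set E : Set Ω := Act ∩ ({ω | x ω ∈ S} ∩ ({ω | Nlow ω ≤ N ω} ∩ ({ω | t ω ≤ t₀} ∩
    {ω | 0 < val ω}))) with hE
  have hEm : MeasurableSet[m₁] E :=
    hAct.inter ((hx hP.isOpen.measurableSet).inter ((measurableSet_le hNlow hNr).inter
      ((measurableSet_le ht measurable_const).inter (measurableSet_lt measurable_const hval))))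
  have hh : Measurable[m₁] (E.indicator fun ω => ENNReal.ofReal (val ω)) :=
    (ENNReal.measurable_ofReal.comp hval).indicator hEm
  have key := hP.lintegral_QN_dev hp₀ hgrow hm hZ hiid hlaw hind hh hN hx ht (by
    intro ω hω
    have hωE : ω ∈ E := Set.mem_of_indicator_ne_zero hω
    obtain ⟨h1, h2, h3, h4, h5⟩ := hωE
    obtain ⟨h6, h7, -⟩ := hbound ω h1 h3 h5
    exact ⟨h2, h6, h4, h7⟩)
  rw [← lintegral_indicator (hm _ hAct), ← lintegral_indicator (hm _ hAct)]
  refine le_trans (lintegral_mono_ae ?_) (key.trans (lintegral_mono fun ω => ?_))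
  · filter_upwards [hae] with ω hω
    by_cases hA : ω ∈ Act
    · rw [Set.indicator_of_mem hA]
      by_cases hv : 0 < val ω
      · obtain ⟨h1, h2, h3⟩ := hω hA
        have hωE : ω ∈ E := ⟨hA, h1, h2, h3, hv⟩
        rw [Set.indicator_apply, Set.indicator_apply, Set.indicator_of_mem hωE]
      · have : ENNReal.ofReal (val ω) = 0 := ENNReal.ofReal_eq_zero.2 (not_lt.1 hv)
        simp [Set.indicator_apply, this]
    · rw [Set.indicator_of_notMem hA]; exact zero_le
  · by_cases hωE : ω ∈ E
    · have hωE' := hωE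
      obtain ⟨h1, h2, h3, h4, h5⟩ := hωE'
      rw [Set.indicator_of_mem hωE, Set.indicator_of_mem h1, ← ENNReal.ofReal_mul h5.le]
      exact ENNReal.ofReal_le_ofReal (hbound ω h1 h3 h5).2.2
    · rw [Set.indicator_of_notMem hωE, zero_mul]; exact zero_le

/-! ### Numerical tail bounds -/

theorem two_mul_exp_neg_le {y : ℝ} (hy : 0 < y) : 2 * Real.exp (-y) ≤ 4 / y ^ 2 := by
  have h := Real.quadratic_le_exp_of_nonneg hy.le
  rw [Real.exp_neg, ← div_eq_mul_inv, div_le_div_iff₀ (Real.exp_pos y) (by positivity)]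
  nlinarith

theorem two_mul_exp_neg_le_div {y : ℝ} (hy : 0 < y) : 2 * Real.exp (-y) ≤ 2 / y := by
  have h := Real.add_one_le_exp y
  rw [Real.exp_neg, ← div_eq_mul_inv, div_le_div_iff₀ (Real.exp_pos y) hy]
  nlinarith

/-- The exponent is at least `2w²/p₁`, and the quadratic lower bound of the exponential yields
`w⁻⁴`: one power more than the cubed floor `(M w)³` costs. -/
theorem Tuning.tail_le {A : Params} {n l : ℕ} {b p₀ t₀ : ℝ} (T : Tuning A n l b p₀ t₀)
    (hp₀ : 0 < p₀) {N w Δ : ℝ} (hw : 1 ≤ w) (hΔ : 0 < Δ) (hN : T.C₀ * w ^ 2 / Δ ^ 4 ≤ N) :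
    2 * Real.exp (-2 * N * (p₀ * (T.t₁ * Δ ^ 2)) ^ 2) ≤ T.p₁ / w ^ 4 := by
  have hp₁ := T.p₁_pos
  have ht₁ := T.t₁_pos
  have hy : 2 * w ^ 2 / T.p₁ ≤ 2 * N * (p₀ * (T.t₁ * Δ ^ 2)) ^ 2 := by
    rw [div_le_iff₀ (by positivity)] at hN ⊢
    have h1 := mul_le_mul_of_nonneg_right hN
      (by positivity : 0 ≤ 2 * (p₀ ^ 2 * T.t₁ ^ 2 * T.p₁))
    have h2 := mul_le_mul_of_nonneg_right T.C₀_ge (by positivity : 0 ≤ 2 * w ^ 2)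
    nlinarith
  have hy0 : 0 < 2 * w ^ 2 / T.p₁ := by positivity
  have h := two_mul_exp_neg_le (lt_of_lt_of_le hy0 hy)
  have e : -2 * N * (p₀ * (T.t₁ * Δ ^ 2)) ^ 2 = -(2 * N * (p₀ * (T.t₁ * Δ ^ 2)) ^ 2) := by ring
  rw [e]
  refine h.trans ?_
  have h2 : 4 / (2 * N * (p₀ * (T.t₁ * Δ ^ 2)) ^ 2) ^ 2 ≤ 4 / (2 * w ^ 2 / T.p₁) ^ 2 := by
    gcongr
  refine h2.trans ?_
  have e2 : 4 / (2 * w ^ 2 / T.p₁) ^ 2 = T.p₁ ^ 2 / w ^ 4 := by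
    field_simp; norm_num
  rw [e2]
  gcongr
  nlinarith [T.p₁_le_one]

/-- The factor `w²` in `N` cancels the `1/w` in the threshold, leaving an exponent of order `u²/Δ⁴`.
Already `exp y ≥ y` bounds the product by a multiple of `Δ⁴/u`, and `u > η₁η₂Δ²/2` makes this a
small multiple of `Δ²`. -/
theorem Tuning.excess_tail_le {A : Params} (hA : A.Valid) {n l : ℕ} {b p₀ t₀ : ℝ}
    (T : Tuning A n l b p₀ t₀) (hp₀ : 0 < p₀) {N w Δ u : ℝ} (hw : 1 ≤ w) (hΔ : 0 < Δ)
    (hN : T.C₀ * w ^ 2 / Δ ^ 4 ≤ N) (hu : A.η₁ * A.η₂ * Δ ^ 2 / 2 < u) :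
    u * (2 * Real.exp (-2 * N * (p₀ * (T.t₃ * u / w)) ^ 2)) ≤ T.c₁ * Δ ^ 2 / 4 := by
  have hη : 0 < A.η₁ * A.η₂ := mul_pos hA.η₁_pos hA.η₂_pos
  have ht₃ := T.t₃_pos
  have hc₁ := T.c₁_pos
  have hu0 : 0 < u := lt_of_le_of_lt (by positivity) hu
  have hw0 : 0 < w := by linarith
  have hC₀ : 0 < T.C₀ := by
    have h8 := T.C₀_ge_decrease
    by_contra! h
    have : T.C₀ * (p₀ ^ 2 * T.t₃ ^ 2 * (A.η₁ * A.η₂) * T.c₁) ≤ 0 :=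
      mul_nonpos_of_nonpos_of_nonneg h (by positivity)
    linarith
  have hy : 2 * T.C₀ * p₀ ^ 2 * T.t₃ ^ 2 * u ^ 2 / Δ ^ 4 ≤ 2 * N * (p₀ * (T.t₃ * u / w)) ^ 2 := by
    have h1 := mul_le_mul_of_nonneg_right hN
      (by positivity : 0 ≤ 2 * (p₀ * (T.t₃ * u / w)) ^ 2)
    have e : T.C₀ * w ^ 2 / Δ ^ 4 * (2 * (p₀ * (T.t₃ * u / w)) ^ 2)
        = 2 * T.C₀ * p₀ ^ 2 * T.t₃ ^ 2 * u ^ 2 / Δ ^ 4 := by field_simp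
    linarith
  have hy0 : 0 < 2 * T.C₀ * p₀ ^ 2 * T.t₃ ^ 2 * u ^ 2 / Δ ^ 4 := by positivity
  have h := two_mul_exp_neg_le_div (lt_of_lt_of_le hy0 hy)
  have e : -2 * N * (p₀ * (T.t₃ * u / w)) ^ 2 = -(2 * N * (p₀ * (T.t₃ * u / w)) ^ 2) := by ring
  rw [e]
  have h2 : 2 / (2 * N * (p₀ * (T.t₃ * u / w)) ^ 2)
      ≤ 2 / (2 * T.C₀ * p₀ ^ 2 * T.t₃ ^ 2 * u ^ 2 / Δ ^ 4) := by gcongr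
  have h3 := mul_le_mul_of_nonneg_left (h.trans h2) hu0.le
  refine h3.trans ?_
  have e2 : u * (2 / (2 * T.C₀ * p₀ ^ 2 * T.t₃ ^ 2 * u ^ 2 / Δ ^ 4))
      = Δ ^ 4 / (T.C₀ * p₀ ^ 2 * T.t₃ ^ 2 * u) := by field_simp
  rw [e2, div_le_iff₀ (by positivity)]
  have h5 := mul_le_mul_of_nonneg_right T.C₀_ge_decrease (by positivity : 0 ≤ Δ ^ 4 / 8)
  have h6 : (T.C₀ * p₀ ^ 2 * T.t₃ ^ 2 * T.c₁ * Δ ^ 2 / 4) * (A.η₁ * A.η₂ * Δ ^ 2 / 2)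
      ≤ (T.C₀ * p₀ ^ 2 * T.t₃ ^ 2 * T.c₁ * Δ ^ 2 / 4) * u :=
    mul_le_mul_of_nonneg_left hu.le (by positivity)
  nlinarith

/-- The drift of the potential in numbers. -/
theorem Tuning.drift_le {A : Params} (hA : A.Valid) {n l : ℕ} {b p₀ t₀ : ℝ}
    (T : Tuning A n l b p₀ t₀) {r w Y V Δ : ℝ} (hr : 0 < r) (hw : 1 ≤ w) (hY : 0 < Y)
    (hM : 0 < T.M) (hYM : T.M * w ≤ Y) (hΔ : A.Δ₀ * r ≤ Δ) :
    r ^ 3 * max (T.a * Y) (T.M * w) ^ 3 + T.C₁ * r / w * (V - T.c₁ * Δ ^ 2)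
      + ((2 * n + 3) * (r ^ 3 * (Y ^ 3 / A.γdec ^ 3) * (T.p₁ / w ^ 4))
        + 2 * (T.C₁ * r / w * (T.c₁ * Δ ^ 2 / 4))) + r ^ 3 / w
      ≤ r ^ 3 * Y ^ 3 + T.C₁ * r / w * V := by
  have hγ := hA.γdec_pos
  have ha := T.a_pos
  have ha1 := T.a_lt
  have hc₁ := T.c₁_pos
  have hp₁ := T.p₁_pos
  have hw0 : 0 < w := by linarith
  have hΔ₀ := hA.Δ₀_pos
  have hC₅ : 0 ≤ T.C₅ := le_trans (by positivity) T.C₅_ge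
  have hC₁ : 0 ≤ T.C₁ := by
    have h1 := T.C₁_ge
    by_contra! h
    have : T.C₁ * (T.c₁ * A.Δ₀ ^ 2) ≤ 0 := mul_nonpos_of_nonpos_of_nonneg h.le (by positivity)
    nlinarith
  have hq : (2 * n + 3) * (T.p₁ / A.γdec ^ 3) ≤ 1 - T.a ^ 3 := by
    rw [mul_div_assoc', div_le_iff₀ (by positivity)]
    exact T.p₁_le
  have hq0 : 0 ≤ (2 * n + 3) * (T.p₁ / A.γdec ^ 3) := by positivity
  have ha3 : 0 < T.a ^ 3 := by positivity
  have hY3 : 0 < Y ^ 3 := by positivity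
  have hw4 : 1 ≤ w ^ 4 := one_le_pow₀ hw
  have key : max (T.a * Y) (T.M * w) ^ 3 + (2 * n + 3) * (T.p₁ / A.γdec ^ 3) * (Y ^ 3 / w ^ 4)
      ≤ Y ^ 3 + T.C₅ / w := by
    -- Above the floor the contraction `1 - a³` pays for failures. Otherwise `Y ≤ (M/a) w`, so
    -- `Y³/w⁴` is at most `C₅/w`, which is left to the energy.
    rcases le_total (T.M * w) (T.a * Y) with h | h
    · rw [max_eq_left h, mul_pow]
      have h1 : Y ^ 3 / w ^ 4 ≤ Y ^ 3 := div_le_self hY3.le hw4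
      have h2 : (2 * n + 3) * (T.p₁ / A.γdec ^ 3) * (Y ^ 3 / w ^ 4) ≤ (1 - T.a ^ 3) * Y ^ 3 :=
        mul_le_mul hq h1 (by positivity) (by linarith)
      have : 0 ≤ T.C₅ / w := by positivity
      linarith
    · rw [max_eq_right h]
      have h1 : (T.M * w) ^ 3 ≤ Y ^ 3 := pow_le_pow_left₀ (by positivity) hYM 3
      have h2 : Y ≤ T.M / T.a * w := by
        rw [div_mul_eq_mul_div, le_div_iff₀ ha]; linarith
      have h3 : Y ^ 3 / w ^ 4 ≤ (T.M / T.a) ^ 3 / w := by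
        rw [div_le_div_iff₀ (by positivity) hw0]
        have h4 := pow_le_pow_left₀ hY.le h2 3
        rw [mul_pow] at h4
        calc Y ^ 3 * w ≤ (T.M / T.a) ^ 3 * w ^ 3 * w := by gcongr
          _ = _ := by ring
      have h4 : (T.M / T.a) ^ 3 / w ≤ T.C₅ / w := by
        gcongr; exact T.C₅_ge
      have h5 : (2 * n + 3) * (T.p₁ / A.γdec ^ 3) * (Y ^ 3 / w ^ 4) ≤ 1 * (Y ^ 3 / w ^ 4) :=
        mul_le_mul_of_nonneg_right (by linarith) (by positivity)
      linarith
  have h1 := mul_le_mul_of_nonneg_left key (by positivity : 0 ≤ r ^ 3)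
  have e1 : (2 * n + 3) * (r ^ 3 * (Y ^ 3 / A.γdec ^ 3) * (T.p₁ / w ^ 4))
      = r ^ 3 * ((2 * n + 3) * (T.p₁ / A.γdec ^ 3) * (Y ^ 3 / w ^ 4)) := by
    field_simp
  -- The two excess terms, `c₁Δ²/4` each, use up the other half of the energy decrease.
  have h2 : r ^ 3 * (T.C₅ + 1) / w ≤ T.C₁ * r / w * (T.c₁ * Δ ^ 2 / 2) := by
    rw [div_mul_eq_mul_div, div_le_div_iff_of_pos_right hw0]
    have h3 : (A.Δ₀ * r) ^ 2 ≤ Δ ^ 2 := pow_le_pow_left₀ (by positivity) hΔ 2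
    have h4 := mul_le_mul_of_nonneg_left h3 (by positivity : 0 ≤ T.C₁ * r * T.c₁ / 2)
    have h5 := mul_le_mul_of_nonneg_left T.C₁_ge (by positivity : 0 ≤ r ^ 3 / 2)
    nlinarith
  have e2 : r ^ 3 * (T.C₅ + 1) / w = r ^ 3 * (T.C₅ / w) + r ^ 3 / w := by field_simp
  rw [e1]
  rw [e2] at h2
  linarith

/-! ### Drift of the potential in expectation -/

namespace Problem

variable {n n₀ l : ℕ} {P : Problem n n₀ l} {S : Set (Vec n)} {Lf Lg : ℝ}
  {Ω : Type*} {_ : MeasurableSpace Ω} {x : Ω → Vec n} {ρ : Ω → ℝ} {μ : Ω → Fin (l + 1) → ℝ}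

theorem Regular.measurable_g (hP : P.Regular S Lf Lg) (i : Fin (l + 1)) : Measurable (P.g i) := by
  refine Fin.cases ?_ (fun i => ?_) i
  · exact hP.measurable_Q
  · exact (hP.diff_c₂ i).continuous.measurable

theorem Regular.measurable_Phi (hP : P.Regular S Lf Lg) (hρ : Measurable ρ)
    (hμ : ∀ i, Measurable fun ω => μ ω i) (hx : Measurable x) :
    Measurable fun ω => P.Phi (ρ ω) (μ ω) (x ω) := by
  unfold Phi augLagrangian
  exact (hP.diff_f.continuous.measurable.comp hx).add ((hρ.div_const 2).mul
    (Finset.measurable_sum _ fun i _ => ((measurable_const.max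
      (((hP.measurable_g i).comp hx).add ((hμ i).div hρ))).pow_const 2)))

theorem Regular.measurable_dPhi (hP : P.Regular S Lf Lg) (hρ : Measurable ρ)
    (hμ : ∀ i, Measurable fun ω => μ ω i) (hx : Measurable x) :
    Measurable fun ω => P.dPhi (ρ ω) (μ ω) (x ω) := by
  unfold dPhi
  exact ((measurable_gradient _).comp hx).add (Finset.measurable_sum _ fun i _ =>
    Measurable.smul (measurable_const.max ((hρ.mul ((hP.measurable_g i).comp hx)).add (hμ i)))
      ((measurable_gradient _).comp hx))

theorem measurable_weight (hρ : Measurable ρ) (hμ : ∀ i, Measurable fun ω => μ ω i) :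
    Measurable fun ω => weight (ρ ω) (μ ω) := by
  unfold weight
  exact (measurable_const.add (Finset.measurable_sum _ fun i _ => hμ i)).add hρ

theorem Regular.measurableSet_QN_dev (hP : P.Regular S Lf Lg) {N : Ω → ℕ} {z : Ω → ℕ → Vec n₀}
    {t : Ω → ℝ} (hN : Measurable N) (hz : Measurable z) (hx : Measurable x) (ht : Measurable t) :
    MeasurableSet {ω | t ω < |P.QN (N ω) (z ω) (x ω) - P.Q (x ω)|} :=
  measurableSet_lt ht ((hP.measurable_QN hN hz hx).sub (hP.measurable_Q.comp hx)).norm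

end Problem

namespace Run

variable {n n₀ l : ℕ} {P : Problem n n₀ l} {A : Params} {Ω : Type u} [mΩ : MeasurableSpace Ω]
  {Pr : Measure Ω} {R : Run P A Pr} {S : Set (Vec n)} {Lf Lg b p₀ t₀ : ℝ}
  {T : Tuning A n l b p₀ t₀}

variable (R) in
/-- The state at inner iteration `k` of outer iteration `m` is determined by the draws
whose label satisfies `B`. -/
structure KnownAt (B : Draw → Prop) (m k : ℕ) : Prop where
  start : Measurable[info R.ξ B] (R.X m 0)
  X : Measurable[info R.ξ B] (R.X m k)
  Δ : Measurable[info R.ξ B] (R.Δ m k)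
  r : Measurable[info R.ξ B] (R.r m)
  ρ : Measurable[info R.ξ B] (R.ρ m)
  μbar : ∀ i, Measurable[info R.ξ B] fun ω => R.μbar m ω i
  N : Measurable[info R.ξ B] (R.N m k)
  active : MeasurableSet[info R.ξ B] {ω | R.Active m k ω}

theorem KnownAt.mono {B B' : Draw → Prop} {m k : ℕ} (h : R.KnownAt B m k)
    (hB : ∀ d, B d → B' d) : R.KnownAt B' m k :=
  have hle := info_mono (ξ := R.ξ) hB
  ⟨h.start.mono hle le_rfl, h.X.mono hle le_rfl, h.Δ.mono hle le_rfl, h.r.mono hle le_rfl,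
    h.ρ.mono hle le_rfl, fun i => (h.μbar i).mono hle le_rfl, h.N.mono hle le_rfl, hle _ h.active⟩

theorem knownAt (R : Run P A Pr) (hP : P.Regular S Lf Lg) {m : ℕ} (hm : 1 ≤ m) (k : ℕ) :
    R.KnownAt (Draw.Before m k) m k := by
  have h := R.startMeasurable hP hm
  have h0 := info_mono (ξ := R.ξ) (before_mono (m := m) (Nat.zero_le k))
  have hr := (R.r_adapted m hm).mono h0 le_rfl
  refine ⟨h.X.mono h0 le_rfl, (h.inner hP hm k).1, (h.inner hP hm k).2, hr, h.ρ.mono h0 le_rfl,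
    fun i => (h.μbar i).mono h0 le_rfl, R.N_adapted m k hm, ?_⟩
  have : {ω | R.Active m k ω} = ⋂ j, ⋂ (_ : j < k), {ω | R.r m ω < R.Δ m (j + 1) ω} := by
    ext ω; simp [Active]
  rw [this]
  refine MeasurableSet.iInter fun j => MeasurableSet.iInter fun hj => measurableSet_lt hr ?_
  exact (h.inner hP hm (j + 1)).2.mono (info_mono (before_mono hj)) le_rfl

namespace KnownAt

variable {B : Draw → Prop} {m k : ℕ} (h : R.KnownAt B m k)

include h

theorem w : Measurable[info R.ξ B] (R.w m) := Problem.measurable_weight h.ρ h.μbar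

theorem merit (hP : P.Regular S Lf Lg) {y : Ω → Vec n} (hy : Measurable[info R.ξ B] y) :
    Measurable[info R.ξ B] fun ω => R.merit m ω (y ω) := hP.measurable_Phi h.ρ h.μbar hy

theorem ratio (hP : P.Regular S Lf Lg) (M : ℝ) : Measurable[info R.ξ B] (R.ratio M m k) :=
  (Measurable.div (measurable_norm.comp (hP.measurable_dPhi h.ρ h.μbar h.X)) h.Δ).max
    (h.w.const_mul M)

theorem energy (hP : P.Regular S Lf Lg) (c κ : ℝ) : Measurable[info R.ξ B] (R.energy c κ m k) :=
  (((h.merit hP h.X).sub (h.merit hP h.start)).add (h.w.const_mul c)).add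
    ((h.Δ.pow_const 2).const_mul κ)

theorem modelPt (j : Option (Fin n × Bool)) : Measurable[info R.ξ B] (R.modelPt m k j) := by
  rcases j with _ | ⟨j, _ | _⟩
  · exact h.X
  · exact h.X.sub (Measurable.smul_const (h.Δ.const_mul A.r₀) _)
  · exact h.X.add (Measurable.smul_const (h.Δ.const_mul A.r₀) _)

theorem testPt (hs : Measurable[info R.ξ B] (R.s m k)) (j : Bool) : Measurable[info R.ξ B] (R.testPt m k j) := by
  rcases j with _ | _
  · exact h.X
  · exact h.X.add hs

theorem excess (hP : P.Regular S Lf Lg) (hs : Measurable[info R.ξ B] (R.s m k)) :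
    Measurable[info R.ξ B] (R.excess m k) :=
  ((h.merit hP (h.X.add hs)).sub (h.merit hP h.X)).add ((h.Δ.pow_const 2).const_mul _)

theorem bigExcess (hP : P.Regular S Lf Lg) (hs : Measurable[info R.ξ B] (R.s m k)) :
    Measurable[info R.ξ B] (R.bigExcess m k) :=
  Measurable.ite (measurableSet_lt (((h.Δ.pow_const 2).const_mul _).div_const 2) (h.excess hP hs))
    (h.excess hP hs) measurable_const

end KnownAt

theorem Regular.modelPt_mem {m k : ℕ} {ω : Ω} (hR : R.Regular S b m k ω) (hA : A.Valid)
    (j : Option (Fin n × Bool)) : R.modelPt m k j ω ∈ S := by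
  have hΔ := R.Δ_pos hA hR.one_le k ω
  have hn : ∀ i, ‖(A.r₀ * R.Δ m k ω) • (EuclideanSpace.single i (1 : ℝ) : Vec n)‖ ≤ R.Δ m k ω := by
    intro i
    rw [norm_smul, PiLp.norm_single, norm_one, mul_one,
      Real.norm_of_nonneg (mul_nonneg hA.r₀_pos.le hΔ.le)]
    nlinarith [hA.r₀_lt]
  rcases j with _ | ⟨j, _ | _⟩
  · exact hR.X_mem hA
  · refine hR.ball ?_
    simpa [modelPt, dist_eq_norm] using hn j
  · refine hR.ball ?_
    simpa [modelPt, dist_eq_norm] using hn j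

theorem Regular.testPt_mem {m k : ℕ} {ω : Ω} (hR : R.Regular S b m k ω) (hA : A.Valid)
    (j : Bool) : R.testPt m k j ω ∈ S := by
  rcases j with _ | _
  · exact hR.X_mem hA
  · exact hR.step_mem

/-- Nonnegative multiple of the cubed ratio that is at stake in an inaccurate iteration. -/
def stake (T : Tuning A n l b p₀ t₀) (R : Run P A Pr) (m k : ℕ) (ω : Ω) : ℝ :=
  R.r m ω ^ 3 * (R.ratio T.M m k ω ^ 3 / A.γdec ^ 3)

/-- The value of the potential after an accurate iteration is at most this. -/
def core (T : Tuning A n l b p₀ t₀) (R : Run P A Pr) (m k : ℕ) (ω : Ω) : ℝ :=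
  R.r m ω ^ 3 * max (T.a * R.ratio T.M m k ω) (T.M * R.w m ω) ^ 3
    + T.C₁ * R.r m ω / R.w m ω * (R.energy T.c T.κ m k ω - T.c₁ * R.Δ m k ω ^ 2)

/-- The part of the potential that multiplies the energy. -/
def gain (T : Tuning A n l b p₀ t₀) (R : Run P A Pr) (m : ℕ) (ω : Ω) : ℝ :=
  T.C₁ * R.r m ω / R.w m ω

theorem Tuning_C₁_pos (T : Tuning A n l b p₀ t₀) (hA : A.Valid) (hb : 1 ≤ b) : 0 < T.C₁ := by
  have hM := Tuning_M_pos T hA hb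
  have hc₁ := T.c₁_pos
  have hΔ := hA.Δ₀_pos
  have ha := T.a_pos
  have hC₅ : 0 ≤ T.C₅ := le_trans (by positivity) T.C₅_ge
  have h1 := T.C₁_ge
  by_contra! h
  have : T.C₁ * (T.c₁ * A.Δ₀ ^ 2) ≤ 0 := mul_nonpos_of_nonpos_of_nonneg h (by positivity)
  nlinarith

theorem gain_nonneg (hA : A.Valid) (hb : 1 ≤ b) {m : ℕ} (hm : 1 ≤ m) (ω : Ω) :
    0 ≤ gain T R m ω := by
  have := one_le_w (R := R) (ω := ω) hA hm
  have := R.r_pos m hm ω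
  have := Tuning_C₁_pos T hA hb
  unfold gain
  positivity

theorem stake_nonneg (hA : A.Valid) (hb : 1 ≤ b) {m : ℕ} (hm : 1 ≤ m) (k : ℕ) (ω : Ω) :
    0 ≤ stake T R m k ω := by
  have := R.r_pos m hm ω
  have := ratio_pos (R := R) (T := T) (ω := ω) hA hb hm k
  have := hA.γdec_pos
  unfold stake
  positivity

open Classical in
theorem Regular.potential_next_le {m k : ℕ} {ω : Ω} (hR : R.Regular S b m k ω) (hA : A.Valid)
    (hb : P.BoundedBy S b) : R.potential T m (k + 1) ω ≤ core T R m k ω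
      + ((∑ j, if T.t₁ * R.Δ m k ω ^ 2 < R.modelDev m k j ω then stake T R m k ω else 0)
        + ((∑ j, if T.t₁ * R.Δ m k ω ^ 2 < R.testDev m k j ω then stake T R m k ω else 0)
        + ∑ j, if T.t₃ * R.excess m k ω / R.w m ω < R.testDev m k j ω
            then gain T R m ω * R.bigExcess m k ω else 0)) := by
  have h1 := mul_le_mul_of_nonneg_left (hR.ratio_cube_le (T := T) hA hb)
    (pow_pos (R.r_pos m hR.one_le ω) 3).le
  have h2 := mul_le_mul_of_nonneg_left (hR.energy_next_le (T := T) hA hb)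
    (gain_nonneg (T := T) (R := R) hA hb.one_le hR.one_le ω)
  simp only [mul_add, Finset.mul_sum, mul_ite, mul_zero] at h1 h2
  unfold potential core
  unfold stake
  unfold gain at *
  linarith

theorem Regular.core_nonneg {m k : ℕ} {ω : Ω} (hR : R.Regular S b m k ω) (hA : A.Valid)
    (hb : P.BoundedBy S b) : 0 ≤ core T R m k ω := by
  have h1 := hR.energy_ge (T := T) hA hb
  have h2 := gain_nonneg (T := T) (R := R) hA hb.one_le hR.one_le ω
  have h3 := (R.r_pos m hR.one_le ω).le
  have h4 := (ratio_pos (R := R) (T := T) (ω := ω) hA hb.one_le hR.one_le k).le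
  have h5 : 0 ≤ max (T.a * R.ratio T.M m k ω) (T.M * R.w m ω) :=
    le_max_of_le_left (mul_nonneg T.a_pos.le h4)
  exact add_nonneg (mul_nonneg (pow_nonneg h3 3) (pow_nonneg h5 3))
    (mul_nonneg h2 (sub_nonneg.2 h1))

end Run

theorem ofReal_combination (n : ℕ) {x y u v : ℝ} (hx : 0 ≤ x) (hu : 0 ≤ u) (hv : 0 ≤ v)
    (hy : 0 ≤ y) : ENNReal.ofReal x + ((2 * n + 3) * ENNReal.ofReal u + 2 * ENNReal.ofReal v)
      + ENNReal.ofReal y = ENNReal.ofReal (x + ((2 * n + 3) * u + 2 * v) + y) := by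
  have h : (2 * n + 3 : ENNReal) = ENNReal.ofReal (2 * n + 3) := by
    rw [ENNReal.ofReal_add (by positivity) (by positivity), ENNReal.ofReal_mul (by positivity),
      ENNReal.ofReal_natCast, ENNReal.ofReal_ofNat, ENNReal.ofReal_ofNat]
  have h2 : (2 : ENNReal) = ENNReal.ofReal 2 := ENNReal.ofReal_ofNat 2 |>.symm
  rw [ENNReal.ofReal_add (by positivity) hy, ENNReal.ofReal_add hx (by positivity),
    ENNReal.ofReal_add (by positivity) (by positivity), ENNReal.ofReal_mul (by positivity),
    ENNReal.ofReal_mul (by positivity), ← h, ← h2]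

namespace Run

variable {n n₀ l : ℕ} {P : Problem n n₀ l} {A : Params} {Ω : Type u} [mΩ : MeasurableSpace Ω]
  {Pr : Measure Ω} {R : Run P A Pr} {S : Set (Vec n)} {Lf Lg b p₀ t₀ : ℝ}
  {T : Tuning A n l b p₀ t₀}

/-- The standing assumptions on a run, with the sample-size condition in normalised form. -/
structure Admissible (R : Run P A Pr) (S : Set (Vec n)) (Lf Lg : ℝ)
    (T : Tuning A n l b p₀ t₀) : Prop where
  problem : P.Regular S Lf Lg
  params : A.Valid
  bounded : P.BoundedBy S b
  p₀_pos : 0 < p₀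
  grow : ∀ x ∈ S, ∀ t, 0 < t → t ≤ t₀ →
    1 - P.α + p₀ * t ≤ P.ν.real {z | P.c₁ x z ≤ P.Q x + t} ∧
    P.ν.real {z | P.c₁ x z ≤ P.Q x - t} ≤ 1 - P.α - p₀ * t
  H_le : ∀ m k, 1 ≤ m → ∀ ω, ‖R.H m k ω‖ ≤ b
  stays : R.StaysIn S
  sample : ∀ᵐ ω ∂Pr, ∀ m k, 1 ≤ m → R.Active m k ω →
    T.C₀ * R.w m ω ^ 2 / R.Δ m k ω ^ 4 ≤ (R.N m k ω : ℝ)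

namespace Admissible

theorem regular (h : R.Admissible S Lf Lg T) : ∀ᵐ ω ∂Pr, ∀ m k, 1 ≤ m → R.Active m k ω →
    R.Regular S b m k ω := by
  filter_upwards [h.stays] with ω hω m k hm hact
  exact ⟨hm, hω m 0 hm (Active.zero R m ω)
    (Metric.mem_closedBall_self (R.Δ_pos h.params hm 0 ω).le), hω m k hm hact, h.H_le m k hm ω⟩

theorem sample_pos (h : R.Admissible S Lf Lg T) {m k : ℕ} (hm : 1 ≤ m) {ω : Ω}
    (hN : T.C₀ * R.w m ω ^ 2 / R.Δ m k ω ^ 4 ≤ (R.N m k ω : ℝ)) : 0 < R.N m k ω := by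
  have h1 := one_le_w (R := R) (ω := ω) h.params hm
  have h2 := R.Δ_pos h.params hm k ω
  have h3 := (T.C₀_pos h.p₀_pos)
  have : (0 : ℝ) < T.C₀ * R.w m ω ^ 2 / R.Δ m k ω ^ 4 := by positivity
  exact_mod_cast this.trans_le hN

theorem stake_tail (h : R.Admissible S Lf Lg T) {m k : ℕ} (hm : 1 ≤ m) {ω : Ω}
    (hN : T.C₀ * R.w m ω ^ 2 / R.Δ m k ω ^ 4 ≤ (R.N m k ω : ℝ)) :
    0 < T.t₁ * R.Δ m k ω ^ 2 ∧ 0 < R.N m k ω ∧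
      stake T R m k ω * (2 * Real.exp (-2 * R.N m k ω * (p₀ * (T.t₁ * R.Δ m k ω ^ 2)) ^ 2))
        ≤ stake T R m k ω * (T.p₁ / R.w m ω ^ 4) := by
  have h1 := one_le_w (R := R) (ω := ω) h.params hm
  have h2 := R.Δ_pos h.params hm k ω
  exact ⟨mul_pos T.t₁_pos (by positivity), h.sample_pos hm hN,
    mul_le_mul_of_nonneg_left (T.tail_le h.p₀_pos h1 h2 hN)
      (stake_nonneg h.params h.bounded.one_le hm k ω)⟩

theorem t₁_mul_le (h : R.Admissible S Lf Lg T) {m k : ℕ} (hm : 1 ≤ m) (ω : Ω) :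
    T.t₁ * R.Δ m k ω ^ 2 ≤ t₀ := by
  have h2 := R.Δ_pos h.params hm k ω
  have h3 := R.Δ_le_one h.params hm k ω
  have : R.Δ m k ω ^ 2 ≤ 1 := by nlinarith
  nlinarith [T.t₁_pos, T.t₁_le]

variable [IsProbabilityMeasure Pr]

theorem lintegral_model_dev (h : R.Admissible S Lf Lg T) {m : ℕ} (hm : 1 ≤ m) (k : ℕ)
    (j : Option (Fin n × Bool)) :
    ∫⁻ ω in {ω | R.Active m k ω}, {ω | T.t₁ * R.Δ m k ω ^ 2 < R.modelDev m k j ω}.indicator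
        (fun ω => ENNReal.ofReal (stake T R m k ω)) ω ∂Pr
      ≤ ∫⁻ ω in {ω | R.Active m k ω},
          ENNReal.ofReal (stake T R m k ω * (T.p₁ / R.w m ω ^ 4)) ∂Pr := by
  have hk := R.knownAt h.problem hm k
  refine h.problem.lintegral_batch_le h.p₀_pos h.grow
    (m₁ := info R.ξ (Draw.Before m k)) (info_le R.ξ_measurable)
    (Z := fun i => R.ξ (.model m k i)) (fun i => R.ξ_measurable _)
    (R.ξ_indep.precomp fun i j hij => by simpa using hij) (fun i => R.ξ_law _)
    (indep_info_batch R.ξ_measurable R.ξ_indep (lab := fun i => .model m k i)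
      fun i => by simp [Draw.Before]) hk.active hk.N (hk.modelPt j)
    (((hk.w.pow_const 2).const_mul T.C₀).div (hk.Δ.pow_const 4))
    ((hk.Δ.pow_const 2).const_mul T.t₁)
    ((hk.r.pow_const 3).mul (((hk.ratio h.problem T.M).pow_const 3).div_const _)) ?_
    fun ω _ hN _ => h.stake_tail hm hN
  filter_upwards [h.regular, h.sample] with ω h1 h2 hact
  exact ⟨(h1 m k hm hact).modelPt_mem h.params j, h2 m k hm hact, h.t₁_mul_le hm ω⟩

/-- The trial point depends on the model batch, so the frozen past must include that batch. -/
theorem lintegral_test_dev (h : R.Admissible S Lf Lg T) {m : ℕ} (hm : 1 ≤ m) (k : ℕ) (j : Bool) :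
    ∫⁻ ω in {ω | R.Active m k ω}, {ω | T.t₁ * R.Δ m k ω ^ 2 < R.testDev m k j ω}.indicator
        (fun ω => ENNReal.ofReal (stake T R m k ω)) ω ∂Pr
      ≤ ∫⁻ ω in {ω | R.Active m k ω},
          ENNReal.ofReal (stake T R m k ω * (T.p₁ / R.w m ω ^ 4)) ∂Pr := by
  have hk := (R.knownAt h.problem hm k).mono before_beforeTest
  refine h.problem.lintegral_batch_le h.p₀_pos h.grow
    (m₁ := info R.ξ (Draw.BeforeTest m k)) (info_le R.ξ_measurable)
    (Z := fun i => R.ξ (.test m k i)) (fun i => R.ξ_measurable _)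
    (R.ξ_indep.precomp fun i j hij => by simpa using hij) (fun i => R.ξ_law _)
    (indep_info_batch R.ξ_measurable R.ξ_indep (lab := fun i => .test m k i)
      fun i => by simp [Draw.BeforeTest]) hk.active hk.N (hk.testPt (R.s_adapted m k hm) j)
    (((hk.w.pow_const 2).const_mul T.C₀).div (hk.Δ.pow_const 4))
    ((hk.Δ.pow_const 2).const_mul T.t₁)
    ((hk.r.pow_const 3).mul (((hk.ratio h.problem T.M).pow_const 3).div_const _)) ?_
    fun ω _ hN _ => h.stake_tail hm hN
  filter_upwards [h.regular, h.sample] with ω h1 h2 hact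
  exact ⟨(h1 m k hm hact).testPt_mem h.params j, h2 m k hm hact, h.t₁_mul_le hm ω⟩

/-- The excess involves the exact merit function at the trial point, so it is known before the test
batch is drawn and may serve as threshold and as weight. -/
theorem lintegral_excess_dev (h : R.Admissible S Lf Lg T) {m : ℕ} (hm : 1 ≤ m) (k : ℕ) (j : Bool) :
    ∫⁻ ω in {ω | R.Active m k ω},
        {ω | T.t₃ * R.excess m k ω / R.w m ω < R.testDev m k j ω}.indicator
          (fun ω => ENNReal.ofReal (gain T R m ω * R.bigExcess m k ω)) ω ∂Pr
      ≤ ∫⁻ ω in {ω | R.Active m k ω},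
          ENNReal.ofReal (gain T R m ω * (T.c₁ * R.Δ m k ω ^ 2 / 4)) ∂Pr := by
  have hk := (R.knownAt h.problem hm k).mono before_beforeTest
  have hs := R.s_adapted m k hm
  refine h.problem.lintegral_batch_le h.p₀_pos h.grow
    (m₁ := info R.ξ (Draw.BeforeTest m k)) (info_le R.ξ_measurable)
    (Z := fun i => R.ξ (.test m k i)) (fun i => R.ξ_measurable _)
    (R.ξ_indep.precomp fun i j hij => by simpa using hij) (fun i => R.ξ_law _)
    (indep_info_batch R.ξ_measurable R.ξ_indep (lab := fun i => .test m k i)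
      fun i => by simp [Draw.BeforeTest]) hk.active hk.N (hk.testPt hs j)
    (((hk.w.pow_const 2).const_mul T.C₀).div (hk.Δ.pow_const 4))
    (((hk.excess h.problem hs).const_mul T.t₃).div hk.w)
    (((hk.r.const_mul T.C₁).div hk.w).mul (hk.bigExcess h.problem hs)) ?_ ?_
  · filter_upwards [h.regular, h.sample] with ω h1 h2 hact
    have hw := one_le_w (R := R) (ω := ω) h.params hm
    refine ⟨(h1 m k hm hact).testPt_mem h.params j, h2 m k hm hact, ?_⟩
    rw [div_le_iff₀ (by linarith)]
    have h3 := mul_le_mul_of_nonneg_left ((h1 m k hm hact).excess_le (T := T) h.params h.bounded)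
      T.t₃_pos.le
    have h4 := mul_le_mul_of_nonneg_right T.t₃_le_t₀ (by linarith : 0 ≤ R.w m ω)
    nlinarith
  · intro ω _ hN hpos
    have hw := one_le_w (R := R) (ω := ω) h.params hm
    have hg := gain_nonneg (T := T) (R := R) h.params h.bounded.one_le hm ω
    have hΔ := R.Δ_pos h.params hm k ω
    have hη : 0 < A.η₁ * A.η₂ := mul_pos h.params.η₁_pos h.params.η₂_pos
    by_cases hu : A.η₁ * A.η₂ * R.Δ m k ω ^ 2 / 2 < R.excess m k ω
    · have hu0 : 0 < R.excess m k ω := lt_of_le_of_lt (by positivity) hu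
      refine ⟨div_pos (mul_pos T.t₃_pos hu0) (by linarith), h.sample_pos hm hN, ?_⟩
      have e : R.bigExcess m k ω = R.excess m k ω := if_pos hu
      change gain T R m ω * R.bigExcess m k ω * _ ≤ _
      rw [e, mul_assoc]
      exact mul_le_mul_of_nonneg_left (T.excess_tail_le h.params h.p₀_pos hw hΔ hN hu) hg
    · have e : R.bigExcess m k ω = 0 := if_neg hu
      rw [e, mul_zero] at hpos
      exact absurd hpos (lt_irrefl 0)

/-- The pathwise bound `potential_next_le` is integrated over the active event, each failure term is
replaced by its tail bound, and `Tuning.drift_le` finishes under the integral. -/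
theorem lintegral_drift (h : R.Admissible S Lf Lg T) {m : ℕ} (hm : 1 ≤ m) (k : ℕ) :
    ∫⁻ ω in {ω | R.Active m k ω}, ENNReal.ofReal (R.potential T m (k + 1) ω) ∂Pr
      + ∫⁻ ω in {ω | R.Active m k ω}, ENNReal.ofReal (R.r m ω ^ 3 / R.w m ω) ∂Pr
      ≤ ∫⁻ ω in {ω | R.Active m k ω}, ENNReal.ofReal (R.potential T m k ω) ∂Pr := by
  classical
  have hA := h.params
  have hb := h.bounded
  have hk := R.knownAt h.problem hm k
  have hk' := hk.mono before_beforeTest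
  have hs := R.s_adapted m k hm
  have hle : info R.ξ (Draw.Before m k) ≤ mΩ := info_le R.ξ_measurable
  have hle' : info R.ξ (Draw.BeforeTest m k) ≤ mΩ := info_le R.ξ_measurable
  set Act : Set Ω := {ω | R.Active m k ω} with hActdef
  have hAct : MeasurableSet Act := hle _ hk.active
  set D₁ : Option (Fin n × Bool) → Ω → ENNReal := fun j =>
    {ω | T.t₁ * R.Δ m k ω ^ 2 < R.modelDev m k j ω}.indicator
      (fun ω => ENNReal.ofReal (stake T R m k ω)) with hD₁
  set D₂ : Bool → Ω → ENNReal := fun j =>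
    {ω | T.t₁ * R.Δ m k ω ^ 2 < R.testDev m k j ω}.indicator
      (fun ω => ENNReal.ofReal (stake T R m k ω)) with hD₂
  set D₃ : Bool → Ω → ENNReal := fun j =>
    {ω | T.t₃ * R.excess m k ω / R.w m ω < R.testDev m k j ω}.indicator
      (fun ω => ENNReal.ofReal (gain T R m ω * R.bigExcess m k ω)) with hD₃
  set B₁ : Ω → ℝ := fun ω => stake T R m k ω * (T.p₁ / R.w m ω ^ 4) with hB₁
  set B₂ : Ω → ℝ := fun ω => gain T R m ω * (T.c₁ * R.Δ m k ω ^ 2 / 4) with hB₂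
  have hN := hk.N.mono hle le_rfl
  have hΔ := hk.Δ.mono hle le_rfl
  have hw := hk.w.mono hle le_rfl
  have hr := hk.r.mono hle le_rfl
  have hratio := (hk.ratio h.problem T.M).mono hle le_rfl
  have henergy := (hk.energy h.problem T.c T.κ).mono hle le_rfl
  have hstake : Measurable (stake T R m k) := (hr.pow_const 3).mul ((hratio.pow_const 3).div_const _)
  have hgain : Measurable (gain T R m) := (hr.const_mul T.C₁).div hw
  have hcore : Measurable (core T R m k) :=
    ((hr.pow_const 3).mul (((hratio.const_mul T.a).max (hw.const_mul T.M)).pow_const 3)).add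
      (hgain.mul (henergy.sub ((hΔ.pow_const 2).const_mul T.c₁)))
  have hB₁m : Measurable B₁ := hstake.mul ((hw.pow_const 4).const_div T.p₁)
  have hB₂m : Measurable B₂ := hgain.mul (((hΔ.pow_const 2).const_mul T.c₁).div_const 4)
  have hz1 : Measurable fun ω i => R.ξ (.model m k i) ω :=
    measurable_pi_lambda _ fun i => R.ξ_measurable _
  have hz2 : Measurable fun ω i => R.ξ (.test m k i) ω :=
    measurable_pi_lambda _ fun i => R.ξ_measurable _
  have hbig : Measurable (R.bigExcess m k) := (hk'.bigExcess h.problem hs).mono hle' le_rfl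
  have hexc : Measurable (R.excess m k) := (hk'.excess h.problem hs).mono hle' le_rfl
  have hD₁m : ∀ j, Measurable (D₁ j) := fun j => hstake.ennreal_ofReal.indicator
    (h.problem.measurableSet_QN_dev hN hz1 ((hk.modelPt j).mono hle le_rfl)
      ((hΔ.pow_const 2).const_mul T.t₁))
  have hD₂m : ∀ j, Measurable (D₂ j) := fun j => hstake.ennreal_ofReal.indicator
    (h.problem.measurableSet_QN_dev hN hz2 ((hk'.testPt hs j).mono hle' le_rfl)
      ((hΔ.pow_const 2).const_mul T.t₁))
  have hD₃m : ∀ j, Measurable (D₃ j) := fun j => (hgain.mul hbig).ennreal_ofReal.indicator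
    (h.problem.measurableSet_QN_dev hN hz2 ((hk'.testPt hs j).mono hle' le_rfl)
      ((hexc.const_mul T.t₃).div hw))
  have hite : ∀ (p : Prop) (v : ℝ), ENNReal.ofReal (if p then v else 0)
      = if p then ENNReal.ofReal v else 0 := by
    intro p v; split_ifs <;> simp
  have hreg : ∀ᵐ ω ∂(Pr.restrict Act), R.Regular S b m k ω ∧ R.Active m k ω := by
    filter_upwards [ae_restrict_of_ae h.regular, ae_restrict_mem hAct] with ω h1 h2
    exact ⟨h1 m k hm h2, h2⟩
  have hB₁n : ∀ ω, 0 ≤ B₁ ω := fun ω => by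
    have h1 := one_le_w (R := R) (ω := ω) hA hm
    have h2 := T.p₁_pos
    exact mul_nonneg (stake_nonneg hA hb.one_le hm k ω) (by positivity)
  have hB₂n : ∀ ω, 0 ≤ B₂ ω := fun ω => by
    have h2 := T.c₁_pos
    exact mul_nonneg (gain_nonneg hA hb.one_le hm ω) (by positivity)
  have step : ∫⁻ ω in Act, ENNReal.ofReal (R.potential T m (k + 1) ω) ∂Pr
      ≤ ∫⁻ ω in Act, ENNReal.ofReal (core T R m k ω) ∂Pr
        + ((2 * n + 3) * ∫⁻ ω in Act, ENNReal.ofReal (B₁ ω) ∂Pr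
          + 2 * ∫⁻ ω in Act, ENNReal.ofReal (B₂ ω) ∂Pr) := by
    calc _ ≤ ∫⁻ ω in Act, (ENNReal.ofReal (core T R m k ω)
          + (∑ j, D₁ j ω + (∑ j, D₂ j ω + ∑ j, D₃ j ω))) ∂Pr := by
          refine lintegral_mono_ae ?_
          filter_upwards [hreg] with ω hω
          refine (ENNReal.ofReal_le_ofReal (hω.1.potential_next_le (T := T) hA hb)).trans ?_
          refine ENNReal.ofReal_add_le.trans (add_le_add le_rfl ?_)
          have hsn := stake_nonneg (T := T) (R := R) hA hb.one_le hm k ω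
          refine ENNReal.ofReal_add_le.trans (add_le_add (le_of_eq ?_)
            (ENNReal.ofReal_add_le.trans (add_le_add (le_of_eq ?_) (le_of_eq ?_))))
          · rw [ENNReal.ofReal_sum_of_nonneg fun j _ => by split_ifs <;> [exact hsn; exact le_rfl]]
            simp only [hite, hD₁, Set.indicator_apply, Set.mem_ofPred_eq]
          · rw [ENNReal.ofReal_sum_of_nonneg fun j _ => by split_ifs <;> [exact hsn; exact le_rfl]]
            simp only [hite, hD₂, Set.indicator_apply, Set.mem_ofPred_eq]
          · have hgn : 0 ≤ gain T R m ω * R.bigExcess m k ω := by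
              refine mul_nonneg (gain_nonneg hA hb.one_le hm ω) ?_
              have hη : 0 < A.η₁ * A.η₂ := mul_pos hA.η₁_pos hA.η₂_pos
              unfold bigExcess
              split_ifs with hu
              · exact (lt_of_le_of_lt (by positivity) hu).le
              · exact le_rfl
            rw [ENNReal.ofReal_sum_of_nonneg fun j _ => by split_ifs <;> [exact hgn; exact le_rfl]]
            simp only [hite, hD₃, Set.indicator_apply, Set.mem_ofPred_eq]
      _ = ∫⁻ ω in Act, ENNReal.ofReal (core T R m k ω) ∂Pr
          + (∑ j, ∫⁻ ω in Act, D₁ j ω ∂Pr + (∑ j, ∫⁻ ω in Act, D₂ j ω ∂Pr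
            + ∑ j, ∫⁻ ω in Act, D₃ j ω ∂Pr)) := by
          rw [lintegral_add_left hcore.ennreal_ofReal,
            lintegral_add_left (Finset.measurable_sum _ fun j _ => hD₁m j),
            lintegral_add_left (Finset.measurable_sum _ fun j _ => hD₂m j),
            lintegral_finsetSum _ fun j _ => hD₁m j, lintegral_finsetSum _ fun j _ => hD₂m j,
            lintegral_finsetSum _ fun j _ => hD₃m j]
      _ ≤ ∫⁻ ω in Act, ENNReal.ofReal (core T R m k ω) ∂Pr
          + (∑ _j : Option (Fin n × Bool), ∫⁻ ω in Act, ENNReal.ofReal (B₁ ω) ∂Pr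
            + (∑ _j : Bool, ∫⁻ ω in Act, ENNReal.ofReal (B₁ ω) ∂Pr
            + ∑ _j : Bool, ∫⁻ ω in Act, ENNReal.ofReal (B₂ ω) ∂Pr)) :=
          add_le_add le_rfl (add_le_add
            (Finset.sum_le_sum fun j _ => h.lintegral_model_dev hm k j)
            (add_le_add (Finset.sum_le_sum fun j _ => h.lintegral_test_dev hm k j)
              (Finset.sum_le_sum fun j _ => h.lintegral_excess_dev hm k j)))
      -- There are `2n + 1` model points and two test points: the first bound occurs `2n + 3` times,
      -- the second twice.
      _ = _ := by
          simp only [Finset.sum_const, Finset.card_univ, Fintype.card_option, Fintype.card_prod,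
            Fintype.card_fin, Fintype.card_bool, nsmul_eq_mul]
          push_cast
          ring
  refine (add_le_add_left step _).trans ?_
  have hrw : Measurable fun ω => R.r m ω ^ 3 / R.w m ω := (hr.pow_const 3).div hw
  have e : ∫⁻ ω in Act, ENNReal.ofReal (core T R m k ω) ∂Pr
        + ((2 * n + 3) * ∫⁻ ω in Act, ENNReal.ofReal (B₁ ω) ∂Pr
          + 2 * ∫⁻ ω in Act, ENNReal.ofReal (B₂ ω) ∂Pr)
        + ∫⁻ ω in Act, ENNReal.ofReal (R.r m ω ^ 3 / R.w m ω) ∂Pr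
      = ∫⁻ ω in Act, (ENNReal.ofReal (core T R m k ω)
        + ((2 * n + 3) * ENNReal.ofReal (B₁ ω) + 2 * ENNReal.ofReal (B₂ ω))
        + ENNReal.ofReal (R.r m ω ^ 3 / R.w m ω)) ∂Pr := by
    rw [lintegral_add_right _ hrw.ennreal_ofReal, lintegral_add_left hcore.ennreal_ofReal,
      lintegral_add_left (hB₁m.ennreal_ofReal.const_mul _),
      lintegral_const_mul _ hB₁m.ennreal_ofReal, lintegral_const_mul _ hB₂m.ennreal_ofReal]
  rw [e]
  refine lintegral_mono_ae ?_
  filter_upwards [hreg] with ω hω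
  have hcn := hω.1.core_nonneg (T := T) hA hb
  have hw1 := one_le_w (R := R) (ω := ω) hA hm
  have hr0 := R.r_pos m hm ω
  have e2 : ENNReal.ofReal (core T R m k ω)
        + ((2 * n + 3) * ENNReal.ofReal (B₁ ω) + 2 * ENNReal.ofReal (B₂ ω))
        + ENNReal.ofReal (R.r m ω ^ 3 / R.w m ω)
      = ENNReal.ofReal (core T R m k ω + ((2 * n + 3) * B₁ ω + 2 * B₂ ω)
        + R.r m ω ^ 3 / R.w m ω) :=
    ofReal_combination n hcn (hB₁n ω) (hB₂n ω) (div_nonneg (pow_nonneg hr0.le 3) (by linarith))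
  rw [e2]
  exact ENNReal.ofReal_le_ofReal (T.drift_le hA hr0 hw1
    (ratio_pos (R := R) (T := T) (ω := ω) hA hb.one_le hm k) (Tuning_M_pos T hA hb.one_le)
    (le_max_right _ _) (hω.2.le_Δ hA hm))

end Admissible

end Run

/-! ### Termination and convergence of the inner runs -/

namespace Run

variable {n n₀ l : ℕ} {P : Problem n n₀ l} {A : Params} {Ω : Type u} [mΩ : MeasurableSpace Ω]
  {Pr : Measure Ω} {R : Run P A Pr} {S : Set (Vec n)} {Lf Lg b p₀ t₀ : ℝ}
  {T : Tuning A n l b p₀ t₀}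

theorem measurableSet_active (hP : P.Regular S Lf Lg) {m : ℕ} (hm : 1 ≤ m) (k : ℕ) :
    MeasurableSet {ω | R.Active m k ω} :=
  info_le R.ξ_measurable _ (R.knownAt hP hm k).active

theorem measurable_potential (hP : P.Regular S Lf Lg) {m : ℕ} (hm : 1 ≤ m) (k : ℕ) :
    Measurable (R.potential T m k) := by
  have hk := R.knownAt hP hm k
  have hle : info R.ξ (Draw.Before m k) ≤ mΩ := info_le R.ξ_measurable
  have hr := hk.r.mono hle le_rfl
  have hw := hk.w.mono hle le_rfl
  exact ((hr.pow_const 3).mul (((hk.ratio hP T.M).mono hle le_rfl).pow_const 3)).add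
    (((hr.const_mul T.C₁).div hw).mul ((hk.energy hP T.c T.κ).mono hle le_rfl))

/-- Telescoping with exit: where iteration `k + 1` is no longer active the potential is retained in
the sum, elsewhere the drift inequality applies again. -/
theorem Admissible.sum_le [IsProbabilityMeasure Pr] (h : R.Admissible S Lf Lg T) {m : ℕ}
    (hm : 1 ≤ m) (j : ℕ) :
    ∑ k ∈ Finset.range j,
      (∫⁻ ω in {ω | R.Active m k ω} \ {ω | R.Active m (k + 1) ω},
          ENNReal.ofReal (R.potential T m (k + 1) ω) ∂Pr
        + ∫⁻ ω in {ω | R.Active m k ω}, ENNReal.ofReal (R.r m ω ^ 3 / R.w m ω) ∂Pr)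
      + ∫⁻ ω in {ω | R.Active m j ω}, ENNReal.ofReal (R.potential T m j ω) ∂Pr
      ≤ ∫⁻ ω, ENNReal.ofReal (R.potential T m 0 ω) ∂Pr := by
  induction j with
  | zero =>
    have : {ω | R.Active m 0 ω} = Set.univ := Set.eq_univ_of_forall fun ω => Active.zero R m ω
    simp [this]
  | succ j ih =>
    refine le_trans ?_ ih
    rw [Finset.sum_range_succ, add_assoc]
    refine add_le_add le_rfl ?_
    refine le_trans (le_of_eq ?_) (h.lintegral_drift hm j)
    have hsub : {ω | R.Active m (j + 1) ω} ⊆ {ω | R.Active m j ω} := fun ω hω =>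
      ((R.active_succ m j ω).1 hω).1
    have hsplit := lintegral_inter_add_sdiff (μ := Pr)
      (fun ω => ENNReal.ofReal (R.potential T m (j + 1) ω)) {ω | R.Active m j ω}
      (measurableSet_active (R := R) h.problem hm (j + 1))
    rw [Set.inter_eq_right.2 hsub] at hsplit
    rw [← hsplit]
    ring

/-- Bound for the potential at the start of an outer iteration, if `r w ≤ τ`. -/
def startBound (T : Tuning A n l b p₀ t₀) (τ : ℝ) : ℝ :=
  (T.M * τ) ^ 3 + T.C₁ * (T.c + T.κ) * τ

/-- At the start the ratio equals `M w` and the energy is at most `(c + κ) w`, so the weight `r/w`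
makes the second term of order `r ≤ r w`. -/
theorem Admissible.lintegral_start_le [IsProbabilityMeasure Pr] (h : R.Admissible S Lf Lg T)
    {m : ℕ} (hm : 1 ≤ m) {τ : ℝ} (hτ : ∀ᵐ ω ∂Pr, R.r m ω * R.w m ω ≤ τ) :
    ∫⁻ ω, ENNReal.ofReal (R.potential T m 0 ω) ∂Pr ≤ ENNReal.ofReal (startBound T τ) := by
  have hA := h.params
  have hb := h.bounded
  calc _ ≤ ∫⁻ _, ENNReal.ofReal (startBound T τ) ∂Pr := by
        refine lintegral_mono_ae ?_
        filter_upwards [h.regular, hτ] with ω h1 h2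
        have hR := h1 m 0 hm (Active.zero R m ω)
        have hw := one_le_w (R := R) (ω := ω) hA hm
        have hr := R.r_pos m hm ω
        have hM := Tuning_M_pos T hA hb.one_le
        have hC₁ := Tuning_C₁_pos T hA hb.one_le
        have hc := Tuning_c_pos T hb.one_le
        have hκ := T.κ_pos
        have hΔ₀ := hA.Δ₀_pos
        refine ENNReal.ofReal_le_ofReal ?_
        have e1 : R.ratio T.M m 0 ω = T.M * R.w m ω := by
          refine max_eq_right ?_
          rw [div_le_iff₀ (R.Δ_pos hA hm 0 ω), R.Δ_zero m hm]
          refine (hR.norm_grad_le (T := T) hA hb).trans ?_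
          have := mul_le_mul_of_nonneg_right T.M_ge_start (by linarith : 0 ≤ R.w m ω)
          linarith
        have e2 : R.energy T.c T.κ m 0 ω = T.c * R.w m ω + T.κ * A.Δ₀ ^ 2 := by
          unfold energy
          rw [R.Δ_zero m hm]; ring
        have h3 : R.energy T.c T.κ m 0 ω ≤ (T.c + T.κ) * R.w m ω := by
          rw [e2]
          have : A.Δ₀ ^ 2 ≤ 1 := by nlinarith [hA.Δ₀_lt]
          nlinarith
        have hrw : R.r m ω ≤ R.r m ω * R.w m ω := by nlinarith
        unfold potential startBound
        rw [e1]
        refine add_le_add ?_ ?_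
        · rw [← mul_pow]
          refine pow_le_pow_left₀ (by positivity) ?_ 3
          nlinarith
        · calc T.C₁ * R.r m ω / R.w m ω * R.energy T.c T.κ m 0 ω
              ≤ T.C₁ * R.r m ω / R.w m ω * ((T.c + T.κ) * R.w m ω) := by gcongr
            _ = T.C₁ * (T.c + T.κ) * R.r m ω := by field_simp
            _ ≤ T.C₁ * (T.c + T.κ) * τ := by gcongr; linarith
    _ = _ := by simp

/-- Without termination every iteration is active, so the integral of `r³/w` over that event enters
a bounded sum arbitrarily often. It vanishes, and `r³/w > 0` makes the event null. -/
theorem Admissible.ae_terminates [IsProbabilityMeasure Pr] (h : R.Admissible S Lf Lg T)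
    {m : ℕ} (hm : 1 ≤ m) {τ : ℝ} (hτ : ∀ᵐ ω ∂Pr, R.r m ω * R.w m ω ≤ τ) :
    ∀ᵐ ω ∂Pr, R.Terminates m ω := by
  have hk := R.knownAt h.problem hm 0
  have hle : info R.ξ (Draw.Before m 0) ≤ mΩ := info_le R.ξ_measurable
  have hf : Measurable fun ω => ENNReal.ofReal (R.r m ω ^ 3 / R.w m ω) :=
    (((hk.r.mono hle le_rfl).pow_const 3).div (hk.w.mono hle le_rfl)).ennreal_ofReal
  set NT : Set Ω := {ω | ∀ k, R.Active m k ω} with hNT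
  have hNTm : MeasurableSet NT := by
    have : NT = ⋂ k, {ω | R.Active m k ω} := by ext ω; simp [hNT]
    rw [this]
    exact MeasurableSet.iInter fun k => measurableSet_active h.problem hm k
  set I : ENNReal := ∫⁻ ω in NT, ENNReal.ofReal (R.r m ω ^ 3 / R.w m ω) ∂Pr with hI
  have hbound : ∀ j : ℕ, j * I ≤ ENNReal.ofReal (startBound T τ) := by
    intro j
    refine le_trans ?_ ((h.sum_le hm j).trans (h.lintegral_start_le hm hτ))
    refine le_trans ?_ le_self_add
    calc (j : ENNReal) * I = ∑ _k ∈ Finset.range j, I := by simp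
      _ ≤ _ := Finset.sum_le_sum fun k _ => le_trans
          (lintegral_mono_set fun ω hω => hω k) le_add_self
  have hI0 : I = 0 := by
    by_contra hne
    have hne' : I ≠ ⊤ := by
      intro htop
      have := hbound 1
      rw [htop] at this
      simp at this
    obtain ⟨j, hj⟩ := ENNReal.exists_nat_mul_gt hne (b := ENNReal.ofReal (startBound T τ))
      ENNReal.ofReal_ne_top
    exact absurd (hbound j) (not_le.2 hj)
  rw [hI, lintegral_eq_zero_iff hf, EventuallyEq, ae_restrict_iff' hNTm] at hI0
  filter_upwards [hI0] with ω hω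
  by_contra hT
  have hact : ω ∈ NT := by
    intro k j _
    by_contra hlt
    exact hT ⟨j, not_lt.1 hlt⟩
  have h1 := hω hact
  have hw := one_le_w (R := R) (ω := ω) h.params hm
  have hr := R.r_pos m hm ω
  have : 0 < R.r m ω ^ 3 / R.w m ω := by positivity
  simp only [Pi.zero_apply, ENNReal.ofReal_eq_zero] at h1
  linarith

/-- At the last inner iteration the step is rejected, and the potential after it dominates the
cubed gradient norm at the output. -/
theorem Regular.norm_grad_cube_le {m k : ℕ} {ω : Ω} (hR : R.Regular S b m k ω) (hA : A.Valid)
    (hb : P.BoundedBy S b) (hact : R.Active m k ω) (hr₀ : R.r m ω < A.Δ₀)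
    (hterm : R.Δ m (k + 1) ω ≤ R.r m ω) :
    ‖R.grad m k ω‖ ^ 3 ≤ R.potential T m (k + 1) ω := by
  have hm := hR.one_le
  have hr := R.r_pos m hm ω
  have hΔ := R.Δ_pos hA hm (k + 1) ω
  have hlt : R.r m ω < R.Δ m k ω := by
    rcases k with _ | k
    · rwa [R.Δ_zero m hm]
    · exact hact k (Nat.lt_succ_self k)
  -- Acceptance would give the radius `min 1 (γinc Δ) > r`, since `r < 1` and `r < Δ`.
  have hrej : ¬ R.Accept m k ω := by
    intro hacc
    rw [(R.step_accept hm hacc).2] at hterm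
    have h1 : R.r m ω < A.γinc * R.Δ m k ω := by nlinarith [hA.γinc_gt]
    exact absurd hterm (not_le.2 (lt_min (R.r_lt m hm ω) h1))
  have hX := (R.step_reject hm hrej).1
  have e : R.grad m (k + 1) ω = R.grad m k ω := by unfold grad; rw [hX]
  have h1 : ‖R.grad m k ω‖ ≤ R.r m ω * R.ratio T.M m (k + 1) ω := by
    have h2 : ‖R.grad m (k + 1) ω‖ / R.Δ m (k + 1) ω ≤ R.ratio T.M m (k + 1) ω := le_max_left _ _
    rw [div_le_iff₀ hΔ, e] at h2
    have h3 := ratio_pos (R := R) (T := T) (ω := ω) hA hb.one_le hm (k + 1)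
    nlinarith
  have h4 := pow_le_pow_left₀ (norm_nonneg _) h1 3
  rw [mul_pow] at h4
  have h5 := mul_nonneg (gain_nonneg (T := T) (R := R) hA hb.one_le hm ω)
    (hR.energy_next_nonneg (T := T) hA hb)
  unfold gain at h5
  unfold potential
  linarith

/-- Decomposition by the index of the last inner iteration: Markov's inequality for the potential
after it on each piece, then summation through `sum_le`. -/
theorem Admissible.measure_grad_ge_le [IsProbabilityMeasure Pr] (h : R.Admissible S Lf Lg T)
    {m : ℕ} (hm : 1 ≤ m) {τ : ℝ} (hτ : ∀ᵐ ω ∂Pr, R.r m ω * R.w m ω ≤ τ) (hτΔ : τ < A.Δ₀)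
    {δ : ℝ} (hδ : 0 < δ) :
    ENNReal.ofReal (δ ^ 3) * Pr {ω | δ ≤ ‖gradient (P.Phi (R.ρ m ω) (R.μbar m ω)) (R.x m ω)‖}
      ≤ ENNReal.ofReal (startBound T τ) := by
  have hA := h.params
  set E : ℕ → Set Ω := fun k => {ω | R.Active m k ω} \ {ω | R.Active m (k + 1) ω} with hE
  have hEm : ∀ k, MeasurableSet (E k) := fun k =>
    (measurableSet_active h.problem hm k).diff (measurableSet_active h.problem hm (k + 1))
  set F : ℕ → Set Ω := fun k =>
    E k ∩ {ω | ENNReal.ofReal (δ ^ 3) ≤ ENNReal.ofReal (R.potential T m (k + 1) ω)} with hF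
  have hmarkov : ∀ k, ENNReal.ofReal (δ ^ 3) * Pr (F k)
      ≤ ∫⁻ ω in E k, ENNReal.ofReal (R.potential T m (k + 1) ω) ∂Pr := by
    intro k
    have hp := (measurable_potential (R := R) (T := T) h.problem hm (k + 1)).ennreal_ofReal
    have := mul_meas_ge_le_lintegral (μ := Pr.restrict (E k)) hp (ENNReal.ofReal (δ ^ 3))
    rw [Measure.restrict_apply (measurableSet_le measurable_const hp)] at this
    rw [Set.inter_comm] at this
    exact this
  have hcover : Pr {ω | δ ≤ ‖gradient (P.Phi (R.ρ m ω) (R.μbar m ω)) (R.x m ω)‖}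
      ≤ Pr (⋃ k, F k) := by
    refine measure_mono_ae ?_
    filter_upwards [h.ae_terminates hm hτ, h.regular, hτ] with ω hT hreg hτω hω
    have hne : {k : ℕ | R.Δ m (k + 1) ω ≤ R.r m ω}.Nonempty := hT
    set k := sInf {k : ℕ | R.Δ m (k + 1) ω ≤ R.r m ω} with hk
    have hterm : R.Δ m (k + 1) ω ≤ R.r m ω := Nat.sInf_mem hne
    have hact : R.Active m k ω := fun j hj => not_le.1 (Nat.notMem_of_lt_sInf hj)
    have hnact : ¬ R.Active m (k + 1) ω := fun hc =>
      absurd hterm (not_le.2 ((R.active_succ m k ω).1 hc).2)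
    have hR := hreg m k hm hact
    have hw := one_le_w (R := R) (ω := ω) hA hm
    have hr := R.r_pos m hm ω
    have hrΔ : R.r m ω < A.Δ₀ := by nlinarith
    have hg : gradient (P.Phi (R.ρ m ω) (R.μbar m ω)) (R.x m ω) = R.grad m k ω := by
      rw [R.output m hm ω]
      exact (h.bounded.hasGradientAt_Phi (R.ρ_pos hA hm ω) (hR.X_mem hA)).gradient
    have hω' : δ ≤ ‖R.grad m k ω‖ := by
      have h0 : δ ≤ ‖gradient (P.Phi (R.ρ m ω) (R.μbar m ω)) (R.x m ω)‖ := hω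
      rwa [hg] at h0
    refine Set.mem_iUnion.2 ⟨k, ⟨hact, hnact⟩, ENNReal.ofReal_le_ofReal ?_⟩
    exact (pow_le_pow_left₀ hδ.le hω' 3).trans
      (hR.norm_grad_cube_le hA h.bounded hact hrΔ hterm)
  calc _ ≤ ENNReal.ofReal (δ ^ 3) * ∑' k, Pr (F k) := by
        gcongr
        exact hcover.trans (measure_iUnion_le _)
    _ = ∑' k, ENNReal.ofReal (δ ^ 3) * Pr (F k) := ENNReal.tsum_mul_left.symm
    _ ≤ ∑' k, ∫⁻ ω in E k, ENNReal.ofReal (R.potential T m (k + 1) ω) ∂Pr :=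
        ENNReal.tsum_le_tsum hmarkov
    _ ≤ _ := by
        refine ENNReal.tsum_le_of_sum_range_le fun j => ?_
        refine le_trans ?_ ((h.sum_le hm j).trans (h.lintegral_start_le hm hτ))
        exact le_trans (Finset.sum_le_sum fun k _ => le_self_add) le_self_add

theorem Admissible.tendstoInMeasure [IsProbabilityMeasure Pr] (h : R.Admissible S Lf Lg T)
    {τ : ℕ → ℝ} (hτ : ∀ m, 1 ≤ m → ∀ᵐ ω ∂Pr, R.r m ω * R.w m ω ≤ τ m)
    (hτ0 : Tendsto τ atTop (𝓝 0)) :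
    TendstoInMeasure Pr
      (fun m ω => ‖gradient (P.Phi (R.ρ m ω) (R.μbar m ω)) (R.x m ω)‖) atTop fun _ => 0 := by
  rw [tendstoInMeasure_iff_norm]
  intro δ hδ
  have hstart : Tendsto (fun m => startBound T (τ m)) atTop (𝓝 0) := by
    have : Tendsto (fun m => (T.M * τ m) ^ 3 + T.C₁ * (T.c + T.κ) * τ m) atTop
        (𝓝 ((T.M * 0) ^ 3 + T.C₁ * (T.c + T.κ) * 0)) :=
      ((hτ0.const_mul _).pow 3).add (hτ0.const_mul _)
    simpa [startBound] using this
  have hδ3 : 0 < δ ^ 3 := by positivity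
  have hlim : Tendsto (fun m => ENNReal.ofReal (startBound T (τ m) / δ ^ 3)) atTop (𝓝 0) := by
    have := ENNReal.tendsto_ofReal (hstart.div_const (δ ^ 3))
    simpa using this
  refine tendsto_of_tendsto_of_tendsto_of_le_of_le' tendsto_const_nhds hlim
    (Eventually.of_forall fun _ => zero_le) ?_
  filter_upwards [hτ0.eventually (gt_mem_nhds h.params.Δ₀_pos), eventually_ge_atTop 1] with m h1 h2
  have h3 := h.measure_grad_ge_le h2 (hτ m h2) h1 hδ
  rw [ENNReal.ofReal_div_of_pos hδ3, ENNReal.le_div_iff_mul_le (by simp [hδ3]) (by simp), mul_comm]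
  simpa using h3

end Run

/-! ### The sample-size condition and the radius condition -/

/-- Two of the five terms suffice: the constant one handles the bounded part `W` of `w`, and the
fourth, at most `1/(ρK)²`, handles `ρ`. -/
theorem accFactor_mul_sq_le {A : Params} (hA : A.Valid) {Lg K ρ μ₀ w W : ℝ} (hLg : 0 < Lg)
    (hK : 0 < K) (hρ : 0 < ρ) (hμ₀ : 0 ≤ μ₀) (hw0 : 0 ≤ w) (hw : w ≤ ρ + W) :
    0 < accFactor A 1 Lg K ρ μ₀ ∧
      accFactor A 1 Lg K ρ μ₀ * w ^ 2 ≤ 2 / K ^ 2 + 2 * W ^ 2 * (Lg ^ 2 * A.r₀ ^ 2) := by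
  have h1 := hA.η₁_pos
  have h2 := hA.η₂_pos
  have h3 := hA.θ_pos
  have h4 := hA.r₀_pos
  have hpos : 0 < accFactor A 1 Lg K ρ μ₀ := by
    unfold accFactor
    refine lt_min (by positivity) (lt_min (by positivity) (lt_min ?_ (lt_min ?_ ?_))) <;> positivity
  refine ⟨hpos, ?_⟩
  have ha : accFactor A 1 Lg K ρ μ₀ ≤ Lg ^ 2 * A.r₀ ^ 2 := by
    refine (min_le_left _ _).trans (by simp)
  have hb : accFactor A 1 Lg K ρ μ₀ ≤ 1 / (ρ * K) ^ 2 := by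
    have h5 : accFactor A 1 Lg K ρ μ₀ ≤ 1 ^ 2 * A.η₁ ^ 2 * A.η₂ ^ 2 / (μ₀ + ρ * K) ^ 2 :=
      (min_le_right _ _).trans ((min_le_right _ _).trans ((min_le_right _ _).trans
        (min_le_left _ _)))
    refine h5.trans ?_
    have h6 : A.η₁ ^ 2 ≤ 1 := pow_le_one₀ h1.le hA.η₁_lt.le
    have h7 : A.η₂ ^ 2 ≤ 1 := pow_le_one₀ h2.le hA.η₂_lt.le
    refine div_le_div₀ zero_le_one ?_ (by positivity) ?_
    · nlinarith [sq_nonneg A.η₁, sq_nonneg A.η₂]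
    · exact pow_le_pow_left₀ (by positivity) (by linarith) 2
  have hw2 : w ^ 2 ≤ 2 * ρ ^ 2 + 2 * W ^ 2 := by
    have := pow_le_pow_left₀ hw0 hw 2
    nlinarith [sq_nonneg (ρ - W)]
  calc accFactor A 1 Lg K ρ μ₀ * w ^ 2
      ≤ accFactor A 1 Lg K ρ μ₀ * (2 * ρ ^ 2 + 2 * W ^ 2) := by gcongr
    _ = accFactor A 1 Lg K ρ μ₀ * (2 * ρ ^ 2) + 2 * W ^ 2 * accFactor A 1 Lg K ρ μ₀ := by ring
    _ ≤ 1 / (ρ * K) ^ 2 * (2 * ρ ^ 2) + 2 * W ^ 2 * (Lg ^ 2 * A.r₀ ^ 2) := by gcongr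
    _ = _ := by field_simp

theorem weight_mul_le_trConst {A : Params} {k : ℕ} {K ρ : ℝ} {μ : Fin k → ℝ}
    (hK : 0 ≤ K) (hw : 0 ≤ Problem.weight ρ μ) : Problem.weight ρ μ * K ≤ trConst A K ρ μ := by
  have hL : 0 ≤ Problem.weight ρ μ * K := mul_nonneg hw hK
  have h1 := le_max_left (2 * (Problem.weight ρ μ * K) + 6 * K * Problem.weight ρ μ)
    (max (((3 - A.η₂) * (6 * K * Problem.weight ρ μ) + 4 * (5 * K * Problem.weight ρ μ))
        / (1 - A.η₂)) <|
      max (2 * (Problem.weight ρ μ * K) / (A.γinc - 1))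
        ((Problem.weight ρ μ * K) / A.γinc *
          ((1 - A.γdec) / A.γdec - (1 - A.γinc) / A.γinc)⁻¹))
  refine le_trans ?_ (le_max_right _ _)
  exact le_add_of_nonneg_right (le_trans (by nlinarith) h1)

namespace Run

variable {n n₀ l : ℕ} {P : Problem n n₀ l} {A : Params} {Ω : Type u} [MeasurableSpace Ω]
  {Pr : Measure Ω} {R : Run P A Pr}

theorem w_le {m : ℕ} (hm : 1 ≤ m) (ω : Ω) : R.w m ω ≤ R.ρ m ω + (1 + (l + 1) * max 1 A.μmax) := by
  have h := Finset.sum_le_card_nsmul Finset.univ (R.μbar m ω) (max 1 A.μmax)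
    fun i _ => R.μbar_le hm ω i
  simp only [Finset.card_univ, Fintype.card_fin, nsmul_eq_mul, Nat.cast_add, Nat.cast_one] at h
  unfold w Problem.weight
  linarith

/-- The sample-size condition bounds the sample sizes below by a multiple of `w² / Δ⁴`. -/
theorem SampleSizeCond.le_N (hA : A.Valid) {CS Lg K C₀ : ℝ} (hLg : 0 < Lg) (hK : 0 < K) (hC₀ : 0 < C₀)
    (hCS : C₀ * (2 / K ^ 2 + 2 * (1 + (l + 1) * max 1 A.μmax) ^ 2 * (Lg ^ 2 * A.r₀ ^ 2))
      ≤ CS ^ 2 * ((n : ℝ) ^ 2 * (P.α * (1 - P.α)) * Real.log ((n : ℝ) / A.ε) ^ 3))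
    (h : R.SampleSizeCond CS 1 Lg K) :
    ∀ᵐ ω ∂Pr, ∀ m k, 1 ≤ m → R.Active m k ω →
      C₀ * R.w m ω ^ 2 / R.Δ m k ω ^ 4 ≤ (R.N m k ω : ℝ) := by
  filter_upwards [h] with ω hω m k hm hact
  refine le_trans ?_ (hω m k hm hact)
  have hw := one_le_w (R := R) (ω := ω) hA hm
  have hΔ := R.Δ_pos hA hm k ω
  obtain ⟨ha, haw⟩ := accFactor_mul_sq_le hA hLg hK (R.ρ_pos hA hm ω) (R.μbar_nonneg hA hm ω 0)
    (by linarith) (w_le (R := R) hm ω)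
  rw [div_le_div_iff₀ (by positivity) (by positivity)]
  have h1 := (mul_le_mul_of_nonneg_left haw hC₀.le).trans hCS
  have h2 := mul_le_mul_of_nonneg_right h1 (by positivity : 0 ≤ R.Δ m k ω ^ 4)
  linarith

/-- The radius condition bounds `r w` by a multiple of `1 / m`. -/
theorem mul_w_le (hA : A.Valid) {K σ C : ℝ} (hK : 0 < K) (hσ : 0 < σ) {m : ℕ} (hm : 1 ≤ m)
    {ω : Ω} (h : R.r m ω ≤ C / (R.Psi K m ω * (m : ℝ) ^ (3 + σ))) :
    R.r m ω * R.w m ω ≤ C / K * (1 / (m : ℝ)) := by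
  have hw := one_le_w (R := R) (ω := ω) hA hm
  have hr := R.r_pos m hm ω
  have hm1 : (1 : ℝ) ≤ m := by exact_mod_cast hm
  have hm0 : (0 : ℝ) < m := by linarith
  have hΨ : R.w m ω * K ≤ R.Psi K m ω :=
    (weight_mul_le_trConst hK.le (by change 0 ≤ R.w m ω; linarith)).trans (le_max_right _ _)
  -- A single power of `m` is enough for `r w` to tend to zero.
  have hmσ : (m : ℝ) ≤ (m : ℝ) ^ (3 + σ) := Real.self_le_rpow_of_one_le hm1 (by linarith)
  have hw0 : 0 < R.w m ω := by linarith
  have hwK : 0 < R.w m ω * K := by positivity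
  rw [le_div_iff₀ (mul_pos (by linarith) (by linarith))] at h
  have h1 : R.r m ω * (R.w m ω * K * m) ≤ C :=
    (mul_le_mul_of_nonneg_left (mul_le_mul hΨ hmσ hm0.le (by linarith)) hr.le).trans h
  rw [div_mul_div_comm, mul_one, le_div_iff₀ (by positivity)]
  linarith

end Run

end QuantileALM

end

/-! ### Choice of the constants and conclusion -/

open QuantileALM

theorem mainTheorem10 {n n₀ l : ℕ} (hn : 0 < n)
    (P : QuantileALM.Problem n n₀ l) (S : Set (QuantileALM.Vec n)) (Lf Lg BH K : ℝ)
    (hP : P.Regular S Lf Lg)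
    (hK : Lf + BH + 2 * Lg ≤ K)
    (hKg : ∀ i, ∀ x ∈ S, (‖gradient (P.g i) x‖ + |P.g i x| + Lg) ^ 2 ≤ K)
    (A : QuantileALM.Params) (hA : A.Valid) :
    ∃ CS dS : ℝ, 0 < CS ∧ 0 < dS ∧
      ∀ (Ω : Type u) [MeasurableSpace Ω] (Pr : MeasureTheory.Measure Ω)
        [MeasureTheory.IsProbabilityMeasure Pr] (R : QuantileALM.Run P A Pr),
        (∀ m k, 1 ≤ m → ∀ ω, ‖R.H m k ω‖ ≤ BH) →
        R.StaysIn S →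
        R.SampleSizeCond CS dS Lg K →
        ∀ σ : ℝ, 0 < σ →
        (∃ C : ℝ, ∀ m : ℕ, 1 ≤ m → ∀ᵐ ω ∂Pr,
          R.r m ω ≤ C / (R.Psi K m ω * (m : ℝ) ^ (3 + σ))) →
        (∀ᵐ ω ∂Pr, ∀ m, 1 ≤ m → R.Terminates m ω) ∧
        ∀ M : ℕ → ℕ, StrictMono M → ∀ᵐ ω ∂Pr, ∃ φ : ℕ → ℕ, StrictMono φ ∧
          Filter.Tendsto
            (fun j => ‖gradient (P.Phi (R.ρ (M (φ j)) ω) (R.μbar (M (φ j)) ω))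
              (R.x (M (φ j)) ω)‖)
            Filter.atTop (nhds 0) := by
  -- No run can stay in an empty `S`, because inner iteration `0` is always active.
  rcases S.eq_empty_or_nonempty with rfl | hS
  · refine ⟨1, 1, one_pos, one_pos, fun Ω _ Pr _ R _ hstay _ _ _ _ => ?_⟩
    obtain ⟨ω, hω⟩ := hstay.exists
    exact absurd (hω 1 0 le_rfl (Run.Active.zero R 1 ω)
      (Metric.mem_closedBall_self (R.Δ_pos hA le_rfl 0 ω).le)) (Set.notMem_empty _)
  have hLg := hP.Lg_pos
  have hK0 : 0 < K := by
    obtain ⟨x, hx⟩ := hS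
    exact lt_of_lt_of_le (by positivity) (hKg 0 x hx)
  obtain ⟨p₀, t₀, hp₀, ht₀, hgrow⟩ := hP.exists_cdf_growth
  obtain ⟨b, hb, hBHb⟩ := hP.exists_boundedBy BH hS hKg
  obtain ⟨T⟩ := Tuning.exists hA n l hb.one_le hp₀ ht₀
  set D : ℝ := (n : ℝ) ^ 2 * (P.α * (1 - P.α)) * Real.log ((n : ℝ) / A.ε) ^ 3 with hD
  set E : ℝ := 2 / K ^ 2 + 2 * (1 + (l + 1) * max 1 A.μmax) ^ 2 * (Lg ^ 2 * A.r₀ ^ 2) with hE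
  have hT : 0 < T.C₀ := T.C₀_pos hp₀
  have hD0 : 0 < D := by
    have h1 : (1 : ℝ) ≤ n := by exact_mod_cast hn
    -- Positivity of the logarithm rests on `ε < 1 ≤ n`.
    have h2 : 0 < Real.log ((n : ℝ) / A.ε) :=
      Real.log_pos ((one_lt_div hA.ε_pos).2 (hA.ε_lt.trans_le h1))
    have h3 := hP.alpha_pos
    have h4 := sub_pos.2 hP.alpha_lt
    positivity
  have hE0 : 0 ≤ E := by positivity
  have hq : 0 ≤ T.C₀ * E / D := by positivity
  -- `C_S = 1 + q` with `q = C₀E/D` works because `q ≤ (1 + q)²`; `d_S` is then simply `1`.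
  have hCS : T.C₀ * E ≤ (1 + T.C₀ * E / D) ^ 2 * D := by
    rw [← div_le_iff₀ hD0]
    nlinarith
  refine ⟨1 + T.C₀ * E / D, 1, by linarith, one_pos, ?_⟩
  rintro Ω _ Pr _ R hH hstay hsample σ hσ ⟨C, hC⟩
  have h : R.Admissible S Lf Lg T :=
    ⟨hP, hA, hb, hp₀, hgrow, fun m k hm ω => (hH m k hm ω).trans hBHb, hstay,
      Run.SampleSizeCond.le_N hA hLg hK0 hT hCS hsample⟩
  have hr : ∀ m, 1 ≤ m → ∀ᵐ ω ∂Pr, R.r m ω * R.w m ω ≤ C / K * (1 / (m : ℝ)) := fun m hm => by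
    filter_upwards [hC m hm] with ω hω
    exact Run.mul_w_le hA hK0 hσ hm hω
  refine ⟨?_, fun M hM => ?_⟩
  · rw [ae_all_iff]
    intro m
    by_cases hm : 1 ≤ m
    · filter_upwards [h.ae_terminates hm (hr m hm)] with ω hω _ using hω
    · exact Eventually.of_forall fun ω hm' => absurd hm' hm
  · have h0 : Tendsto (fun m : ℕ => C / K * (1 / (m : ℝ))) atTop (𝓝 0) := by
      simpa using tendsto_one_div_atTop_nhds_zero_nat.const_mul (C / K)
    -- The subsequence obtained from convergence in measure is deterministic: one `φ` serves almost
    -- every outcome.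
    obtain ⟨φ, hφ, hlim⟩ :=
      ((h.tendstoInMeasure hr h0).comp hM.tendsto_atTop).exists_seq_tendsto_ae
    filter_upwards [hlim] with ω hω using ⟨φ, hφ, hω⟩
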